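/- \textbf{Setting.} $\lambda\in\mathbb{N}$ is the security parameter, $\{f_k\}$ is a keyed family of functions $f_k:\{0,1\}^\lambda\to\{0,1\}^{3\lambda}$ with keys $k\in\{0,1\}^\lambda$. A QPT algorithm is a (non-uniform) polynomial-size family of quantum circuits; a function is negligible if it is $\lambda^{-\omega(1)}$. The family $\{f_k\}$ is a \emph{quantum-secure PRF} if $(k,x)\mapsto f_k(x)$ can be evaluated by Boolean circuits of polynomial size and for every QPT oracle algorithm $\mathcal A$ there is a negligible $\mu$ with \[ \bigl|\Pr[1\leftarrow\mathcal A(1^\lambda)^{f_k}]-\Pr[1\leftarrow\mathcal A(1^\lambda)^{g}]\bigr|\le\mu(\lambda)\quad\text{for all }\lambda, \] where $k\in\{0,1\}^\lambda$ and $g:\{0,1\}^\lambda\to\{0,1\}^{3\lambda}$ are uniformly random and an oracle $h$ is accessed in superposition through $|x\rangle|z\rangle\mapsto|x\rangle|z\oplus h(x)\rangle$. \textbf{The scheme $\Pi$.} $\mathsf{Gen}(1^\lambda)$ samples $\mathsf{dk}=(\mathsf{dk}_0,\mathsf{dk}_1)$ uniformly from $\{0,1\}^\lambda\times\{0,1\}^\lambda$.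 $\mathsf{QPKGen}(\mathsf{dk})$ outputs the pure state $|\mathsf{qpk}_0\rangle\otimes|\mathsf{qpk}_1\rangle$, where $|\mathsf{qpk}_b\rangle=2^{-\lambda/2}\sum_{x\in\{0,1\}^\lambda}|x,f_{\mathsf{dk}_b}(x)\rangle$. To encrypt a bit $b$, measure $|\mathsf{qpk}_b\rangle$ in the computational basis; the outcome $(x,y)$ is the classical ciphertext. $\mathsf{Dec}(\mathsf{dk},(x,y))$ is $0$ if $f_{\mathsf{dk}_0}(x)=y$; otherwise it is $1$ if $f_{\mathsf{dk}_1}(x)=y$; otherwise it is $\bot$. \textbf{CCA security.} In the (adaptive) chosen-ciphertext game the challenger samples $\mathsf{dk}\leftarrow\mathsf{Gen}(1^\lambda)$. The adversary may at any time obtain copies of the public key from $\mathsf{QPKGen}(\mathsf{dk})$, and it has classical oracle access to $\mathsf{Dec}(\mathsf{dk},\cdot)$. It sends two messages $m_0,m_1\in\{0,1\}$; the challenger samples a uniform bit $b$ and returns the ciphertext $c^*$ obtained by encrypting $m_b$ with a fresh public key. From then on the decryption oracle answers $\bot$ on $c^*$ and is unchanged on all other inputs. The adversary outputs a bit $b'$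 and wins if $b'=b$. The scheme is \emph{CCA-secure} if for every QPT adversary there is a negligible $\varepsilon$ such that it wins with probability at most $\frac12+\varepsilon(\lambda)$ for all $\lambda$. \textbf{Theorem.} If $\{f_k\}$ is a quantum-secure PRF, then $\Pi$ is CCA-secure. -/

import Mathlib

namespace QuantumPKE

open Matrix

/-! ### Registers, local operators and channels

The computational basis of a register whose qubits are labelled by `ι` is `ι → Bool`. A vector of the
register is a function `(ι → Bool) → ℂ`, and a (sub-normalized) mixed state is a matrix over `ι → Bool`. -/

/-- Bit strings of length `n`. -/
abbrev Bits (n : ℕ) : Type := Fin n → Bool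

/-- Operators on the space of a register with qubits labelled by `ι`. -/
abbrev Op (ι : Type) : Type := Matrix (ι → Bool) (ι → Bool) ℂ

/-- The operator on `m` qubits that acts as `A` on the wires `e` and as the identity elsewhere. -/
def liftOp {ι : Type} [Fintype ι] {m : ℕ} (e : ι ↪ Fin m) (A : Op ι) : Op (Fin m) :=
  Matrix.of fun s t => if ∀ q, (∀ i, e i ≠ q) → s q = t q then A (s ∘ e) (t ∘ e) else 0

/-- The map `ρ ↦ ∑ k, K k ρ (K k)†`, with the Kraus operators `K k` acting on the wires `e`. -/
noncomputable def channel {ι κ : Type} [Fintype ι] [Fintype κ] {m : ℕ} (e : ι ↪ Fin m) (K : κ → Op ι)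
    (ρ : Op (Fin m)) : Op (Fin m) :=
  ∑ k, liftOp e (K k) * ρ * (liftOp e (K k))ᴴ

/-- The unitary evolution `ρ ↦ U ρ U†`, with `U` acting on the wires `e`. -/
noncomputable def applyUnitary {ι : Type} [Fintype ι] {m : ℕ} (e : ι ↪ Fin m) (U : Op ι)
    (ρ : Op (Fin m)) : Op (Fin m) :=
  channel e (fun _ : Unit => U) ρ

/-- The orthogonal projection onto the basis vector `|v⟩`. -/
def basisProj {ι : Type} [Fintype ι] (v : ι → Bool) : Op ι :=
  Matrix.of fun s t => if s = v ∧ t = v then 1 else 0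

/-- Measurement of the wires `e` in the computational basis, restricted to the outcome `v`: the result is
the post-measurement state, scaled by the probability of `v`. -/
noncomputable def postMeasure {ι : Type} [Fintype ι] {m : ℕ} (e : ι ↪ Fin m) (v : ι → Bool)
    (ρ : Op (Fin m)) : Op (Fin m) :=
  channel e (fun _ : Unit => basisProj v) ρ

/-- Measurement of the wires `e` in the computational basis; the outcome stays on the wires. -/
noncomputable def measureWires {ι : Type} [Fintype ι] [DecidableEq ι] {m : ℕ} (e : ι ↪ Fin m)
    (ρ : Op (Fin m)) : Op (Fin m) :=
  channel e (fun v : ι → Bool => basisProj v) ρ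

/-- The contents of the wires `e` are discarded and replaced by a fresh register in the pure state `ψ`. -/
noncomputable def prepare {ι : Type} [Fintype ι] [DecidableEq ι] {m : ℕ} (e : ι ↪ Fin m)
    (ψ : (ι → Bool) → ℂ) (ρ : Op (Fin m)) : Op (Fin m) :=
  channel e (fun v : ι → Bool => Matrix.of fun s t => if t = v then ψ s else 0) ρ

/-- The basis vector `|v⟩`. -/
def ket {ι : Type} [Fintype ι] (v : ι → Bool) : (ι → Bool) → ℂ :=
  fun s => if s = v then 1 else 0

/-- The unitary `|x⟩|z⟩ ↦ |x⟩|z ⊕ g x⟩`. -/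
def xorOp {ι κ : Type} [Fintype ι] [Fintype κ] (g : (ι → Bool) → (κ → Bool)) : Op (ι ⊕ κ) :=
  Matrix.of fun s t =>
    if s = Sum.elim (t ∘ Sum.inl) (fun j => xor (t (Sum.inr j)) (g (t ∘ Sum.inl) j)) then 1 else 0

/-- The state `|0…0⟩⟨0…0|`. -/
def zeroState (m : ℕ) : Op (Fin m) := basisProj (fun _ => false)

/-- The probability that measuring qubit `q` of `ρ` in the computational basis gives `b`. -/
noncomputable def outcomeProb {m : ℕ} (q : Fin m) (b : Bool) (ρ : Op (Fin m)) : ℝ :=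
  ∑ s : Fin m → Bool, if s q = b then (ρ s s).re else 0

/-! ### Quantum oracle circuits -/

/-- A universal set of elementary gates; the index is the number of qubits. -/
inductive Gate : ℕ → Type
  | x : Gate 1
  | h : Gate 1
  | t : Gate 1
  | cnot : Gate 2
  | toffoli : Gate 3

/-- The matrix of an elementary gate. In `cnot` and `toffoli` the last qubit is the target. -/
noncomputable def Gate.op : {k : ℕ} → Gate k → Op (Fin k)
  | _, .x => Matrix.of fun s t => if s 0 = !(t 0) then 1 else 0
  | _, .h => Matrix.of fun s t => (if s 0 && t 0 then -1 else 1) / (Real.sqrt 2 : ℂ)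
  | _, .t => Matrix.of fun s t =>
    if s = t then (if t 0 then Complex.exp (Complex.I * Real.pi / 4) else 1) else 0
  | _, .cnot => Matrix.of fun s t => if s = ![t 0, xor (t 1) (t 0)] then 1 else 0
  | _, .toffoli => Matrix.of fun s t => if s = ![t 0, t 1, xor (t 2) (t 0 && t 1)] then 1 else 0

/-- One step of a circuit on `m` qubits whose oracle calls are described by `O`. -/
inductive Instr (m : ℕ) (O : Type) : Type
  | gate {k : ℕ} (g : Gate k) (e : Fin k ↪ Fin m)
  | measure (q : Fin m)
  | reset (q : Fin m)
  | query (o : O)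

/-- A single wire. -/
def oneWire {m : ℕ} (q : Fin m) : Unit ↪ Fin m := ⟨fun _ => q, fun _ _ _ => rfl⟩

/-- The action of one step on mixed states, for a given behaviour of the oracles. -/
noncomputable def Instr.apply {m : ℕ} {O : Type} (oracle : O → Op (Fin m) → Op (Fin m)) :
    Instr m O → Op (Fin m) → Op (Fin m)
  | .gate g e, ρ => applyUnitary e g.op ρ
  | .measure q, ρ => measureWires (oneWire q) ρ
  | .reset q, ρ => prepare (oneWire q) (ket fun _ => false) ρ
  | .query o, ρ => oracle o ρ

/-- The action of a circuit: its steps are executed from left to right. -/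
noncomputable def run {m : ℕ} {O : Type} (oracle : O → Op (Fin m) → Op (Fin m))
    (P : List (Instr m O)) (ρ : Op (Fin m)) : Op (Fin m) :=
  P.foldl (fun σ i => i.apply oracle σ) ρ

/-- A function `ℕ → ℕ` that is bounded by a polynomial. -/
def PolyBounded (s : ℕ → ℕ) : Prop := ∃ p : Polynomial ℕ, ∀ n, s n ≤ p.eval n

/-- A negligible function, i.e. one of the form `n ^ (-ω(1))`. -/
def Negligible (ε : ℕ → ℝ) : Prop :=
  Asymptotics.SuperpolynomialDecay Filter.atTop (fun n : ℕ => (n : ℝ)) ε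

/-! ### Quantum-secure pseudorandom functions -/

/-- A keyed family of functions `f_k : {0,1}^n → {0,1}^(3n)` with keys `k ∈ {0,1}^n`. -/
abbrev KeyedFun : Type := ∀ n : ℕ, Bits n → Bits n → Bits (3 * n)

/-- Evaluation of a Boolean circuit, given as a straight-line list of NAND gates. Values are numbered in
the order in which they arise, the inputs first; a gate `(i, j)` produces the NAND of values `i` and `j`.
A number without a value is read as `false`. -/
def evalCircuit (C : List (ℕ × ℕ)) (input : List Bool) : List Bool :=
  C.foldl (fun v g => v ++ [!(v.getD g.1 false && v.getD g.2 false)]) input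

/-- The family can be evaluated, as a function of the key and the input, by Boolean circuits of
polynomial size. -/
def EfficientlyComputable (f : KeyedFun) : Prop :=
  ∃ (C : ℕ → List (ℕ × ℕ)) (out : ∀ n, Fin (3 * n) → ℕ),
    PolyBounded (fun n => (C n).length) ∧
    ∀ n (k x : Bits n) (j : Fin (3 * n)),
      (evalCircuit (C n) (List.ofFn k ++ List.ofFn x)).getD (out n j) false = f n k x j

/-- A quantum circuit with oracle access to a function `{0,1}^n → {0,1}^(3n)`. An oracle call is given by
the wires it acts on: an input register `x` and an output register `z`. -/
structure PRFAdversary (n : ℕ) where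
  /-- number of qubits, initially in the state `|0…0⟩` -/
  qubits : ℕ
  /-- the circuit -/
  prog : List (Instr qubits (Fin n ⊕ Fin (3 * n) ↪ Fin qubits))
  /-- the output qubit -/
  out : Fin qubits

/-- The size of the circuit: its number of qubits and of steps. -/
def PRFAdversary.size {n : ℕ} (A : PRFAdversary n) : ℕ := A.qubits + A.prog.length

/-- The probability that the adversary outputs `1`, with superposition access to `g`: every call applies
`|x⟩|z⟩ ↦ |x⟩|z ⊕ g x⟩`. -/
noncomputable def PRFAdversary.acceptProb {n : ℕ} (A : PRFAdversary n) (g : Bits n → Bits (3 * n)) : ℝ :=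
  outcomeProb A.out true (run (fun e ρ => applyUnitary e (xorOp g) ρ) A.prog (zeroState A.qubits))

/-- The expectation of a real-valued function of a uniformly random element. -/
noncomputable def uniformAvg {α : Type} [Fintype α] (F : α → ℝ) : ℝ := (∑ a, F a) / Fintype.card α

/-- `f` can be evaluated efficiently, and no polynomial-size family of quantum circuits with
superposition access to an oracle distinguishes `f_k`, for a uniformly random key `k`, from a uniformly
random function. -/
def IsQuantumSecurePRF (f : KeyedFun) : Prop :=
  EfficientlyComputable f ∧
    ∀ A : ∀ n, PRFAdversary n, PolyBounded (fun n => (A n).size) →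
      ∃ μ : ℕ → ℝ, Negligible μ ∧ ∀ n,
        |uniformAvg (fun k : Bits n => (A n).acceptProb (f n k)) -
          uniformAvg (fun g : Bits n → Bits (3 * n) => (A n).acceptProb g)| ≤ μ n

/-! ### Bit encryption with quantum public keys and classical ciphertexts -/

/-- A bit-encryption scheme with quantum public keys and classical ciphertexts, at one value of the
security parameter: decryption keys in `K`, public keys on a register with qubits labelled by `Q`,
ciphertexts that are bit strings indexed by `C`. -/
structure BitQPKE (K Q C : Type) [Fintype Q] [DecidableEq Q] [Fintype C] [DecidableEq C] where
  /-- the distribution of the decryption key -/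
  gen : PMF K
  /-- the public key, a pure state that is determined by the decryption key -/
  qpk : K → (Q → Bool) → ℂ
  qpk_norm : ∀ dk, ∑ s, ‖qpk dk s‖ ^ 2 = 1
  /-- encryption of a bit is a quantum measurement of the public key: `enc b c` is the measurement
  operator that belongs to the ciphertext `c`, and it yields the recycled public key -/
  enc : Bool → (C → Bool) → Op Q
  enc_complete : ∀ b, ∑ c, (enc b c)ᴴ * enc b c = 1
  /-- decryption; `none` stands for `⊥` -/
  dec : K → (C → Bool) → Option Bool

/-- The probability that encrypting the bit `b` with a fresh public key of `dk` gives the ciphertext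
`c`. -/
noncomputable def BitQPKE.encProb {K Q C : Type} [Fintype Q] [DecidableEq Q] [Fintype C] [DecidableEq C]
    (S : BitQPKE K Q C) (dk : K) (b : Bool) (c : C → Bool) : ℝ :=
  ∑ s, ‖(S.enc b c *ᵥ S.qpk dk) s‖ ^ 2

/-- The oracle calls of a chosen-ciphertext adversary, with the wires that they act on. -/
inductive CCAQuery (m : ℕ) (Q C : Type) : Type
  /-- ask for a copy of the public key, to be delivered on the given wires -/
  | qpk (e : Q ↪ Fin m)
  /-- ask for the decryption of a ciphertext; the answer goes to two further wires -/
  | dec (e : C ⊕ Fin 2 ↪ Fin m)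

/-- The encoding of the answers of the decryption oracle by two bits: `⊥ ↦ 00`, `0 ↦ 10`, `1 ↦ 11`. -/
def encodeAnswer (o : Option Bool) : Bits 2 := ![o.isSome, o.getD false]

/-- The two oracles of the game, for the decryption function `D`. A decryption query is classical: the
query wires are measured, and then the answer is added to the answer wires. -/
noncomputable def ccaOracle {K Q C : Type} [Fintype Q] [DecidableEq Q] [Fintype C] [DecidableEq C]
    (S : BitQPKE K Q C) (dk : K) (D : (C → Bool) → Option Bool) {m : ℕ} :
    CCAQuery m Q C → Op (Fin m) → Op (Fin m)
  | .qpk e, ρ => prepare e (S.qpk dk) ρ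
  | .dec e, ρ => applyUnitary e (xorOp fun c => encodeAnswer (D c))
      (measureWires (Function.Embedding.inl.trans e) ρ)

/-- A quantum adversary in the chosen-ciphertext game. -/
structure CCAAdversary (Q C : Type) where
  /-- number of qubits, initially in the state `|0…0⟩` -/
  qubits : ℕ
  /-- the circuit that is run before the challenge -/
  find : List (Instr qubits (CCAQuery qubits Q C))
  /-- the two wires that are measured to obtain the two messages -/
  msg : Fin 2 ↪ Fin qubits
  /-- the wires on which the challenge ciphertext is delivered -/
  chal : C ↪ Fin qubits
  /-- the circuit that is run after the challenge -/
  guess : List (Instr qubits (CCAQuery qubits Q C))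
  /-- the wire that is measured to obtain the guess -/
  out : Fin qubits

/-- The size of the adversary: its number of qubits and of steps. -/
def CCAAdversary.size {Q C : Type} (A : CCAAdversary Q C) : ℕ :=
  A.qubits + A.find.length + A.guess.length

/-- The probability that the adversary outputs `b'` when the decryption key is `dk` and the challenge bit
is `b`. The adversary runs its first circuit with access to `QPKGen(dk)` and `Dec(dk, ·)` and sends
messages `v 0` and `v 1`; the challenger returns an encryption `c` of `v b` (with a fresh public key); the
adversary runs its second circuit, where the decryption oracle answers `⊥` on `c`. -/
noncomputable def ccaOutputProb {K Q C : Type} [Fintype Q] [DecidableEq Q] [Fintype C] [DecidableEq C]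
    (S : BitQPKE K Q C) (A : CCAAdversary Q C) (dk : K) (b b' : Bool) : ℝ :=
  let ρ := run (ccaOracle S dk (S.dec dk)) A.find (zeroState A.qubits)
  ∑ v : Bits 2, ∑ c : C → Bool,
    S.encProb dk (v (if b then 1 else 0)) c *
      outcomeProb A.out b'
        (run (ccaOracle S dk fun c' => if c' = c then none else S.dec dk c') A.guess
          (prepare A.chal (ket c) (postMeasure A.msg v ρ)))

/-- The probability that the adversary wins the (adaptive) chosen-ciphertext game. -/
noncomputable def ccaWinProb {K Q C : Type} [Fintype K] [Fintype Q] [DecidableEq Q] [Fintype C]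
    [DecidableEq C] (S : BitQPKE K Q C) (A : CCAAdversary Q C) : ℝ :=
  ∑ dk : K, (S.gen dk).toReal * uniformAvg fun b : Bool => ccaOutputProb S A dk b b

/-- Security against adaptive chosen-ciphertext attacks by polynomial-size families of quantum
circuits. -/
def CCASecure {K Q C : ℕ → Type} [∀ n, Fintype (K n)] [∀ n, Fintype (Q n)] [∀ n, DecidableEq (Q n)]
    [∀ n, Fintype (C n)] [∀ n, DecidableEq (C n)] (S : ∀ n, BitQPKE (K n) (Q n) (C n)) : Prop :=
  ∀ A : ∀ n, CCAAdversary (Q n) (C n), PolyBounded (fun n => (A n).size) →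
    ∃ ε : ℕ → ℝ, Negligible ε ∧ ∀ n, ccaWinProb (S n) (A n) ≤ 1 / 2 + ε n

/-! ### The scheme -/

/-- Positions of a string `(x, y)` with `x ∈ {0,1}^n` and `y ∈ {0,1}^(3n)`. -/
abbrev Pos (n : ℕ) : Type := Fin n ⊕ Fin (3 * n)

/-- The state `2^(-n/2) ∑ x, |x, g x⟩`. -/
noncomputable def graphState {n : ℕ} (g : Bits n → Bits (3 * n)) : (Pos n → Bool) → ℂ :=
  fun s => if s ∘ Sum.inr = g (s ∘ Sum.inl) then 1 / (Real.sqrt (2 ^ n) : ℂ) else 0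

theorem graphState_norm {n : ℕ} (g : Bits n → Bits (3 * n)) :
    ∑ s, ‖graphState g s‖ ^ 2 = 1 := by
  rw [← (Equiv.sumArrowEquivProdArrow (Fin n) (Fin (3 * n)) Bool).symm.sum_comp,
    Fintype.sum_prod_type]
  have h : ∀ (x : Bits n) (y : Bits (3 * n)),
      ‖graphState g ((Equiv.sumArrowEquivProdArrow (Fin n) (Fin (3 * n)) Bool).symm (x, y))‖ ^ 2
        = if y = g x then ((2 : ℝ) ^ n)⁻¹ else 0 := by
    intro x y
    have hx : (Equiv.sumArrowEquivProdArrow (Fin n) (Fin (3 * n)) Bool).symm (x, y)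
      = Sum.elim x y := rfl
    rw [hx]
    unfold graphState
    simp only [Sum.elim_comp_inl, Sum.elim_comp_inr]
    by_cases hy : y = g x
    · simp [hy]
    · simp [hy]
  simp [h]

/-- Key pairs `(dk_0, dk_1)`, public keys `|qpk_0⟩ ⊗ |qpk_1⟩` with `|qpk_b⟩ = 2^(-n/2) ∑ x, |x, f_{dk_b} x⟩`
(the qubits of `|qpk_b⟩` are labelled `(b, ·)`). A bit `b` is encrypted by measuring `|qpk_b⟩` in the
computational basis; a ciphertext `(x, y)` is decrypted to `0` if `f_{dk_0} x = y`, otherwise to `1` if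
`f_{dk_1} x = y`, and otherwise to `⊥`. -/
noncomputable def bitScheme (f : KeyedFun) (n : ℕ) :
    BitQPKE (Bits n × Bits n) (Bool × Pos n) (Pos n) where
  gen := PMF.uniformOfFintype (Bits n × Bits n)
  qpk dk := fun s => graphState (f n dk.1) (fun i => s (false, i)) *
    graphState (f n dk.2) (fun i => s (true, i))
  qpk_norm dk := by
    rw [← ((Equiv.boolArrowEquivProd (Pos n → Bool)).symm.trans
      (Equiv.curry Bool (Pos n) Bool).symm).sum_comp, Fintype.sum_prod_type]
    have h : ∀ a b : Pos n → Bool, ‖graphState (f n dk.1) a * graphState (f n dk.2) b‖ ^ 2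
        = ‖graphState (f n dk.1) a‖ ^ 2 * ‖graphState (f n dk.2) b‖ ^ 2 := by
      intro a b
      rw [norm_mul, mul_pow]
    calc _ = ∑ a, ∑ b, ‖graphState (f n dk.1) a * graphState (f n dk.2) b‖ ^ 2 := rfl
      _ = 1 := by simp only [h, ← Finset.mul_sum, graphState_norm, mul_one]
  enc b c := Matrix.diagonal fun s => if (fun i => s (b, i)) = c then 1 else 0
  enc_complete b := by
    simp only [Matrix.diagonal_conjTranspose, Matrix.diagonal_mul_diagonal]
    ext s t
    rw [Matrix.sum_apply]
    by_cases h : s = t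
    · subst h
      simp
    · simp [h]
  dec dk c :=
    if f n dk.1 (c ∘ Sum.inl) = c ∘ Sum.inr then some false
    else if f n dk.2 (c ∘ Sum.inl) = c ∘ Sum.inr then some true
    else none

end QuantumPKE

/-! Fix the message bit that is encrypted. The challenge is then `(x, F x)` with `x` uniform and `F`
the function in one of the two slots. The heart of the proof is that this challenge may be exchanged
for `(x, y)` with `y` uniform and independent of both keys. After the exchange the challenge no
longer depends on the challenge bit, so the probabilities of the outputs 0 and 1, summed over the
messages, add up to 1 (`sum_gameProb_eq_one`). The adversary therefore wins with probability 1/2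
plus the cost of the exchange (`ccaWinProb_le`).

The exchange has three moves: PRF security turns `F` into a random function `g`, a statistical
argument replaces `g x` by `y`, and PRF security turns `g` back into `F`. Because of the last move
both slots end in the same experiment, so the two keys never have to be random functions at once.

The statistical move is `sum_gameProb_le`. Draw a fresh value `z` and, after the challenge, use `g`
with its value at `x` changed to `z`. Public keys move by a vector of norm `O(2^(-n/2))`. Decryption
is punctured at `(x, g x)`, so it changes at most at ciphertexts with second half `z`, which the
adversary cannot know. Exchanging the roles of `g x` and `z` (`sum_update_swap`) then yields a game
with the challenge `(x, y)` and the function `g` after the challenge, but with the value `y` at `x`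
before it. As `x` is not used before the challenge otherwise, that last trace of `y` can be removed
at the same price. Both replacements go call by call (`StepLE.run_of_const_left`,
`StepLE.run_of_const_right`), in hybrids where the replaced call always acts on a state independent
of the random point. The cost of one call is bounded by `IsEffect.prepare_le` for public keys and by
`IsEffect.dec_le` for decryption, where it matters that the query is measured.

The rest is the reduction `exists_reduction`: the whole game has to run on elementary gates with
oracle access to one function only. The other function is evaluated by its Boolean circuit, made
reversible, with the key hardwired; decryption is a reversible program that is uncomputed after its
answer has been copied; public keys come from Hadamard gates and calls. The messages, the output,
the slot, the other key, `x` and possibly `y` are fixed as non-uniform advice, and the circuit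
accepts if the messages and the output are the prescribed ones. Taking the worst parameters at every
`n` gives a single adversary, hence a single negligible bound (`exists_advantage_bound`). -/

namespace QuantumPKE

open Matrix
open scoped ComplexOrder

set_option linter.unusedSectionVars false
set_option linter.unusedSimpArgs false

/-! ### Local operators -/

section LiftOp

variable {ι : Type} {m : ℕ}

/-- `s` with the contents of the wires `e` replaced by `r`. -/
noncomputable def overwrite (e : ι ↪ Fin m) (r : ι → Bool) (s : Fin m → Bool) : Fin m → Bool :=
  Function.extend e r s

@[simp] theorem overwrite_apply (e : ι ↪ Fin m) (r : ι → Bool) (s : Fin m → Bool) (i : ι) :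
    overwrite e r s (e i) = r i := e.injective.extend_apply r s i

theorem overwrite_of_notMem (e : ι ↪ Fin m) (r : ι → Bool) (s : Fin m → Bool) {q : Fin m}
    (h : ∀ i, e i ≠ q) : overwrite e r s q = s q :=
  Function.extend_apply' _ _ _ (by rintro ⟨i, hi⟩; exact h i hi)

@[simp] theorem overwrite_comp (e : ι ↪ Fin m) (r : ι → Bool) (s : Fin m → Bool) :
    overwrite e r s ∘ e = r := by
  funext i; simp

theorem overwrite_injective (e : ι ↪ Fin m) (s : Fin m → Bool) :
    Function.Injective fun r => overwrite e r s := by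
  intro r r' h
  have := congrArg (fun u => u ∘ e) h
  simpa using this

theorem eq_overwrite_iff (e : ι ↪ Fin m) (r : ι → Bool) (s u : Fin m → Bool) :
    u = overwrite e r s ↔ u ∘ e = r ∧ ∀ q, (∀ i, e i ≠ q) → u q = s q := by
  constructor
  · rintro rfl
    exact ⟨overwrite_comp e r s, fun q hq => overwrite_of_notMem e r s hq⟩
  · rintro ⟨rfl, h⟩
    funext q
    by_cases hq : ∃ i, e i = q
    · obtain ⟨i, rfl⟩ := hq
      simp
    · push Not at hq
      rw [overwrite_of_notMem e _ _ hq, h q hq]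

@[simp] theorem overwrite_self (e : ι ↪ Fin m) (s : Fin m → Bool) :
    overwrite e (s ∘ e) s = s :=
  ((eq_overwrite_iff e _ s s).2 ⟨rfl, fun _ _ => rfl⟩).symm

@[simp] theorem overwrite_overwrite (e : ι ↪ Fin m) (r r' : ι → Bool) (s : Fin m → Bool) :
    overwrite e r (overwrite e r' s) = overwrite e r s := by
  rw [eq_overwrite_iff]
  refine ⟨by simp, fun q hq => ?_⟩
  rw [overwrite_of_notMem e _ _ hq, overwrite_of_notMem e _ _ hq]

variable [Fintype ι] [DecidableEq ι]

/-- Row `s` of the lifted operator vanishes except at strings that agree with `s` off the wires `e`,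
and these are parametrized by their contents on `e`. All entrywise formulas for channels rest on
this. -/
theorem sum_liftOp_mul (e : ι ↪ Fin m) (A : Op ι) (s : Fin m → Bool) (φ : (Fin m → Bool) → ℂ) :
    ∑ u, liftOp e A s u * φ u = ∑ r, A (s ∘ e) r * φ (overwrite e r s) := by
  symm
  refine Finset.sum_of_injOn (fun r => overwrite e r s) (overwrite_injective e s).injOn (by simp) ?_ ?_
  · intro u _ hu
    have : ¬ ∀ q, (∀ i, e i ≠ q) → s q = u q := by
      intro h
      exact hu ⟨u ∘ e, by simp, ((eq_overwrite_iff e _ s u).2 ⟨rfl, fun q hq => (h q hq).symm⟩).symm⟩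
    simp [liftOp, this]
  · intro r _
    have : ∀ q, (∀ i, e i ≠ q) → s q = overwrite e r s q :=
      fun q hq => (overwrite_of_notMem e r s hq).symm
    simp only [liftOp, Matrix.of_apply, if_pos this, overwrite_comp]

theorem liftOp_mul_apply (e : ι ↪ Fin m) (A : Op ι) {κ : Type} (X : Matrix (Fin m → Bool) κ ℂ)
    (s : Fin m → Bool) (t : κ) :
    (liftOp e A * X) s t = ∑ r, A (s ∘ e) r * X (overwrite e r s) t := by
  rw [Matrix.mul_apply, sum_liftOp_mul e A s fun u => X u t]

theorem liftOp_conjTranspose (e : ι ↪ Fin m) (A : Op ι) : (liftOp e A)ᴴ = liftOp e Aᴴ := by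
  ext s t
  simp only [liftOp, Matrix.conjTranspose_apply, Matrix.of_apply]
  have : (∀ q, (∀ i, e i ≠ q) → t q = s q) ↔ ∀ q, (∀ i, e i ≠ q) → s q = t q :=
    forall₂_congr fun _ _ => eq_comm
  by_cases h : ∀ q, (∀ i, e i ≠ q) → s q = t q
  · rw [if_pos h, if_pos (this.2 h)]
  · rw [if_neg h, if_neg (mt this.1 h), star_zero]

theorem liftOp_mul (e : ι ↪ Fin m) (A B : Op ι) : liftOp e A * liftOp e B = liftOp e (A * B) := by
  ext s t
  rw [liftOp_mul_apply]
  simp only [liftOp, Matrix.of_apply, overwrite_comp, Matrix.mul_apply]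
  have key : ∀ r, (∀ q, (∀ i, e i ≠ q) → overwrite e r s q = t q) ↔
      ∀ q, (∀ i, e i ≠ q) → s q = t q := fun r =>
    forall₂_congr fun q hq => by rw [overwrite_of_notMem e r s hq]
  simp only [key]
  split_ifs <;> simp

theorem liftOp_add (e : ι ↪ Fin m) (A B : Op ι) : liftOp e (A + B) = liftOp e A + liftOp e B := by
  ext s t
  simp only [liftOp, Matrix.of_apply, Matrix.add_apply]
  split_ifs <;> simp

theorem liftOp_sum (e : ι ↪ Fin m) {κ : Type} [Fintype κ] (A : κ → Op ι) :
    liftOp e (∑ k, A k) = ∑ k, liftOp e (A k) := by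
  ext s t
  simp only [liftOp, Matrix.of_apply, Matrix.sum_apply]
  split_ifs <;> simp

theorem liftOp_smul_one (e : ι ↪ Fin m) (c : ℂ) :
    liftOp e (c • (1 : Op ι)) = c • (1 : Op (Fin m)) := by
  ext s t
  simp only [liftOp, Matrix.of_apply, Matrix.smul_apply, Matrix.one_apply]
  by_cases h : s = t
  · simp [h]
  · rw [if_neg h]
    by_cases h1 : ∀ q, (∀ i, e i ≠ q) → s q = t q
    · rw [if_pos h1, if_neg]
      intro h2
      apply h
      funext q
      by_cases hq : ∃ i, e i = q
      · obtain ⟨i, rfl⟩ := hq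
        exact congrFun h2 i
      · push Not at hq
        exact h1 q hq
    · rw [if_neg h1, smul_zero]

theorem mul_liftOp_conjTranspose_apply (e : ι ↪ Fin m) (A : Op ι) {κ : Type}
    (X : Matrix κ (Fin m → Bool) ℂ) (s : κ) (t : Fin m → Bool) :
    (X * (liftOp e A)ᴴ) s t = ∑ r, X s (overwrite e r t) * star (A (t ∘ e) r) := by
  have h := liftOp_mul_apply e A Xᴴ t s
  have h2 : (X * (liftOp e A)ᴴ) s t = star ((liftOp e A * Xᴴ) t s) := by
    rw [← Matrix.conjTranspose_apply, Matrix.conjTranspose_mul, Matrix.conjTranspose_conjTranspose]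
  rw [h2, h, star_sum]
  simp [mul_comm]

theorem channel_apply {κ : Type} [Fintype κ] (e : ι ↪ Fin m) (K : κ → Op ι) (ρ : Op (Fin m))
    (s t : Fin m → Bool) :
    channel e K ρ s t = ∑ k, ∑ r', (∑ r, K k (s ∘ e) r * ρ (overwrite e r s) (overwrite e r' t)) *
      star (K k (t ∘ e) r') := by
  simp only [channel, Matrix.sum_apply]
  refine Finset.sum_congr rfl fun k _ => ?_
  rw [mul_liftOp_conjTranspose_apply]
  simp only [liftOp_mul_apply]

theorem postMeasure_apply (e : ι ↪ Fin m) (v : ι → Bool) (ρ : Op (Fin m)) (s t : Fin m → Bool) :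
    postMeasure e v ρ s t = if s ∘ e = v ∧ t ∘ e = v then ρ s t else 0 := by
  simp only [postMeasure, channel_apply, basisProj, Matrix.of_apply, Fintype.sum_unique]
  by_cases h : t ∘ e = v
  · by_cases h' : s ∘ e = v
    · subst h
      simp only [h', true_and, ite_mul, one_mul, zero_mul, Finset.sum_ite_eq', Finset.mem_univ, if_true,
        apply_ite (star : ℂ → ℂ), star_one, star_zero, mul_ite, mul_one, mul_zero]
      rw [overwrite_self, ← h', overwrite_self]
    · simp [h']
  · simp [h]

theorem measureWires_eq_sum (e : ι ↪ Fin m) (ρ : Op (Fin m)) :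
    measureWires e ρ = ∑ v, postMeasure e v ρ := by
  simp [measureWires, postMeasure, channel]

theorem measureWires_apply (e : ι ↪ Fin m) (ρ : Op (Fin m)) (s t : Fin m → Bool) :
    measureWires e ρ s t = if s ∘ e = t ∘ e then ρ s t else 0 := by
  rw [measureWires_eq_sum, Matrix.sum_apply]
  simp only [postMeasure_apply]
  by_cases h : s ∘ e = t ∘ e
  · simp [h]
  · rw [if_neg h]
    refine Finset.sum_eq_zero fun v _ => if_neg ?_
    rintro ⟨rfl, h'⟩
    exact h h'.symm

/-- The Kraus operators are `|ψ⟩⟨v|`, so what remains of `ρ` is its partial trace over `e`. -/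
theorem prepare_apply (e : ι ↪ Fin m) (ψ : (ι → Bool) → ℂ) (ρ : Op (Fin m))
    (s t : Fin m → Bool) :
    prepare e ψ ρ s t =
      ψ (s ∘ e) * star (ψ (t ∘ e)) * ∑ v, ρ (overwrite e v s) (overwrite e v t) := by
  simp only [prepare, channel_apply, Matrix.of_apply, Finset.mul_sum]
  refine Finset.sum_congr rfl fun v _ => ?_
  simp only [ite_mul, zero_mul, Finset.sum_ite_eq', Finset.mem_univ, if_true,
        apply_ite (star : ℂ → ℂ), star_zero, mul_ite, mul_zero]
  ring

theorem sum_liftOp_conjTranspose_mul {κ : Type} [Fintype κ] (e : ι ↪ Fin m)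
    (K : κ → Op ι) (c : ℂ) (hK : ∑ k, (K k)ᴴ * K k = c • 1) :
    ∑ k, (liftOp e (K k))ᴴ * liftOp e (K k) = c • (1 : Op (Fin m)) := by
  simp only [liftOp_conjTranspose, liftOp_mul]
  rw [← liftOp_sum, hK, liftOp_smul_one]

theorem trace_channel {κ : Type} [Fintype κ] (e : ι ↪ Fin m)
    (K : κ → Op ι) (c : ℂ) (hK : ∑ k, (K k)ᴴ * K k = c • 1) (ρ : Op (Fin m)) :
    (channel e K ρ).trace = c * ρ.trace := by
  simp only [channel, Matrix.trace_sum]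
  have : ∀ k, (liftOp e (K k) * ρ * (liftOp e (K k))ᴴ).trace =
      ((liftOp e (K k))ᴴ * liftOp e (K k) * ρ).trace := fun k => by
    rw [Matrix.trace_mul_comm, Matrix.mul_assoc]
  simp only [this]
  rw [← Matrix.trace_sum, ← Finset.sum_mul, sum_liftOp_conjTranspose_mul e K c hK]
  simp

theorem posSemidef_channel {κ : Type} [Fintype κ] (e : ι ↪ Fin m) (K : κ → Op ι) {ρ : Op (Fin m)}
    (h : ρ.PosSemidef) : (channel e K ρ).PosSemidef :=
  Matrix.posSemidef_sum _ fun _ _ => h.mul_mul_conjTranspose_same _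

theorem channel_add {κ : Type} [Fintype κ] (e : ι ↪ Fin m) (K : κ → Op ι) (ρ σ : Op (Fin m)) :
    channel e K (ρ + σ) = channel e K ρ + channel e K σ := by
  simp [channel, mul_add, add_mul, Finset.sum_add_distrib]

theorem channel_smul {κ : Type} [Fintype κ] (e : ι ↪ Fin m) (K : κ → Op ι) (c : ℝ) (ρ : Op (Fin m)) :
    channel e K (c • ρ) = c • channel e K ρ := by
  simp [channel, Finset.smul_sum]

end LiftOp

/-! ### Quantum operations and effects -/

/-- A real-linear map on operators that preserves positivity and the trace. -/
structure IsQuantumOp {m : ℕ} (Φ : Op (Fin m) → Op (Fin m)) : Prop where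
  map_add : ∀ ρ σ, Φ (ρ + σ) = Φ ρ + Φ σ
  map_smul : ∀ (c : ℝ) ρ, Φ (c • ρ) = c • Φ ρ
  posSemidef : ∀ {ρ}, ρ.PosSemidef → (Φ ρ).PosSemidef
  trace : ∀ ρ, (Φ ρ).trace = ρ.trace

/-- A real-linear functional on operators that lies between `0` and the trace on positive operators. -/
structure IsEffect {m : ℕ} (F : Op (Fin m) → ℝ) : Prop where
  map_add : ∀ ρ σ, F (ρ + σ) = F ρ + F σ
  map_smul : ∀ (c : ℝ) ρ, F (c • ρ) = c * F ρ
  nonneg : ∀ {ρ}, ρ.PosSemidef → 0 ≤ F ρ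
  le_trace : ∀ {ρ}, ρ.PosSemidef → F ρ ≤ ρ.trace.re

theorem IsQuantumOp.id {m : ℕ} : IsQuantumOp (fun ρ : Op (Fin m) => ρ) :=
  ⟨fun _ _ => rfl, fun _ _ => rfl, fun h => h, fun _ => rfl⟩

theorem IsQuantumOp.comp {m : ℕ} {Φ Ψ : Op (Fin m) → Op (Fin m)} (hΦ : IsQuantumOp Φ)
    (hΨ : IsQuantumOp Ψ) : IsQuantumOp (fun ρ => Φ (Ψ ρ)) :=
  ⟨fun ρ σ => by rw [hΨ.map_add, hΦ.map_add], fun c ρ => by rw [hΨ.map_smul, hΦ.map_smul],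
    fun h => hΦ.posSemidef (hΨ.posSemidef h), fun ρ => by rw [hΦ.trace, hΨ.trace]⟩

theorem IsEffect.comp {m : ℕ} {F : Op (Fin m) → ℝ} {Ψ : Op (Fin m) → Op (Fin m)} (hF : IsEffect F)
    (hΨ : IsQuantumOp Ψ) : IsEffect (fun ρ => F (Ψ ρ)) :=
  ⟨fun ρ σ => by rw [hΨ.map_add, hF.map_add], fun c ρ => by rw [hΨ.map_smul, hF.map_smul],
    fun h => hF.nonneg (hΨ.posSemidef h), fun h => by
      rw [← hΨ.trace]; exact hF.le_trace (hΨ.posSemidef h)⟩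

theorem IsQuantumOp.channel {ι κ : Type} [Fintype ι] [DecidableEq ι] [Fintype κ] {m : ℕ}
    (e : ι ↪ Fin m) (K : κ → Op ι) (hK : ∑ k, (K k)ᴴ * K k = 1) :
    IsQuantumOp (QuantumPKE.channel e K) :=
  ⟨channel_add e K, channel_smul e K, posSemidef_channel e K,
    fun ρ => by rw [trace_channel e K 1 (by rw [hK, one_smul]), one_mul]⟩

theorem IsQuantumOp.applyUnitary {ι : Type} [Fintype ι] [DecidableEq ι] {m : ℕ}
    (e : ι ↪ Fin m) (U : Op ι) (hU : Uᴴ * U = 1) : IsQuantumOp (QuantumPKE.applyUnitary e U) :=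
  IsQuantumOp.channel e _ (by simpa using hU)

theorem basisProj_eq_diagonal {ι : Type} [Fintype ι] [DecidableEq ι] (v : ι → Bool) :
    basisProj v = Matrix.diagonal fun s => if s = v then (1 : ℂ) else 0 := by
  ext s t
  simp only [basisProj, Matrix.of_apply, Matrix.diagonal_apply]
  by_cases h : s = t
  · simp [h]
  · rw [if_neg h, if_neg]
    rintro ⟨rfl, rfl⟩
    exact h rfl

theorem IsQuantumOp.measureWires {ι : Type} [Fintype ι] [DecidableEq ι] {m : ℕ}
    (e : ι ↪ Fin m) : IsQuantumOp (QuantumPKE.measureWires e) := by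
  refine IsQuantumOp.channel e _ ?_
  simp only [basisProj_eq_diagonal, Matrix.diagonal_conjTranspose, Matrix.diagonal_mul_diagonal]
  ext s t
  rw [Matrix.sum_apply]
  by_cases h : s = t
  · subst h
    simp
  · simp [h]

/-- No normalization is assumed, because the formula is also needed for the difference of two public
keys. -/
theorem sum_prepare_kraus {ι : Type} [Fintype ι] [DecidableEq ι] (ψ : (ι → Bool) → ℂ) :
    ∑ v : ι → Bool, (Matrix.of fun s t => if t = v then ψ s else 0 : Op ι)ᴴ *
      (Matrix.of fun s t => if t = v then ψ s else 0 : Op ι) =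
      ((∑ s, ‖ψ s‖ ^ 2 : ℝ) : ℂ) • (1 : Op ι) := by
  ext s t
  simp only [Matrix.sum_apply, Matrix.mul_apply, Matrix.conjTranspose_apply, Matrix.of_apply,
    Matrix.smul_apply, Matrix.one_apply, smul_eq_mul, apply_ite (star : ℂ → ℂ), star_zero, ite_mul,
    zero_mul, mul_ite, mul_zero, mul_one]
  by_cases h : s = t
  · subst h
    simp only [if_true]
    rw [Finset.sum_comm]
    push_cast
    refine Finset.sum_congr rfl fun u _ => ?_
    simp [Complex.conj_mul']
  · rw [if_neg h]
    refine Finset.sum_eq_zero fun v _ => Finset.sum_eq_zero fun u _ => ?_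
    split_ifs <;> simp_all

theorem IsQuantumOp.prepare {ι : Type} [Fintype ι] [DecidableEq ι] {m : ℕ}
    (e : ι ↪ Fin m) (ψ : (ι → Bool) → ℂ) (hψ : ∑ s, ‖ψ s‖ ^ 2 = 1) :
    IsQuantumOp (QuantumPKE.prepare e ψ) :=
  IsQuantumOp.channel e _ (by rw [sum_prepare_kraus, hψ]; simp)

theorem trace_prepare {ι : Type} [Fintype ι] [DecidableEq ι] {m : ℕ} (e : ι ↪ Fin m)
    (ψ : (ι → Bool) → ℂ) (ρ : Op (Fin m)) :
    (prepare e ψ ρ).trace = ((∑ s, ‖ψ s‖ ^ 2 : ℝ) : ℂ) * ρ.trace :=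
  trace_channel e _ _ (sum_prepare_kraus ψ) ρ

theorem sum_norm_ket {ι : Type} [Fintype ι] [DecidableEq ι] (v : ι → Bool) :
    ∑ s, ‖ket v s‖ ^ 2 = 1 := by
  simp [ket, apply_ite (norm : ℂ → ℝ), ite_pow]

theorem permutation_unitary {α : Type} [Fintype α] [DecidableEq α] (π : α → α)
    (hπ : Function.Injective π) :
    (Matrix.of fun s t => if s = π t then (1 : ℂ) else 0 : Matrix α α ℂ)ᴴ *
      (Matrix.of fun s t => if s = π t then (1 : ℂ) else 0) = 1 := by
  ext s t
  simp only [Matrix.mul_apply, Matrix.conjTranspose_apply, Matrix.of_apply, Matrix.one_apply,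
    apply_ite (star : ℂ → ℂ), star_zero, star_one, ite_mul, one_mul, zero_mul, Finset.sum_ite_eq',
    Finset.sum_ite_eq, Finset.mem_univ, if_true]
  simp [hπ.eq_iff]

/-- The classical map underlying `xorOp`. -/
def xorMap {ι κ : Type} (g : (ι → Bool) → (κ → Bool)) (t : ι ⊕ κ → Bool) : ι ⊕ κ → Bool :=
  Sum.elim (t ∘ Sum.inl) (fun j => xor (t (Sum.inr j)) (g (t ∘ Sum.inl) j))

theorem xorMap_involutive {ι κ : Type} (g : (ι → Bool) → (κ → Bool)) :
    Function.Involutive (xorMap g) := by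
  intro t
  funext j
  cases j with
  | inl i => rfl
  | inr j => simp [xorMap]

theorem xorOp_unitary {ι κ : Type} [Fintype ι] [Fintype κ] [DecidableEq ι] [DecidableEq κ]
    (g : (ι → Bool) → (κ → Bool)) : (xorOp g)ᴴ * xorOp g = 1 := by
  have h : xorOp g = Matrix.of fun s t => if s = xorMap g t then (1 : ℂ) else 0 := by
    ext s t
    simp only [xorOp, xorMap, Matrix.of_apply]
    congr
  rw [h]
  exact permutation_unitary (xorMap g) (xorMap_involutive g).injective

theorem Gate.op_unitary {k : ℕ} (g : Gate k) : (g.op)ᴴ * g.op = 1 := by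
  cases g with
  | x =>
    have := permutation_unitary (fun t : Fin 1 → Bool => fun i => !(t i))
      (fun s t h => by funext i; simpa using congrFun h i)
    have h : Gate.x.op = Matrix.of fun s t : Fin 1 → Bool => if s = (fun i => !(t i)) then (1 : ℂ) else 0 := by
      ext s t
      have : s = (fun i => !(t i)) ↔ s 0 = !(t 0) :=
        ⟨fun h => congrFun h 0, fun h => by funext i; rw [Subsingleton.elim i 0]; exact h⟩
      simp only [Gate.op, Matrix.of_apply, this]
    rw [h]
    exact this
  | h =>
    have h2 : ((Real.sqrt 2 : ℝ) : ℂ) * ((Real.sqrt 2 : ℝ) : ℂ) = 2 := by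
      rw [← Complex.ofReal_mul, Real.mul_self_sqrt (by norm_num)]; norm_num
    have h0 : ((Real.sqrt 2 : ℝ) : ℂ) ≠ 0 := by
      intro h; rw [h] at h2; norm_num at h2
    ext s t
    rw [Matrix.mul_apply, ← (Equiv.funUnique (Fin 1) Bool).symm.sum_comp]
    simp only [Gate.op, Matrix.conjTranspose_apply, Matrix.of_apply, Fintype.sum_bool, Matrix.one_apply]
    have hst : s = t ↔ s 0 = t 0 :=
      ⟨fun h => by rw [h], fun h => by funext i; rw [Subsingleton.elim i 0]; exact h⟩
    simp only [hst, Equiv.funUnique_symm_apply, uniqueElim_const]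
    cases s 0 <;> cases t 0 <;> simp <;> field_simp <;> rw [sq, h2] <;> norm_num
  | t =>
    ext s t
    have hd : (Gate.t.op : Op (Fin 1)) = Matrix.diagonal fun t =>
        if t 0 then Complex.exp (Complex.I * Real.pi / 4) else 1 := by
      ext s t
      simp only [Gate.op, Matrix.of_apply, Matrix.diagonal_apply]
      by_cases h : s = t
      · simp [h]
      · simp [h]
    rw [hd, Matrix.diagonal_conjTranspose, Matrix.diagonal_mul_diagonal, Matrix.diagonal_apply,
      Matrix.one_apply]
    split_ifs
    · rename_i h1 h2
      simp only [Pi.star_apply, h2, if_true]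
      have : Complex.I * Real.pi / 4 = ((Real.pi / 4 : ℝ) : ℂ) * Complex.I := by push_cast; ring
      rw [this, RCLike.star_def, Complex.conj_mul', Complex.norm_exp_ofReal_mul_I]
      norm_num
    · rename_i h1 h2
      simp [h2]
    · rfl
  | cnot =>
    refine permutation_unitary (fun t : Fin 2 → Bool => ![t 0, xor (t 1) (t 0)]) ?_
    intro s t h
    have h0 := congrFun h 0
    have h1 := congrFun h 1
    simp only [Matrix.cons_val_zero, Matrix.cons_val_one] at h0 h1
    funext i
    fin_cases i
    · exact h0
    · rw [h0] at h1; simpa using h1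
  | toffoli =>
    refine permutation_unitary (fun t : Fin 3 → Bool => ![t 0, t 1, xor (t 2) (t 0 && t 1)]) ?_
    intro s t h
    have h0 := congrFun h 0
    have h1 := congrFun h 1
    have h2 := congrFun h 2
    simp at h0 h1 h2
    funext i
    fin_cases i
    · exact h0
    · exact h1
    · rw [h0, h1] at h2; simpa using h2

theorem Instr.isQuantumOp {m : ℕ} {O : Type} {oracle : O → Op (Fin m) → Op (Fin m)}
    (h : ∀ o, IsQuantumOp (oracle o)) (i : Instr m O) : IsQuantumOp (i.apply oracle) := by
  cases i with
  | gate g e => exact IsQuantumOp.applyUnitary e _ g.op_unitary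
  | measure q => exact IsQuantumOp.measureWires _
  | reset q => exact IsQuantumOp.prepare _ _ (sum_norm_ket _)
  | query o => exact h o

/-! ### Runs of circuits and outcome probabilities -/

@[simp] theorem run_nil {m : ℕ} {O : Type} (oracle : O → Op (Fin m) → Op (Fin m)) (ρ : Op (Fin m)) :
    run oracle [] ρ = ρ := rfl

@[simp] theorem run_cons {m : ℕ} {O : Type} (oracle : O → Op (Fin m) → Op (Fin m)) (i : Instr m O)
    (P : List (Instr m O)) (ρ : Op (Fin m)) :
    run oracle (i :: P) ρ = run oracle P (i.apply oracle ρ) := rfl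

theorem run_append {m : ℕ} {O : Type} (oracle : O → Op (Fin m) → Op (Fin m))
    (P P' : List (Instr m O)) (ρ : Op (Fin m)) :
    run oracle (P ++ P') ρ = run oracle P' (run oracle P ρ) := by
  simp [run]

theorem isQuantumOp_run {m : ℕ} {O : Type} {oracle : O → Op (Fin m) → Op (Fin m)}
    (h : ∀ o, IsQuantumOp (oracle o)) (P : List (Instr m O)) : IsQuantumOp (run oracle P) := by
  induction P with
  | nil => exact IsQuantumOp.id
  | cons i P ih => exact ih.comp (i.isQuantumOp h)

theorem IsEffect.mono {m : ℕ} {F : Op (Fin m) → ℝ} (hF : IsEffect F) {ρ σ τ : Op (Fin m)}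
    (hτ : τ.PosSemidef) (h : ρ + τ = σ) : F ρ ≤ F σ := by
  rw [← h, hF.map_add]
  linarith [hF.nonneg hτ]

theorem IsEffect.map_sum {m : ℕ} {F : Op (Fin m) → ℝ} (hF : IsEffect F) {κ : Type} (s : Finset κ)
    (ρ : κ → Op (Fin m)) : F (∑ k ∈ s, ρ k) = ∑ k ∈ s, F (ρ k) := by
  classical
  have h0 : F 0 = 0 := by simpa using hF.map_smul 0 0
  induction s using Finset.induction_on with
  | empty => simpa using h0
  | insert a s ha ih => rw [Finset.sum_insert ha, Finset.sum_insert ha, hF.map_add, ih]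

theorem isEffect_outcomeProb {m : ℕ} (q : Fin m) (b : Bool) : IsEffect (outcomeProb q b) := by
  refine ⟨fun ρ σ => ?_, fun c ρ => ?_, fun h => ?_, fun h => ?_⟩
  · simp only [outcomeProb, ← Finset.sum_add_distrib]
    refine Finset.sum_congr rfl fun s _ => ?_
    split_ifs <;> simp
  · simp only [outcomeProb, Finset.mul_sum]
    refine Finset.sum_congr rfl fun s _ => ?_
    split_ifs <;> simp
  · refine Finset.sum_nonneg fun s _ => ?_
    split_ifs
    · exact (Complex.le_def.1 h.diag_nonneg).1
    · rfl
  · simp only [outcomeProb, Matrix.trace, Matrix.diag, Complex.re_sum]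
    refine Finset.sum_le_sum fun s _ => ?_
    split_ifs
    · rfl
    · exact (Complex.le_def.1 h.diag_nonneg).1

theorem sum_outcomeProb {m : ℕ} (q : Fin m) (ρ : Op (Fin m)) :
    ∑ b, outcomeProb q b ρ = ρ.trace.re := by
  simp only [outcomeProb, Matrix.trace, Matrix.diag, Complex.re_sum]
  rw [Finset.sum_comm]
  refine Finset.sum_congr rfl fun s _ => ?_
  simp

theorem trace_re_nonneg {m : ℕ} {ρ : Op (Fin m)} (h : ρ.PosSemidef) : 0 ≤ ρ.trace.re :=
  (Complex.le_def.1 h.trace_nonneg).1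

theorem posSemidef_zeroState (m : ℕ) : (zeroState m).PosSemidef := by
  rw [zeroState, basisProj_eq_diagonal, Matrix.posSemidef_diagonal_iff]
  intro s
  split_ifs <;> simp

theorem trace_zeroState (m : ℕ) : (zeroState m).trace = 1 := by
  rw [zeroState, basisProj_eq_diagonal, Matrix.trace_diagonal]
  simp

/-! ### The game for an arbitrary pair of functions -/

/-- The public key for a pair of functions. -/
noncomputable def pairQpk {n : ℕ} (F : Bool → Bits n → Bits (3 * n)) : (Bool × Pos n → Bool) → ℂ :=
  fun s => graphState (F false) (fun i => s (false, i)) * graphState (F true) (fun i => s (true, i))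

/-- The decryption function for a pair of functions. -/
def pairDec {n : ℕ} (F : Bool → Bits n → Bits (3 * n)) (c : Pos n → Bool) : Option Bool :=
  if F false (c ∘ Sum.inl) = c ∘ Sum.inr then some false
  else if F true (c ∘ Sum.inl) = c ∘ Sum.inr then some true
  else none

/-- The decryption function, punctured at a challenge ciphertext. -/
def puncture {C : Type} [Fintype C] [DecidableEq C] (c : C → Bool) (D : (C → Bool) → Option Bool)
    (c' : C → Bool) : Option Bool :=
  if c' = c then none else D c'

/-- The oracles of the chosen-ciphertext game for a public key `ψ` and a decryption function `D`. -/
noncomputable def pairOracle {Q C : Type} [Fintype Q] [DecidableEq Q] [Fintype C] [DecidableEq C]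
    (ψ : (Q → Bool) → ℂ) (D : (C → Bool) → Option Bool) {m : ℕ} :
    CCAQuery m Q C → Op (Fin m) → Op (Fin m)
  | .qpk e, ρ => prepare e ψ ρ
  | .dec e, ρ => applyUnitary e (xorOp fun c => encodeAnswer (D c))
      (measureWires (Function.Embedding.inl.trans e) ρ)

/-- The state before the challenge, with messages `v`. -/
noncomputable def findState {n : ℕ} (A : CCAAdversary (Bool × Pos n) (Pos n))
    (F : Bool → Bits n → Bits (3 * n)) (v : Bits 2) : Op (Fin A.qubits) :=
  postMeasure A.msg v (run (pairOracle (pairQpk F) (pairDec F)) A.find (zeroState A.qubits))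

/-- The probability of the messages `v` and the output `b'`, for the challenge ciphertext `c`. -/
noncomputable def gameProb {n : ℕ} (A : CCAAdversary (Bool × Pos n) (Pos n))
    (F : Bool → Bits n → Bits (3 * n)) (v : Bits 2) (b' : Bool) (c : Pos n → Bool) : ℝ :=
  outcomeProb A.out b' (run (pairOracle (pairQpk F) (puncture c (pairDec F))) A.guess
    (prepare A.chal (ket c) (findState A F v)))

theorem sum_norm_mul {n : ℕ} (φ φ' : (Pos n → Bool) → ℂ) :
    ∑ s : Bool × Pos n → Bool, ‖φ (fun i => s (false, i)) * φ' (fun i => s (true, i))‖ ^ 2 =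
      (∑ s, ‖φ s‖ ^ 2) * ∑ s, ‖φ' s‖ ^ 2 := by
  rw [← ((Equiv.boolArrowEquivProd (Pos n → Bool)).symm.trans
    (Equiv.curry Bool (Pos n) Bool).symm).sum_comp, Fintype.sum_prod_type, Finset.sum_mul_sum]
  refine Finset.sum_congr rfl fun a _ => Finset.sum_congr rfl fun b _ => ?_
  rw [← mul_pow, ← norm_mul]
  rfl

theorem sum_norm_pairQpk {n : ℕ} (F : Bool → Bits n → Bits (3 * n)) :
    ∑ s, ‖pairQpk F s‖ ^ 2 = 1 := by
  unfold pairQpk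
  rw [sum_norm_mul (graphState (F false)) (graphState (F true))]
  simp [graphState_norm]

theorem isQuantumOp_pairOracle {Q C : Type} [Fintype Q] [DecidableEq Q] [Fintype C] [DecidableEq C]
    {ψ : (Q → Bool) → ℂ} (hψ : ∑ s, ‖ψ s‖ ^ 2 = 1) (D : (C → Bool) → Option Bool) {m : ℕ}
    (o : CCAQuery m Q C) : IsQuantumOp (pairOracle ψ D o) := by
  cases o with
  | qpk e => exact IsQuantumOp.prepare e ψ hψ
  | dec e =>
    exact (IsQuantumOp.applyUnitary e _ (xorOp_unitary _)).comp (IsQuantumOp.measureWires _)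

theorem graphState_elim {n : ℕ} (g : Bits n → Bits (3 * n)) (x : Bits n) (y : Bits (3 * n)) :
    graphState g (Sum.elim x y) = if y = g x then 1 / (Real.sqrt (2 ^ n) : ℂ) else 0 := rfl

/-- The two vectors can differ only at the basis states `(x, g x)` and `(x, y)`, where the entries
have squared modulus at most `2^(-n)`. -/
theorem sum_norm_graphState_sub {n : ℕ} (g : Bits n → Bits (3 * n)) (x : Bits n) (y : Bits (3 * n)) :
    ∑ s, ‖graphState g s - graphState (Function.update g x y) s‖ ^ 2 ≤ 2 * ((2 : ℝ) ^ n)⁻¹ := by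
  have h1 : ∀ s, ‖graphState g s - graphState (Function.update g x y) s‖ ^ 2 ≤
      (if s = Sum.elim x (g x) then ((2 : ℝ) ^ n)⁻¹ else 0) +
        (if s = Sum.elim x y then ((2 : ℝ) ^ n)⁻¹ else 0) := by
    intro s
    obtain ⟨a, b, rfl⟩ : ∃ a b, s = Sum.elim a b := ⟨s ∘ Sum.inl, s ∘ Sum.inr, by simp⟩
    have hn : ‖((1 : ℂ) / (Real.sqrt (2 ^ n) : ℂ))‖ ^ 2 = ((2 : ℝ) ^ n)⁻¹ := by simp
    have he : ∀ y' : Bits (3 * n), Sum.elim a b = Sum.elim x y' ↔ a = x ∧ b = y' := by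
      intro y'
      constructor
      · intro h
        exact ⟨by simpa using congrArg (· ∘ Sum.inl) h, by simpa using congrArg (· ∘ Sum.inr) h⟩
      · rintro ⟨rfl, rfl⟩; rfl
    simp only [graphState_elim, he]
    by_cases hax : a = x
    · subst hax
      simp only [Function.update_self, true_and]
      by_cases h1 : b = g a <;> by_cases h2 : b = y
      · rw [if_pos h1, if_pos h2, if_pos h1, if_pos h2, sub_self]; simp
      · rw [if_pos h1, if_neg h2, if_pos h1, if_neg h2, sub_zero, hn, add_zero]
      · rw [if_neg h1, if_pos h2, if_neg h1, if_pos h2, zero_sub, norm_neg, hn, zero_add]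
      · rw [if_neg h1, if_neg h2, if_neg h1, if_neg h2]; simp
    · simp [hax]
  refine (Finset.sum_le_sum fun s _ => h1 s).trans ?_
  rw [Finset.sum_add_distrib]
  simp only [Finset.sum_ite_eq', Finset.mem_univ, if_true]
  linarith

theorem sum_norm_pairQpk_sub {n : ℕ} (i : Bool) (h g : Bits n → Bits (3 * n)) (x : Bits n)
    (y : Bits (3 * n)) :
    ∑ s, ‖pairQpk (fun b => if b = i then g else h) s -
      pairQpk (fun b => if b = i then Function.update g x y else h) s‖ ^ 2 ≤ 2 * ((2 : ℝ) ^ n)⁻¹ := by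
  cases i
  · simp only [pairQpk, if_true, ← sub_mul, reduceCtorEq, if_false]
    rw [sum_norm_mul (fun s => graphState g s - graphState (Function.update g x y) s) (graphState h),
      graphState_norm, mul_one]
    exact sum_norm_graphState_sub g x y
  · simp only [pairQpk, if_true, ← mul_sub, reduceCtorEq, if_false]
    rw [sum_norm_mul (graphState h) (fun s => graphState g s - graphState (Function.update g x y) s),
      graphState_norm, one_mul]
    exact sum_norm_graphState_sub g x y

/-! ### Perturbing the oracles -/

/-- A weighted parallelogram law for operators: the Kraus operators of `ψ` are those of `φ` plus
those of `ψ - φ`, and the cross terms are absorbed into a positive operator. The form with a free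
weight `t` avoids fidelity and trace distance. -/
theorem IsEffect.prepare_le {ι : Type} [Fintype ι] [DecidableEq ι] {m : ℕ} {F : Op (Fin m) → ℝ}
    (hF : IsEffect F) (e : ι ↪ Fin m) (ψ φ : (ι → Bool) → ℂ) {ρ : Op (Fin m)} (hρ : ρ.PosSemidef)
    {t : ℝ} (ht : 0 < t) :
    F (prepare e ψ ρ) ≤ (1 + t) * F (prepare e φ ρ) +
      (1 + t⁻¹) * ((∑ s, ‖ψ s - φ s‖ ^ 2) * ρ.trace.re) := by
  -- With the coefficient `t⁻¹` the cross terms of the two squares cancel; the second square is the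
  -- positive remainder that is dropped.
  have key : ∀ A B : Op (Fin m), (A + B) * ρ * (A + B)ᴴ + t • ((A - t⁻¹ • B) * ρ * (A - t⁻¹ • B)ᴴ) =
      (1 + t) • (A * ρ * Aᴴ) + (1 + t⁻¹) • (B * ρ * Bᴴ) := by
    intro A B
    simp only [Matrix.conjTranspose_add, Matrix.conjTranspose_sub, Matrix.conjTranspose_smul,
      star_trivial, add_mul, mul_add, sub_mul, mul_sub, smul_sub, add_smul, one_smul,
      Matrix.smul_mul, Matrix.mul_smul, smul_smul]
    rw [← mul_assoc, mul_inv_cancel₀ ht.ne', one_smul, one_smul, one_mul]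
    abel
  let K : ((ι → Bool) → ℂ) → (ι → Bool) → Op (Fin m) := fun χ v =>
    liftOp e (Matrix.of fun s t => if t = v then χ s else 0)
  have hK : ∀ v, K ψ v = K φ v + K (fun s => ψ s - φ s) v := by
    intro v
    simp only [K]
    rw [← liftOp_add]
    congr 1
    ext s t
    simp only [Matrix.of_apply, Matrix.add_apply]
    split_ifs <;> simp
  have hsum : prepare e ψ ρ + ∑ v, t • ((K φ v - t⁻¹ • K (fun s => ψ s - φ s) v) * ρ *
      (K φ v - t⁻¹ • K (fun s => ψ s - φ s) v)ᴴ) =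
      (1 + t) • prepare e φ ρ + (1 + t⁻¹) • prepare e (fun s => ψ s - φ s) ρ := by
    simp only [prepare, channel, Finset.smul_sum, ← Finset.sum_add_distrib]
    refine Finset.sum_congr rfl fun v _ => ?_
    have := key (K φ v) (K (fun s => ψ s - φ s) v)
    rw [← hK] at this
    exact this
  have hpos : (∑ v, t • ((K φ v - t⁻¹ • K (fun s => ψ s - φ s) v) * ρ *
      (K φ v - t⁻¹ • K (fun s => ψ s - φ s) v)ᴴ)).PosSemidef :=
    Matrix.posSemidef_sum _ fun v _ => (hρ.mul_mul_conjTranspose_same _).smul ht.le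
  have h1 := hF.mono hpos hsum
  rw [hF.map_add, hF.map_smul, hF.map_smul] at h1
  refine h1.trans ?_
  have hp : (prepare e (fun s => ψ s - φ s) ρ).PosSemidef := posSemidef_channel e _ hρ
  have h2 := hF.le_trace hp
  rw [trace_prepare, Complex.re_ofReal_mul] at h2
  have : 0 ≤ 1 + t⁻¹ := by positivity
  gcongr

/-- The weight is chosen of the order of the distance of the two states, which balances the two
error terms. -/
theorem IsEffect.prepare_le_add {ι : Type} [Fintype ι] [DecidableEq ι] {m : ℕ} {F : Op (Fin m) → ℝ}
    (hF : IsEffect F) (e : ι ↪ Fin m) {ψ φ : (ι → Bool) → ℂ} {ρ : Op (Fin m)} (hρ : ρ.PosSemidef)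
    {t : ℝ} (ht : 0 < t) (ht1 : t ≤ 1) (hφ : ∑ s, ‖φ s‖ ^ 2 = 1)
    (hd : ∑ s, ‖ψ s - φ s‖ ^ 2 ≤ 2 * t ^ 2) :
    F (prepare e ψ ρ) ≤ F (prepare e φ ρ) + 6 * t * ρ.trace.re := by
  have h1 := hF.prepare_le e ψ φ hρ ht
  have hp : (prepare e φ ρ).PosSemidef := posSemidef_channel e _ hρ
  have h2 := hF.le_trace hp
  rw [trace_prepare, hφ, Complex.ofReal_one, one_mul] at h2
  have h0 := trace_re_nonneg hρ
  -- This term costs `2 t² + 2 t ≤ 4 t`, as `t ≤ 1`; the factor `1 + t` costs one more `t`, so the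
  -- constant 6 has some slack.
  have h3 : (1 + t⁻¹) * ((∑ s, ‖ψ s - φ s‖ ^ 2) * ρ.trace.re) ≤ 4 * t * ρ.trace.re := by
    rw [← mul_assoc]
    refine mul_le_mul_of_nonneg_right ?_ h0
    have : (1 + t⁻¹) * ∑ s, ‖ψ s - φ s‖ ^ 2 ≤ (1 + t⁻¹) * (2 * t ^ 2) := by
      have : 0 ≤ 1 + t⁻¹ := by positivity
      gcongr
    refine this.trans ?_
    have : (1 + t⁻¹) * (2 * t ^ 2) = 2 * t ^ 2 + 2 * t := by field_simp
    rw [this]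
    nlinarith
  nlinarith

/-- The probability that measuring the wires `e` gives `v`. -/
noncomputable def wireProb {ι : Type} [Fintype ι] {m : ℕ} (e : ι ↪ Fin m) (v : ι → Bool)
    (ρ : Op (Fin m)) : ℝ :=
  (postMeasure e v ρ).trace.re

theorem wireProb_nonneg {ι : Type} [Fintype ι] [DecidableEq ι] {m : ℕ} (e : ι ↪ Fin m)
    (v : ι → Bool) {ρ : Op (Fin m)} (hρ : ρ.PosSemidef) : 0 ≤ wireProb e v ρ :=
  trace_re_nonneg (posSemidef_channel e _ hρ)

theorem sum_wireProb {ι : Type} [Fintype ι] [DecidableEq ι] {m : ℕ} (e : ι ↪ Fin m)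
    (ρ : Op (Fin m)) : ∑ v, wireProb e v ρ = ρ.trace.re := by
  simp only [wireProb]
  rw [← Complex.re_sum, ← Matrix.trace_sum, ← measureWires_eq_sum, (IsQuantumOp.measureWires e).trace]

/-- In the branch where the query was measured to be `c`, only the value at `c` enters the answer.
-/
theorem applyUnitary_postMeasure_congr {C : Type} [Fintype C] [DecidableEq C] {m : ℕ}
    (e : C ⊕ Fin 2 ↪ Fin m) (D D' : (C → Bool) → Option Bool) (c : C → Bool) (h : D c = D' c)
    (ρ : Op (Fin m)) :
    applyUnitary e (xorOp fun c => encodeAnswer (D c))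
        (postMeasure (Function.Embedding.inl.trans e) c ρ) =
      applyUnitary e (xorOp fun c => encodeAnswer (D' c))
        (postMeasure (Function.Embedding.inl.trans e) c ρ) := by
  have key : ∀ (u : C ⊕ Fin 2 → Bool) (s : Fin m → Bool) (r : C ⊕ Fin 2 → Bool), (r ∘ Sum.inl = c) →
      (xorOp (fun c => encodeAnswer (D c)) : Op (C ⊕ Fin 2)) u r =
        (xorOp (fun c => encodeAnswer (D' c)) : Op (C ⊕ Fin 2)) u r := by
    intro u s r hr
    simp only [xorOp, Matrix.of_apply, hr, h]
  have hcomp : ∀ (r : C ⊕ Fin 2 → Bool) (s : Fin m → Bool),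
      overwrite e r s ∘ (Function.Embedding.inl.trans e : C ↪ Fin m) = r ∘ Sum.inl := by
    intro r s
    funext i
    exact overwrite_apply e r s (Sum.inl i)
  ext s t
  simp only [applyUnitary, channel_apply, Fintype.sum_unique, postMeasure_apply, hcomp]
  refine Finset.sum_congr rfl fun r' _ => ?_
  by_cases hr' : r' ∘ Sum.inl = c
  · rw [key _ s r' hr']
    congr 1
    refine Finset.sum_congr rfl fun r _ => ?_
    by_cases hr : r ∘ Sum.inl = c
    · rw [key _ s r hr]
    · simp [hr]
  · simp [hr']

/-- Since the query is measured, the call is a sum over its outcomes. Branches where the two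
functions agree are equal; any other branch contributes at most its own probability. -/
theorem IsEffect.dec_le {Q C : Type} [Fintype Q] [DecidableEq Q] [Fintype C] [DecidableEq C] {m : ℕ}
    {F : Op (Fin m) → ℝ} (hF : IsEffect F) (ψ ψ' : (Q → Bool) → ℂ) (D D' : (C → Bool) → Option Bool)
    (e : C ⊕ Fin 2 ↪ Fin m) {ρ : Op (Fin m)} (hρ : ρ.PosSemidef) :
    F (pairOracle ψ D (.dec e) ρ) ≤ F (pairOracle ψ' D' (.dec e) ρ) +
      ∑ c, if D c = D' c then 0 else wireProb (Function.Embedding.inl.trans e) c ρ := by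
  have hU : ∀ D : (C → Bool) → Option Bool,
      IsQuantumOp (applyUnitary e (xorOp fun c => encodeAnswer (D c))) := fun D =>
    IsQuantumOp.applyUnitary e _ (xorOp_unitary _)
  have hex : ∀ D : (C → Bool) → Option Bool, F (applyUnitary e (xorOp fun c => encodeAnswer (D c))
      (measureWires (Function.Embedding.inl.trans e) ρ)) =
      ∑ c, F (applyUnitary e (xorOp fun c => encodeAnswer (D c))
        (postMeasure (Function.Embedding.inl.trans e) c ρ)) := fun D => by
    rw [measureWires_eq_sum]
    exact (hF.comp (hU D)).map_sum _ _
  change F (applyUnitary e _ _) ≤ F (applyUnitary e _ _) + _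
  rw [hex D, hex D', ← Finset.sum_add_distrib]
  refine Finset.sum_le_sum fun c _ => ?_
  have hp : (postMeasure (Function.Embedding.inl.trans e) c ρ).PosSemidef := posSemidef_channel _ _ hρ
  split_ifs with h
  · rw [applyUnitary_postMeasure_congr e D D' c h, add_zero]
  · have h1 := (hF.comp (hU D)).le_trace hp
    have h2 := (hF.comp (hU D')).nonneg hp
    unfold wireProb
    linarith

/-- `O` is, up to an error `δ` in every call and on average over `a`, at most as likely to be accepted
as `O'`. -/
def StepLE {m : ℕ} {X α : Type} [Fintype α] (O O' : α → X → Op (Fin m) → Op (Fin m)) (δ : ℝ) : Prop :=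
  ∀ (x : X) (F : α → Op (Fin m) → ℝ), (∀ a, IsEffect (F a)) → ∀ ρ : Op (Fin m), ρ.PosSemidef →
    ∑ a, F a (O a x ρ) ≤ ∑ a, F a (O' a x ρ) + δ * ρ.trace.re

theorem StepLE.instr {m : ℕ} {X α : Type} [Fintype α] {O O' : α → X → Op (Fin m) → Op (Fin m)} {δ : ℝ}
    (hδ : 0 ≤ δ) (h : StepLE O O' δ) :
    StepLE (fun a (i : Instr m X) => i.apply (O a)) (fun a i => i.apply (O' a)) δ := by
  intro i F hF ρ hρ
  have h0 : 0 ≤ δ * ρ.trace.re := mul_nonneg hδ (trace_re_nonneg hρ)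
  cases i with
  | query x => exact h x F hF ρ hρ
  | gate g e => exact le_add_of_nonneg_right h0
  | measure q => exact le_add_of_nonneg_right h0
  | reset q => exact le_add_of_nonneg_right h0

/-- A hybrid argument in which the steps before the replaced one use the fixed oracle `O` and those
after it use `O' a`. The state reaching the replaced step is then the same for all `a`, and the
later steps, which may depend on `a`, are part of the effect. -/
theorem StepLE.run_of_const_left {m : ℕ} {X α : Type} [Fintype α]
    {O : X → Op (Fin m) → Op (Fin m)} {O' : α → X → Op (Fin m) → Op (Fin m)} {δ : ℝ}
    (hδ : 0 ≤ δ) (hO : ∀ x, IsQuantumOp (O x)) (hO' : ∀ a x, IsQuantumOp (O' a x))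
    (h : StepLE (fun _ => O) O' δ) (P : List (Instr m X)) (F : α → Op (Fin m) → ℝ)
    (hF : ∀ a, IsEffect (F a)) (ρ : Op (Fin m)) (hρ : ρ.PosSemidef) :
    ∑ a, F a (run O P ρ) ≤ ∑ a, F a (run (O' a) P ρ) + P.length * δ * ρ.trace.re := by
  induction P generalizing ρ with
  | nil => simp
  | cons i P ih =>
    have hi := i.isQuantumOp hO
    have h1 := ih (i.apply O ρ) (hi.posSemidef hρ)
    rw [hi.trace] at h1
    have h2 := h.instr hδ i (fun a ρ => F a (run (O' a) P ρ))
      (fun a => (hF a).comp (isQuantumOp_run (hO' a) P)) ρ hρ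
    simp only [run_cons, List.length_cons]
    push_cast
    linarith

/-- The same hybrids, traversed in the opposite direction. -/
theorem StepLE.run_of_const_right {m : ℕ} {X α : Type} [Fintype α]
    {O : X → Op (Fin m) → Op (Fin m)} {O' : α → X → Op (Fin m) → Op (Fin m)} {δ : ℝ}
    (hδ : 0 ≤ δ) (hO : ∀ x, IsQuantumOp (O x)) (hO' : ∀ a x, IsQuantumOp (O' a x))
    (h : StepLE O' (fun _ => O) δ) (P : List (Instr m X)) (F : α → Op (Fin m) → ℝ)
    (hF : ∀ a, IsEffect (F a)) (ρ : Op (Fin m)) (hρ : ρ.PosSemidef) :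
    ∑ a, F a (run (O' a) P ρ) ≤ ∑ a, F a (run O P ρ) + P.length * δ * ρ.trace.re := by
  induction P generalizing ρ with
  | nil => simp
  | cons i P ih =>
    have hi := i.isQuantumOp hO
    have h1 := ih (i.apply O ρ) (hi.posSemidef hρ)
    rw [hi.trace] at h1
    have h2 := h.instr hδ i (fun a ρ => F a (run (O' a) P ρ))
      (fun a => (hF a).comp (isQuantumOp_run (hO' a) P)) ρ hρ
    simp only [run_cons, List.length_cons]
    push_cast
    linarith

/-- Public keys are compared for each `a` separately, decryption only on average: as `ρ` does not
depend on `a`, it suffices that every fixed ciphertext is treated differently for at most a fraction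
`t` of the `a`. -/
theorem stepLE_pairOracle {Q C α : Type} [Fintype Q] [DecidableEq Q] [Fintype C] [DecidableEq C]
    [Fintype α] {m : ℕ} {ψ ψ' : α → (Q → Bool) → ℂ} {D D' : α → (C → Bool) → Option Bool}
    {t : ℝ} (ht : 0 < t) (ht1 : t ≤ 1) (hψ' : ∀ a, ∑ s, ‖ψ' a s‖ ^ 2 = 1)
    (hd : ∀ a, ∑ s, ‖ψ a s - ψ' a s‖ ^ 2 ≤ 2 * t ^ 2)
    (hD : ∀ c, (∑ a, if D a c = D' a c then 0 else 1 : ℝ) ≤ Fintype.card α * t) :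
    StepLE (fun a => (pairOracle (ψ a) (D a) : CCAQuery m Q C → _))
      (fun a => pairOracle (ψ' a) (D' a)) (Fintype.card α * (6 * t)) := by
  intro x F hF ρ hρ
  have h0 := trace_re_nonneg hρ
  cases x with
  | qpk e =>
    refine (Finset.sum_le_sum fun a _ =>
      (hF a).prepare_le_add e hρ ht ht1 (hψ' a) (hd a)).trans ?_
    rw [Finset.sum_add_distrib, Finset.sum_const, Finset.card_univ, nsmul_eq_mul, mul_assoc,
      mul_assoc, mul_assoc]
    exact le_rfl
  | dec e =>
    refine (Finset.sum_le_sum fun a _ => (hF a).dec_le (ψ a) (ψ' a) (D a) (D' a) e hρ).trans ?_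
    rw [Finset.sum_add_distrib]
    refine add_le_add le_rfl ?_
    rw [Finset.sum_comm]
    have h1 : ∀ c, (∑ a, if D a c = D' a c then 0 else
        wireProb (Function.Embedding.inl.trans e) c ρ) ≤
        Fintype.card α * t * wireProb (Function.Embedding.inl.trans e) c ρ := by
      intro c
      refine le_trans (le_of_eq ?_)
        (mul_le_mul_of_nonneg_right (hD c) (wireProb_nonneg (Function.Embedding.inl.trans e) c hρ))
      rw [Finset.sum_mul]
      refine Finset.sum_congr rfl fun a _ => ?_
      split_ifs <;> simp
    refine (Finset.sum_le_sum fun c _ => h1 c).trans ?_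
    rw [← Finset.mul_sum, sum_wireProb]
    have : (0 : ℝ) ≤ Fintype.card α * t := by positivity
    nlinarith

/-! ### The challenge in the game with a random function -/

/-- The pair of functions with `g` in slot `i` and `h` in the other slot. -/
def slotPair {n : ℕ} (i : Bool) (g h : Bits n → Bits (3 * n)) : Bool → Bits n → Bits (3 * n) :=
  fun b => if b = i then g else h

theorem IsEffect.comp_postMeasure {ι : Type} [Fintype ι] [DecidableEq ι] {m : ℕ}
    {F : Op (Fin m) → ℝ} (hF : IsEffect F) (e : ι ↪ Fin m) (v : ι → Bool) :
    IsEffect fun ρ => F (postMeasure e v ρ) := by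
  have hp : ∀ {ρ : Op (Fin m)} (v), ρ.PosSemidef → (postMeasure e v ρ).PosSemidef :=
    fun v h => posSemidef_channel e _ h
  refine ⟨fun ρ σ => ?_, fun c ρ => ?_, fun h => hF.nonneg (hp v h), fun {ρ} h => ?_⟩
  · rw [postMeasure, channel_add, hF.map_add]; rfl
  · rw [postMeasure, channel_smul, hF.map_smul]; rfl
  · refine (hF.le_trace (hp v h)).trans ?_
    rw [← sum_wireProb e ρ]
    exact Finset.single_le_sum (f := fun v => wireProb e v ρ)
      (fun v _ => wireProb_nonneg e v h) (Finset.mem_univ v)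

theorem pairDec_update_of_ne {n : ℕ} (i : Bool) (g h : Bits n → Bits (3 * n)) (x : Bits n)
    (y : Bits (3 * n)) (c : Pos n → Bool) (hc : c ∘ Sum.inl ≠ x) :
    pairDec (slotPair i (Function.update g x y) h) c = pairDec (slotPair i g h) c := by
  have : ∀ b, slotPair i (Function.update g x y) h b (c ∘ Sum.inl) =
      slotPair i g h b (c ∘ Sum.inl) := by
    intro b
    unfold slotPair
    split_ifs
    · rw [Function.update_of_ne hc]
    · rfl
  simp only [pairDec, this]

/-- The changed value matters only for ciphertexts `(x, y')` with `y' = g x` or `y' = z`. The first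
is the challenge, where both oracles are punctured, and the second is excluded. -/
theorem puncture_update_of_ne {n : ℕ} (i : Bool) (g h : Bits n → Bits (3 * n)) (x : Bits n)
    (z : Bits (3 * n)) (c : Pos n → Bool) (hc : c ∘ Sum.inr ≠ z) :
    puncture (Sum.elim x (g x)) (pairDec (slotPair i (Function.update g x z) h)) c =
      puncture (Sum.elim x (g x)) (pairDec (slotPair i g h)) c := by
  unfold puncture
  split_ifs with h1
  · rfl
  · by_cases h2 : c ∘ Sum.inl = x
    · have h3 : g x ≠ c ∘ Sum.inr := by
        rintro h3
        apply h1
        rw [h3, ← h2, Sum.elim_comp_inl_inr]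
      have : ∀ b, slotPair i (Function.update g x z) h b (c ∘ Sum.inl) = c ∘ Sum.inr ↔
          slotPair i g h b (c ∘ Sum.inl) = c ∘ Sum.inr := by
        intro b
        unfold slotPair
        split_ifs
        · rw [h2, Function.update_self]
          exact ⟨fun h => absurd h.symm hc, fun h => absurd h h3⟩
        · rfl
      simp only [pairDec, this]
    · exact pairDec_update_of_ne i g h x z c h2

/-- The sum over `g`, `x` and a fresh value for `g x`, rearranged by the exchange of the two values. -/
theorem sum_update_swap {X Y : Type} [Fintype X] [DecidableEq X] [Fintype Y] [DecidableEq Y]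
    (Φ : (X → Y) → (X → Y) → X → Y → ℝ) :
    ∑ g : X → Y, ∑ x, ∑ z, Φ g (Function.update g x z) x (g x) =
      ∑ g : X → Y, ∑ x, ∑ y, Φ (Function.update g x y) g x y := by
  rw [Finset.sum_comm]
  conv_rhs => rw [Finset.sum_comm]
  refine Finset.sum_congr rfl fun x _ => ?_
  rw [← Fintype.sum_prod_type', ← Fintype.sum_prod_type']
  -- For fixed `x`, the value of the function at `x` and the fresh value trade places; doing this
  -- twice restores both.
  let τ : (X → Y) × Y → (X → Y) × Y := fun p => (Function.update p.1 x p.2, p.1 x)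
  have hτ : Function.Involutive τ := by
    rintro ⟨g, z⟩
    simp [τ]
  refine Fintype.sum_equiv hτ.toPerm _ _ ?_
  rintro ⟨g, z⟩
  simp [τ]

/-- The error of one oracle call when the random function changes at a random point. -/
noncomputable def stepError (n : ℕ) : ℝ := (Real.sqrt 2)⁻¹ ^ n

theorem stepError_pos (n : ℕ) : 0 < stepError n := by unfold stepError; positivity

theorem stepError_le_one (n : ℕ) : stepError n ≤ 1 := by
  refine pow_le_one₀ (by positivity) (inv_le_one_of_one_le₀ ?_)
  rw [Real.one_le_sqrt]; norm_num

theorem stepError_sq (n : ℕ) : stepError n ^ 2 = ((2 : ℝ) ^ n)⁻¹ := by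
  rw [stepError, ← pow_mul, mul_comm, pow_mul, inv_pow, Real.sq_sqrt (by norm_num), inv_pow]

theorem inv_two_pow_le_stepError (n : ℕ) : ((2 : ℝ) ^ n)⁻¹ ≤ stepError n := by
  rw [← stepError_sq, sq]
  exact mul_le_of_le_one_left (stepError_pos n).le (stepError_le_one n)

theorem sum_norm_slotPair_sub {n : ℕ} (i : Bool) (g h : Bits n → Bits (3 * n)) (x : Bits n)
    (y : Bits (3 * n)) :
    ∑ s, ‖pairQpk (slotPair i g h) s - pairQpk (slotPair i (Function.update g x y) h) s‖ ^ 2 ≤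
      2 * stepError n ^ 2 := by
  rw [stepError_sq]
  exact sum_norm_pairQpk_sub i h g x y

/-- After the challenge, `z` is the random point. A given ciphertext is affected for at most one
`z`, namely its second half. The original oracle does not depend on `z`, so it is the fixed one, and
the left-hand sum merely counts the `z`. -/
theorem sum_guess_le {n : ℕ} (i : Bool) (g h : Bits n → Bits (3 * n)) (x : Bits n) {m : ℕ}
    (P : List (Instr m (CCAQuery m (Bool × Pos n) (Pos n)))) {F : Op (Fin m) → ℝ} (hF : IsEffect F)
    {ρ : Op (Fin m)} (hρ : ρ.PosSemidef) (hρ1 : ρ.trace.re ≤ 1) :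
    ∑ _z : Bits (3 * n), F (run (pairOracle (pairQpk (slotPair i g h))
        (puncture (Sum.elim x (g x)) (pairDec (slotPair i g h)))) P ρ) ≤
      ∑ z : Bits (3 * n), F (run (pairOracle (pairQpk (slotPair i (Function.update g x z) h))
        (puncture (Sum.elim x (g x)) (pairDec (slotPair i (Function.update g x z) h)))) P ρ) +
        P.length * (Fintype.card (Bits (3 * n)) * (6 * stepError n)) := by
  have hε := stepError_pos n
  have hstep := stepLE_pairOracle (α := Bits (3 * n)) (m := m)
    (ψ := fun _ => pairQpk (slotPair i g h))
    (ψ' := fun z => pairQpk (slotPair i (Function.update g x z) h))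
    (D := fun _ => puncture (Sum.elim x (g x)) (pairDec (slotPair i g h)))
    (D' := fun z => puncture (Sum.elim x (g x)) (pairDec (slotPair i (Function.update g x z) h)))
    hε (stepError_le_one n) (fun z => sum_norm_pairQpk _)
    (fun z => sum_norm_slotPair_sub i g h x z) (by
      intro c
      have h1 : ∀ z : Bits (3 * n), (if puncture (Sum.elim x (g x)) (pairDec (slotPair i g h)) c =
          puncture (Sum.elim x (g x)) (pairDec (slotPair i (Function.update g x z) h)) c
          then (0 : ℝ) else 1) ≤ if c ∘ Sum.inr = z then 1 else 0 := by
        intro z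
        by_cases hz : c ∘ Sum.inr = z
        · rw [if_pos hz]; split_ifs <;> norm_num
        · rw [if_pos (puncture_update_of_ne i g h x z c hz).symm, if_neg hz]
      refine (Finset.sum_le_sum fun z _ => h1 z).trans ?_
      simp only [Finset.sum_ite_eq, Finset.mem_univ, if_true]
      have h2 := inv_two_pow_le_stepError n
      have h3 : (Fintype.card (Bits (3 * n)) : ℝ) = 2 ^ (3 * n) := by simp
      rw [h3]
      -- A single bad `z` among `2^(3n)`, far below the error that is already spent on public keys.
      calc (1 : ℝ) = 2 ^ n * (2 ^ n)⁻¹ := by field_simp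
        _ ≤ 2 ^ (3 * n) * stepError n := by
          gcongr
          · norm_num
          · omega)
  have := hstep.run_of_const_left (by positivity)
    (fun o => isQuantumOp_pairOracle (sum_norm_pairQpk _) _ o)
    (fun z o => isQuantumOp_pairOracle (sum_norm_pairQpk _) _ o) P (fun _ => F) (fun _ => hF) ρ hρ
  refine this.trans (add_le_add le_rfl ?_)
  exact mul_le_of_le_one_right (by positivity) hρ1

/-- Before the challenge, the pair `(x, y)` is the random point. A given ciphertext is affected only
if its first half is `x`, a fraction `2^(-n)` of the pairs. The effects may depend on the pair,
because the challenge is built from it later. -/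
theorem sum_find_le {n : ℕ} (i : Bool) (g h : Bits n → Bits (3 * n)) {m : ℕ}
    (P : List (Instr m (CCAQuery m (Bool × Pos n) (Pos n))))
    {F : Bits n × Bits (3 * n) → Op (Fin m) → ℝ} (hF : ∀ a, IsEffect (F a))
    {ρ : Op (Fin m)} (hρ : ρ.PosSemidef) (hρ1 : ρ.trace.re ≤ 1) :
    ∑ a : Bits n × Bits (3 * n), F a (run
        (pairOracle (pairQpk (slotPair i (Function.update g a.1 a.2) h))
          (pairDec (slotPair i (Function.update g a.1 a.2) h))) P ρ) ≤
      ∑ a : Bits n × Bits (3 * n), F a (run (pairOracle (pairQpk (slotPair i g h))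
          (pairDec (slotPair i g h))) P ρ) +
        P.length * (Fintype.card (Bits n × Bits (3 * n)) * (6 * stepError n)) := by
  have hε := stepError_pos n
  have hstep := stepLE_pairOracle (α := Bits n × Bits (3 * n)) (m := m)
    (ψ := fun a => pairQpk (slotPair i (Function.update g a.1 a.2) h))
    (ψ' := fun _ => pairQpk (slotPair i g h))
    (D := fun a => pairDec (slotPair i (Function.update g a.1 a.2) h))
    (D' := fun _ => pairDec (slotPair i g h))
    hε (stepError_le_one n) (fun a => sum_norm_pairQpk _)
    (fun a => by
      have := sum_norm_slotPair_sub i g h a.1 a.2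
      simpa only [norm_sub_rev] using this) (by
      intro c
      have h1 : ∀ a : Bits n × Bits (3 * n),
          (if pairDec (slotPair i (Function.update g a.1 a.2) h) c = pairDec (slotPair i g h) c
          then (0 : ℝ) else 1) ≤ if c ∘ Sum.inl = a.1 then 1 else 0 := by
        intro a
        by_cases hz : c ∘ Sum.inl = a.1
        · rw [if_pos hz]; split_ifs <;> norm_num
        · rw [if_pos (pairDec_update_of_ne i g h a.1 a.2 c hz), if_neg hz]
      refine (Finset.sum_le_sum fun z _ => h1 z).trans ?_
      have h4 : ∀ x : Bits n, (∑ y : Bits (3 * n), if c ∘ Sum.inl = (x, y).1 then (1 : ℝ) else 0) =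
          if c ∘ Sum.inl = x then (Fintype.card (Bits (3 * n)) : ℝ) else 0 := by
        intro x
        by_cases hx : c ∘ Sum.inl = x <;> simp [hx]
      rw [Fintype.sum_prod_type]
      simp only [h4, Finset.sum_ite_eq, Finset.mem_univ, if_true, Fintype.card_prod]
      have h2 := inv_two_pow_le_stepError n
      have h3 : (Fintype.card (Bits n) : ℝ) = 2 ^ n := by simp
      push_cast
      rw [h3]
      calc (Fintype.card (Bits (3 * n)) : ℝ)
          = 2 ^ n * Fintype.card (Bits (3 * n)) * (2 ^ n)⁻¹ := by field_simp
        _ ≤ 2 ^ n * Fintype.card (Bits (3 * n)) * stepError n := by gcongr)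
  have := hstep.run_of_const_right (by positivity)
    (fun o => isQuantumOp_pairOracle (sum_norm_pairQpk _) _ o)
    (fun z o => isQuantumOp_pairOracle (sum_norm_pairQpk _) _ o) P F hF ρ hρ
  refine this.trans (add_le_add le_rfl ?_)
  exact mul_le_of_le_one_right (by positivity) hρ1

/-! ### From the challenge `(x, g x)` to an independent challenge `(x, y)` -/

theorem isEffect_guess {n : ℕ} (A : CCAAdversary (Bool × Pos n) (Pos n))
    (F : Bool → Bits n → Bits (3 * n)) (v : Bits 2) (b' : Bool) (c : Pos n → Bool) :
    IsEffect fun ρ => outcomeProb A.out b' (run (pairOracle (pairQpk F) (puncture c (pairDec F)))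
      A.guess (prepare A.chal (ket c) (postMeasure A.msg v ρ))) :=
  (((isEffect_outcomeProb A.out b').comp (isQuantumOp_run
    (fun o => isQuantumOp_pairOracle (sum_norm_pairQpk F) _ o) A.guess)).comp
    (IsQuantumOp.prepare A.chal _ (sum_norm_ket c))).comp_postMeasure A.msg v

theorem isQuantumOp_find {n : ℕ} (A : CCAAdversary (Bool × Pos n) (Pos n))
    (F : Bool → Bits n → Bits (3 * n)) :
    IsQuantumOp (run (pairOracle (pairQpk F) (pairDec F)) A.find) :=
  isQuantumOp_run (fun o => isQuantumOp_pairOracle (sum_norm_pairQpk F) _ o) A.find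

/-- Resample the value at `x` after the challenge, exchange the old and the new value, and then undo
the change before the challenge. Unnormalized sums are used so that the exchange is a bijection of
the summation range; the sum over the idle `z` on the left supplies the fresh value. -/
theorem sum_gameProb_le {n : ℕ} (A : CCAAdversary (Bool × Pos n) (Pos n)) (i : Bool)
    (h : Bits n → Bits (3 * n)) (v : Bits 2) (b' : Bool) :
    ∑ g : Bits n → Bits (3 * n), ∑ x, ∑ _z : Bits (3 * n),
        gameProb A (slotPair i g h) v b' (Sum.elim x (g x)) ≤
      ∑ g : Bits n → Bits (3 * n), ∑ x, ∑ y, gameProb A (slotPair i g h) v b' (Sum.elim x y) +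
        Fintype.card (Bits n → Bits (3 * n)) * (Fintype.card (Bits n) *
          (Fintype.card (Bits (3 * n)) * (6 * A.size * stepError n))) := by
  have hε := stepError_pos n
  -- The intermediate game: `g` before the challenge, `g'` after it, and the challenge `(x, y)`.
  let mid (g g' : Bits n → Bits (3 * n)) (x : Bits n) (y : Bits (3 * n)) : ℝ :=
    outcomeProb A.out b' (run (pairOracle (pairQpk (slotPair i g' h))
      (puncture (Sum.elim x y) (pairDec (slotPair i g' h)))) A.guess
      (prepare A.chal (ket (Sum.elim x y)) (findState A (slotPair i g h) v)))
  have htr : ((zeroState A.qubits).trace).re ≤ 1 := by rw [trace_zeroState]; simp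
  have h1 : ∀ (g : Bits n → Bits (3 * n)) (x : Bits n),
      ∑ _z : Bits (3 * n), gameProb A (slotPair i g h) v b' (Sum.elim x (g x)) ≤
      ∑ z : Bits (3 * n), mid g (Function.update g x z) x (g x) +
        A.guess.length * (Fintype.card (Bits (3 * n)) * (6 * stepError n)) := by
    intro g x
    have hp : (findState A (slotPair i g h) v).PosSemidef :=
      posSemidef_channel _ _ ((isQuantumOp_find A _).posSemidef (posSemidef_zeroState _))
    have hpr := IsQuantumOp.prepare A.chal _ (sum_norm_ket (Sum.elim x (g x)))
    refine sum_guess_le i g h x A.guess (isEffect_outcomeProb A.out b') (hpr.posSemidef hp) ?_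
    rw [hpr.trace]
    have h2 : wireProb A.msg v (run (pairOracle (pairQpk (slotPair i g h))
        (pairDec (slotPair i g h))) A.find (zeroState A.qubits)) ≤ _ :=
      Finset.single_le_sum (f := fun v => wireProb A.msg v (run (pairOracle (pairQpk (slotPair i g h))
        (pairDec (slotPair i g h))) A.find (zeroState A.qubits)))
        (fun v _ => wireProb_nonneg A.msg v ((isQuantumOp_find A _).posSemidef
          (posSemidef_zeroState _))) (Finset.mem_univ v)
    rw [sum_wireProb, (isQuantumOp_find A _).trace] at h2
    exact h2.trans htr
  have h2 : ∀ g : Bits n → Bits (3 * n), ∑ x, ∑ y, mid (Function.update g x y) g x y ≤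
      ∑ x, ∑ y, gameProb A (slotPair i g h) v b' (Sum.elim x y) +
        A.find.length * (Fintype.card (Bits n × Bits (3 * n)) * (6 * stepError n)) := by
    intro g
    have := sum_find_le i g h A.find
      (F := fun a ρ => outcomeProb A.out b' (run (pairOracle (pairQpk (slotPair i g h))
        (puncture (Sum.elim a.1 a.2) (pairDec (slotPair i g h)))) A.guess
        (prepare A.chal (ket (Sum.elim a.1 a.2)) (postMeasure A.msg v ρ))))
      (fun a => isEffect_guess A _ v b' _) (posSemidef_zeroState A.qubits) htr
    rw [Fintype.sum_prod_type, Fintype.sum_prod_type] at this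
    exact this
  calc _ ≤ ∑ g : Bits n → Bits (3 * n), ∑ x, (∑ z : Bits (3 * n),
        mid g (Function.update g x z) x (g x) +
        A.guess.length * (Fintype.card (Bits (3 * n)) * (6 * stepError n))) :=
        Finset.sum_le_sum fun g _ => Finset.sum_le_sum fun x _ => h1 g x
    _ = ∑ g : Bits n → Bits (3 * n), ∑ x, ∑ y, mid (Function.update g x y) g x y +
        Fintype.card (Bits n → Bits (3 * n)) * (Fintype.card (Bits n) *
          (A.guess.length * (Fintype.card (Bits (3 * n)) * (6 * stepError n)))) := by
        simp only [Finset.sum_add_distrib, Finset.sum_const, Finset.card_univ, nsmul_eq_mul]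
        -- Here the challenge `(x, g x)` becomes `(x, y)` with `y` free, and the modified function
        -- moves from the second phase to the first.
        rw [sum_update_swap mid]
    _ ≤ ∑ g : Bits n → Bits (3 * n), (∑ x, ∑ y, gameProb A (slotPair i g h) v b' (Sum.elim x y) +
        A.find.length * (Fintype.card (Bits n × Bits (3 * n)) * (6 * stepError n))) +
        Fintype.card (Bits n → Bits (3 * n)) * (Fintype.card (Bits n) *
          (A.guess.length * (Fintype.card (Bits (3 * n)) * (6 * stepError n)))) :=
        add_le_add (Finset.sum_le_sum fun g _ => h2 g) le_rfl
    _ ≤ _ := by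
        rw [Finset.sum_add_distrib, add_assoc]
        refine add_le_add le_rfl ?_
        simp only [Finset.sum_const, Finset.card_univ, nsmul_eq_mul, Fintype.card_prod]
        have : (A.find.length : ℝ) + A.guess.length ≤ A.size := by
          have : A.find.length + A.guess.length ≤ A.size := by unfold CCAAdversary.size; omega
          exact_mod_cast this
        have h3 := mul_le_mul_of_nonneg_left this (show (0 : ℝ) ≤
          Fintype.card (Bits n → Bits (3 * n)) * (Fintype.card (Bits n) *
            (Fintype.card (Bits (3 * n)) * (6 * stepError n))) by positivity)
        push_cast at h3 ⊢
        linarith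

/-- For a challenge fixed in advance, these are the probabilities of all results of one
trace-preserving experiment. -/
theorem sum_gameProb_eq_one {n : ℕ} (A : CCAAdversary (Bool × Pos n) (Pos n))
    (F : Bool → Bits n → Bits (3 * n)) (c : Pos n → Bool) :
    ∑ v : Bits 2, ∑ b', gameProb A F v b' c = 1 := by
  unfold gameProb
  simp only [sum_outcomeProb]
  have : ∀ v, (run (pairOracle (pairQpk F) (puncture c (pairDec F))) A.guess
      (prepare A.chal (ket c) (findState A F v))).trace = (findState A F v).trace := fun v => by
    rw [(isQuantumOp_run (fun o => isQuantumOp_pairOracle (sum_norm_pairQpk F) _ o) A.guess).trace,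
      (IsQuantumOp.prepare A.chal _ (sum_norm_ket c)).trace]
  simp only [this]
  change ∑ v, wireProb A.msg v _ = 1
  rw [sum_wireProb, (isQuantumOp_find A F).trace, trace_zeroState]
  simp

/-! ### Classical reversible programs with oracle calls -/

/-- A reversible operation on bits labelled by `ω`. Operations with colliding wires do nothing. -/
inductive ClassicalOp (n : ℕ) (ω : Type) : Type
  | x (t : ω)
  | cnot (c t : ω)
  | toffoli (a b t : ω)
  | query (e : Pos n ↪ ω)

section Classical

variable {n : ℕ} {ω : Type} [DecidableEq ω]

/-- The bits `v` are added to the wires `z`. -/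
noncomputable def xorAt {κ : Type} (z : κ → ω) (v : κ → Bool) (s : ω → Bool) : ω → Bool :=
  fun w => xor (s w) (Function.extend z v (fun _ => false) w)

theorem xorAt_apply {κ : Type} {z : κ → ω} (hz : Function.Injective z) (v : κ → Bool) (s : ω → Bool)
    (j : κ) : xorAt z v s (z j) = xor (s (z j)) (v j) := by
  simp [xorAt, hz.extend_apply]

theorem xorAt_of_ne {κ : Type} {z : κ → ω} (v : κ → Bool) (s : ω → Bool) {w : ω}
    (h : ∀ j, z j ≠ w) : xorAt z v s w = s w := by
  rw [xorAt, Function.extend_apply' _ _ _ (by rintro ⟨j, hj⟩; exact h j hj), Bool.xor_false]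

/-- The action of an operation on bit assignments. -/
noncomputable def ClassicalOp.eval (g : Bits n → Bits (3 * n)) : ClassicalOp n ω → (ω → Bool) → (ω → Bool)
  | .x t, s => Function.update s t (!(s t))
  | .cnot c t, s => if c = t then s else Function.update s t (xor (s t) (s c))
  | .toffoli a b t, s =>
    if a = t ∨ b = t ∨ a = b then s else Function.update s t (xor (s t) (s a && s b))
  | .query e, s => xorAt (fun j => e (Sum.inr j)) (g fun i => s (e (Sum.inl i))) s

/-- The wires that an operation may change. -/
def ClassicalOp.writes : ClassicalOp n ω → ω → Prop
  | .x t, w => w = t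
  | .cnot _ t, w => w = t
  | .toffoli _ _ t, w => w = t
  | .query e, w => ∃ j, w = e (Sum.inr j)

/-- The wires that an operation acts on. -/
def ClassicalOp.uses : ClassicalOp n ω → ω → Prop
  | .x t, w => w = t
  | .cnot c t, w => w = c ∨ w = t
  | .toffoli a b t, w => w = a ∨ w = b ∨ w = t
  | .query e, w => ∃ p, w = e p

theorem ClassicalOp.uses_of_writes {c : ClassicalOp n ω} {w : ω} (h : c.writes w) : c.uses w := by
  cases c with
  | x t => exact h
  | cnot c t => exact Or.inr h
  | toffoli a b t => exact Or.inr (Or.inr h)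
  | query e => obtain ⟨j, hj⟩ := h; exact ⟨_, hj⟩

theorem ClassicalOp.eval_of_not_writes (g : Bits n → Bits (3 * n)) {c : ClassicalOp n ω} {w : ω}
    (h : ¬ c.writes w) (s : ω → Bool) : c.eval g s w = s w := by
  cases c with
  | x t => exact Function.update_of_ne h _ _
  | cnot c t =>
    simp only [eval]
    split_ifs
    · rfl
    · exact Function.update_of_ne h _ _
  | toffoli a b t =>
    simp only [eval]
    split_ifs
    · rfl
    · exact Function.update_of_ne h _ _
  | query e => exact xorAt_of_ne _ _ fun j hj => h ⟨j, hj.symm⟩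

/-- The wire that is changed is never one that is read, thanks to the convention on collisions.
Hence the reversed list inverts a program. -/
theorem ClassicalOp.eval_eval (g : Bits n → Bits (3 * n)) (c : ClassicalOp n ω) (s : ω → Bool) :
    c.eval g (c.eval g s) = s := by
  cases c with
  | x t => simp [eval]
  | cnot c t =>
    simp only [eval]
    split_ifs with h
    · rfl
    · simp [Function.update_of_ne h]
  | toffoli a b t =>
    simp only [eval]
    split_ifs with h
    · rfl
    · push Not at h
      simp [Function.update_of_ne h.1, Function.update_of_ne h.2.1]
  | query e =>
    simp only [eval]
    have h : ∀ i, xorAt (fun j => e (Sum.inr j)) (g fun i => s (e (Sum.inl i))) s (e (Sum.inl i)) =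
        s (e (Sum.inl i)) := fun i => xorAt_of_ne _ _ fun j hj => by simpa using e.injective hj
    simp only [h]
    funext w
    simp [xorAt]

/-- A perturbation on untouched wires passes through. This lets an answer that was written after a
computation survive the uncomputation. -/
theorem ClassicalOp.eval_xor (g : Bits n → Bits (3 * n)) (c : ClassicalOp n ω) (s δ : ω → Bool)
    (h : ∀ w, c.uses w → δ w = false) :
    c.eval g (fun w => xor (s w) (δ w)) = fun w => xor (c.eval g s w) (δ w) := by
  have hu : ∀ t b, δ t = false → Function.update (fun w => xor (s w) (δ w)) t b =
      fun w => xor (Function.update s t b w) (δ w) := by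
    intro t b ht
    funext w
    by_cases hw : w = t
    · subst hw; simp [ht]
    · simp [hw]
  cases c with
  | x t =>
    have ht := h t rfl
    simp only [eval, ht, Bool.xor_false]
    exact hu t _ ht
  | cnot c t =>
    have ht := h t (Or.inr rfl)
    have hc := h c (Or.inl rfl)
    simp only [eval, ht, hc, Bool.xor_false]
    split_ifs
    · rfl
    · exact hu t _ ht
  | toffoli a b t =>
    have ht := h t (Or.inr (Or.inr rfl))
    have ha := h a (Or.inl rfl)
    have hb := h b (Or.inr (Or.inl rfl))
    simp only [eval, ht, ha, hb, Bool.xor_false]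
    split_ifs
    · rfl
    · exact hu t _ ht
  | query e =>
    have he : ∀ i, δ (e (Sum.inl i)) = false := fun i => h _ ⟨_, rfl⟩
    simp only [eval, he, Bool.xor_false]
    funext w
    simp only [xorAt]
    cases s w <;> cases δ w <;> simp

/-- The action of a program on bit assignments. -/
noncomputable def evalProg (g : Bits n → Bits (3 * n)) (P : List (ClassicalOp n ω)) (s : ω → Bool) :
    ω → Bool :=
  P.foldl (fun s c => c.eval g s) s

@[simp] theorem evalProg_nil (g : Bits n → Bits (3 * n)) (s : ω → Bool) : evalProg g [] s = s := rfl

@[simp] theorem evalProg_cons (g : Bits n → Bits (3 * n)) (c : ClassicalOp n ω)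
    (P : List (ClassicalOp n ω)) (s : ω → Bool) :
    evalProg g (c :: P) s = evalProg g P (c.eval g s) := rfl

theorem evalProg_append (g : Bits n → Bits (3 * n)) (P P' : List (ClassicalOp n ω)) (s : ω → Bool) :
    evalProg g (P ++ P') s = evalProg g P' (evalProg g P s) := by
  simp [evalProg]

theorem evalProg_reverse (g : Bits n → Bits (3 * n)) (P : List (ClassicalOp n ω)) (s : ω → Bool) :
    evalProg g P.reverse (evalProg g P s) = s := by
  induction P generalizing s with
  | nil => rfl
  | cons c P ih => rw [List.reverse_cons, evalProg_append, evalProg_cons g c P, ih]; exact c.eval_eval g s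

theorem evalProg_reverse' (g : Bits n → Bits (3 * n)) (P : List (ClassicalOp n ω)) (s : ω → Bool) :
    evalProg g P (evalProg g P.reverse s) = s := by
  have := evalProg_reverse g P.reverse s
  rwa [List.reverse_reverse] at this

/-- The program changes no wire outside `S`. -/
def WritesIn (P : List (ClassicalOp n ω)) (S : ω → Prop) : Prop := ∀ c ∈ P, ∀ w, c.writes w → S w

/-- The program acts on no wire outside `S`. -/
def UsesIn (P : List (ClassicalOp n ω)) (S : ω → Prop) : Prop := ∀ c ∈ P, ∀ w, c.uses w → S w

theorem WritesIn.append {P P' : List (ClassicalOp n ω)} {S : ω → Prop} (h : WritesIn P S)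
    (h' : WritesIn P' S) : WritesIn (P ++ P') S := by
  intro c hc
  rcases List.mem_append.1 hc with hc | hc
  · exact h c hc
  · exact h' c hc

theorem UsesIn.append {P P' : List (ClassicalOp n ω)} {S : ω → Prop} (h : UsesIn P S)
    (h' : UsesIn P' S) : UsesIn (P ++ P') S := by
  intro c hc
  rcases List.mem_append.1 hc with hc | hc
  · exact h c hc
  · exact h' c hc

theorem UsesIn.reverse {P : List (ClassicalOp n ω)} {S : ω → Prop} (h : UsesIn P S) :
    UsesIn P.reverse S := fun c hc => h c (List.mem_reverse.1 hc)

theorem UsesIn.mono {P : List (ClassicalOp n ω)} {S T : ω → Prop} (h : UsesIn P S)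
    (hST : ∀ w, S w → T w) : UsesIn P T := fun c hc w hw => hST w (h c hc w hw)

theorem UsesIn.writesIn {P : List (ClassicalOp n ω)} {S : ω → Prop} (h : UsesIn P S) :
    WritesIn P S := fun c hc w hw => h c hc w (ClassicalOp.uses_of_writes hw)

theorem WritesIn.eval_eq {P : List (ClassicalOp n ω)} {S : ω → Prop} (h : WritesIn P S)
    (g : Bits n → Bits (3 * n)) {w : ω} (hw : ¬ S w) (s : ω → Bool) : evalProg g P s w = s w := by
  induction P generalizing s with
  | nil => rfl
  | cons c P ih =>
    rw [evalProg_cons, ih fun c' hc' => h c' (List.mem_cons_of_mem _ hc')]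
    exact c.eval_of_not_writes g (fun hc => hw (h c List.mem_cons_self w hc)) s

theorem UsesIn.eval_xor {P : List (ClassicalOp n ω)} {S : ω → Prop} (h : UsesIn P S)
    (g : Bits n → Bits (3 * n)) (s δ : ω → Bool) (hδ : ∀ w, S w → δ w = false) :
    evalProg g P (fun w => xor (s w) (δ w)) = fun w => xor (evalProg g P s w) (δ w) := by
  induction P generalizing s with
  | nil => rfl
  | cons c P ih =>
    rw [evalProg_cons, c.eval_xor g s δ fun w hw => hδ w (h c List.mem_cons_self w hw),
      ih fun c' hc' => h c' (List.mem_cons_of_mem _ hc')]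
    rfl

/-- Compute, copy the result to wires that the computation does not touch, and uncompute. -/
theorem UsesIn.eval_conj {κ : Type} {P W : List (ClassicalOp n ω)} {S : ω → Prop} (h : UsesIn P S)
    (g : Bits n → Bits (3 * n)) (z : κ → ω) (v : κ → Bool) (s : ω → Bool) (hz : ∀ j, ¬ S (z j))
    (hW : evalProg g W (evalProg g P s) = xorAt z v (evalProg g P s)) :
    evalProg g (P ++ W ++ P.reverse) s = xorAt z v s := by
  have hδ : ∀ w, S w → Function.extend z v (fun _ => false) w = false := by
    intro w hw
    rw [Function.extend_apply']
    rintro ⟨j, rfl⟩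
    exact hz j hw
  rw [evalProg_append, evalProg_append, hW]
  have := h.reverse.eval_xor g (evalProg g P s) _ hδ
  rw [evalProg_reverse] at this
  exact this

/-! ### Copying and comparing registers -/

/-- The targets are distinct and are never sources, so the single gates do not interfere. -/
theorem evalProg_cnots {κ : Type} (g : Bits n → Bits (3 * n)) (src z : κ → ω)
    (hz : Function.Injective z) (hsrc : ∀ i j, src i ≠ z j) (l : List κ) (hl : l.Nodup)
    (hmem : ∀ j, j ∈ l) (s : ω → Bool) :
    evalProg g (l.map fun j => .cnot (src j) (z j)) s = xorAt z (fun j => s (src j)) s := by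
  have h1 : ∀ (l : List κ) (s : ω → Bool) (w : ω), (∀ j ∈ l, z j ≠ w) →
      evalProg g (l.map fun j => ClassicalOp.cnot (src j) (z j)) s w = s w := by
    intro l s w hw
    refine WritesIn.eval_eq (S := fun w' => w' ≠ w) ?_ g (by simp) s
    intro c hc w' hw'
    obtain ⟨j, hj, rfl⟩ := List.mem_map.1 hc
    rw [show w' = z j from hw']
    exact hw j hj
  have h2 : ∀ (l : List κ) (s : ω → Bool), l.Nodup → ∀ j ∈ l,
      evalProg g (l.map fun j => ClassicalOp.cnot (src j) (z j)) s (z j) =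
        xor (s (z j)) (s (src j)) := by
    intro l
    induction l with
    | nil => intro s _ j hj; simp at hj
    | cons i l ih =>
      intro s hl j hj
      rw [List.nodup_cons] at hl
      rw [List.map_cons, evalProg_cons]
      simp only [ClassicalOp.eval, if_neg (hsrc i i)]
      rcases List.mem_cons.1 hj with hji | hj
      · subst hji
        have h3 : ∀ i ∈ l, z i ≠ z j := fun i hi h => by
          rw [hz h] at hi
          exact hl.1 hi
        rw [h1 l _ _ h3, Function.update_self]
      · have hji : j ≠ i := fun h => hl.1 (h ▸ hj)
        rw [ih _ hl.2 j hj, Function.update_of_ne (fun h => hji (hz h)),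
          Function.update_of_ne (hsrc j i)]
  funext w
  by_cases hw : ∃ j, z j = w
  · obtain ⟨j, rfl⟩ := hw
    rw [h2 l s hl j (hmem j), xorAt_apply hz]
  · push Not at hw
    rw [h1 l s w fun j _ => hw j, xorAt_of_ne _ _ hw]

/-- Compare the pairs of wires in the list, starting at position `j` of the work registers. -/
def eqProg (reg acc : ℕ → ω) : List (ω × ω) → ℕ → List (ClassicalOp n ω)
  | [], _ => []
  | p :: l, j => [.cnot p.1 (reg j), .cnot p.2 (reg j), .x (reg j), .toffoli (acc j) (reg j) (acc (j + 1))]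
      ++ eqProg reg acc l (j + 1)

theorem length_eqProg (reg acc : ℕ → ω) (l : List (ω × ω)) (j : ℕ) :
    (eqProg reg acc l j : List (ClassicalOp n ω)).length = 4 * l.length := by
  induction l generalizing j with
  | nil => rfl
  | cons p l ih => simp only [eqProg, List.length_append, ih, List.length_cons, List.length_nil]; omega

theorem usesIn_eqProg (reg acc : ℕ → ω) (l : List (ω × ω)) (j : ℕ) :
    UsesIn (eqProg reg acc l j : List (ClassicalOp n ω))
      fun w => (∃ p ∈ l, w = p.1 ∨ w = p.2) ∨ (∃ i, w = reg i) ∨ ∃ i, w = acc i := by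
  induction l generalizing j with
  | nil => intro c hc; simp [eqProg] at hc
  | cons p l ih =>
    refine UsesIn.append ?_ ((ih (j + 1)).mono ?_)
    · intro c hc w hw
      simp only [List.mem_cons, List.not_mem_nil, or_false] at hc
      rcases hc with rfl | rfl | rfl | rfl <;> simp only [ClassicalOp.uses] at hw
      · rcases hw with rfl | rfl
        · exact Or.inl ⟨p, by simp⟩
        · exact Or.inr (Or.inl ⟨_, rfl⟩)
      · rcases hw with rfl | rfl
        · exact Or.inl ⟨p, by simp⟩
        · exact Or.inr (Or.inl ⟨_, rfl⟩)
      · exact Or.inr (Or.inl ⟨_, hw⟩)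
      · rcases hw with rfl | rfl | rfl
        · exact Or.inr (Or.inr ⟨_, rfl⟩)
        · exact Or.inr (Or.inl ⟨_, rfl⟩)
        · exact Or.inr (Or.inr ⟨_, rfl⟩)
    · rintro w (⟨p, hp, h⟩ | h)
      · exact Or.inl ⟨p, List.mem_cons_of_mem _ hp, h⟩
      · exact Or.inr h

theorem writesIn_eqProg (reg acc : ℕ → ω) (l : List (ω × ω)) (j : ℕ) :
    WritesIn (eqProg reg acc l j : List (ClassicalOp n ω))
      fun w => (∃ i, w = reg i) ∨ ∃ i, w = acc i := by
  induction l generalizing j with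
  | nil => intro c hc; simp [eqProg] at hc
  | cons p l ih =>
    refine WritesIn.append ?_ (ih (j + 1))
    intro c hc w hw
    simp only [List.mem_cons, List.not_mem_nil, or_false] at hc
    rcases hc with rfl | rfl | rfl | rfl <;> simp only [ClassicalOp.writes] at hw
    · exact Or.inl ⟨_, hw⟩
    · exact Or.inl ⟨_, hw⟩
    · exact Or.inl ⟨_, hw⟩
    · exact Or.inr ⟨_, hw⟩

/-- The work bit becomes `u ⊕ v ⊕ 1`, which is the equality test, and the Toffoli gate multiplies it
into the accumulator. -/
theorem evalProg_eqStep (g : Bits n → Bits (3 * n)) {u v r a a' : ω} (s : ω → Bool) (hu : u ≠ r)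
    (hv : v ≠ r) (ha : a ≠ r) (ha' : a' ≠ r) (haa : a ≠ a') (hr : s r = false) (ha0 : s a' = false) :
    evalProg g [.cnot u r, .cnot v r, .x r, .toffoli a r a'] s =
      Function.update (Function.update s r (s u == s v)) a' (s a && (s u == s v)) := by
  have h : ¬ (a = a' ∨ r = a' ∨ a = r) := by
    rintro (h | h | h)
    · exact haa h
    · exact ha' h.symm
    · exact ha h
  simp only [evalProg_cons, evalProg_nil, ClassicalOp.eval, if_neg hu, if_neg hv, if_neg h,
    Function.update_self, Function.update_of_ne hv, Function.update_of_ne ha, Function.update_of_ne ha',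
    Function.update_idem, hr, ha0]
  cases s u <;> cases s v <;> simp

/-- Each comparison gets its own work bit and passes a running conjunction to the next accumulator
bit. Injectivity is required only up to `B`, since the registers are finite and indices wrap around.
-/
theorem evalProg_eqProg (g : Bits n → Bits (3 * n)) {reg acc : ℕ → ω} {B : ℕ}
    (hreg : ∀ i ≤ B, ∀ j ≤ B, reg i = reg j → i = j) (hacc : ∀ i ≤ B, ∀ j ≤ B, acc i = acc j → i = j)
    (hra : ∀ i j, acc i ≠ reg j) (l : List (ω × ω)) (j : ℕ) (hj : j + l.length ≤ B)
    (hl : ∀ p ∈ l, (∀ i, p.1 ≠ reg i ∧ p.1 ≠ acc i) ∧ ∀ i, p.2 ≠ reg i ∧ p.2 ≠ acc i) (s : ω → Bool)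
    (hsr : ∀ i, j ≤ i → i ≤ B → s (reg i) = false) (hsa : ∀ i, j < i → i ≤ B → s (acc i) = false) :
    evalProg g (eqProg reg acc l j) s (acc (j + l.length)) =
      (s (acc j) && l.all fun p => s p.1 == s p.2) := by
  induction l generalizing j s with
  | nil => simp [eqProg]
  | cons p l ih =>
    have hp := hl p List.mem_cons_self
    rw [List.length_cons] at hj
    have hne : acc j ≠ acc (j + 1) := fun h => by
      have := hacc j (by omega) (j + 1) (by omega) h
      omega
    rw [eqProg, evalProg_append, evalProg_eqStep g s (hp.1 j).1 (hp.2 j).1 (hra _ _) (hra _ _) hne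
      (hsr j le_rfl (by omega)) (hsa (j + 1) (by omega) (by omega))]
    rw [List.length_cons, show j + (l.length + 1) = j + 1 + l.length by omega,
      ih (j + 1) (by omega) (fun q hq => hl q (List.mem_cons_of_mem _ hq))]
    · rw [Function.update_self, List.all_cons, Bool.and_assoc]
      congr 2
      rw [Bool.eq_iff_iff, List.all_eq_true, List.all_eq_true]
      refine forall₂_congr fun q hq => ?_
      have hq := hl q (List.mem_cons_of_mem _ hq)
      rw [Function.update_of_ne (hq.1 _).2, Function.update_of_ne (hq.1 _).1,
        Function.update_of_ne (hq.2 _).2, Function.update_of_ne (hq.2 _).1]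
    · intro i hi hiB
      rw [Function.update_of_ne (hra _ _).symm, Function.update_of_ne, hsr i (by omega) hiB]
      intro h
      have := hreg i hiB j (by omega) h
      omega
    · intro i hi hiB
      rw [Function.update_of_ne, Function.update_of_ne (hra _ _), hsa i (by omega) hiB]
      intro h
      have := hacc i hiB (j + 1) (by omega) h
      omega

/-! ### Boolean circuits as reversible programs -/

/-- Load constants and wires into consecutive positions of the work register. -/
def loadProg (val : ℕ → ω) : List (Bool ⊕ ω) → ℕ → List (ClassicalOp n ω)
  | [], _ => []
  | Sum.inl b :: l, t => (if b then [.x (val t)] else []) ++ loadProg val l (t + 1)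
  | Sum.inr w :: l, t => [.cnot w (val t)] ++ loadProg val l (t + 1)

/-- A NAND gate whose result is written to position `t` of the work register. -/
def nandProg (val : ℕ → ω) (p : ℕ × ℕ) (t : ℕ) : List (ClassicalOp n ω) :=
  -- An operand that does not exist yet reads as `false`, so the NAND is `true`.
  if t ≤ p.1 ∨ t ≤ p.2 then [.x (val t)]
  -- A Toffoli gate with equal controls would be a collision; the NAND of a bit with itself is its
  -- negation.
  else if p.1 = p.2 then [.cnot (val p.1) (val t), .x (val t)]
  else [.toffoli (val p.1) (val p.2) (val t), .x (val t)]

/-- A NAND circuit whose results are written to consecutive positions of the work register. -/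
def circuitProg (val : ℕ → ω) : List (ℕ × ℕ) → ℕ → List (ClassicalOp n ω)
  | [], _ => []
  | p :: C, t => nandProg val p t ++ circuitProg val C (t + 1)

theorem length_loadProg (val : ℕ → ω) (l : List (Bool ⊕ ω)) (t : ℕ) :
    (loadProg val l t : List (ClassicalOp n ω)).length ≤ l.length := by
  induction l generalizing t with
  | nil => exact le_rfl
  | cons a l ih =>
    have := ih (t + 1)
    cases a with
    | inl b => cases b <;> simp [loadProg] <;> omega
    | inr w => simp [loadProg]; omega

theorem length_circuitProg (val : ℕ → ω) (C : List (ℕ × ℕ)) (t : ℕ) :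
    (circuitProg val C t : List (ClassicalOp n ω)).length ≤ 2 * C.length := by
  induction C generalizing t with
  | nil => exact le_rfl
  | cons p C ih =>
    have := ih (t + 1)
    have h2 : (nandProg val p t : List (ClassicalOp n ω)).length ≤ 2 := by
      unfold nandProg; split_ifs <;> simp
    simp only [circuitProg, List.length_append, List.length_cons]
    omega

theorem usesIn_loadProg (val : ℕ → ω) (l : List (Bool ⊕ ω)) (t : ℕ) :
    UsesIn (loadProg val l t : List (ClassicalOp n ω))
      fun w => Sum.inr w ∈ l ∨ ∃ i, w = val i := by
  induction l generalizing t with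
  | nil => intro c hc; simp [loadProg] at hc
  | cons a l ih =>
    have h := (ih (t + 1)).mono (T := fun w => Sum.inr w ∈ a :: l ∨ ∃ i, w = val i)
      fun w hw => hw.imp (List.mem_cons_of_mem _) id
    cases a with
    | inl b =>
      refine UsesIn.append ?_ h
      intro c hc w hw
      cases b
      · simp at hc
      · simp only [if_true, List.mem_singleton] at hc
        subst hc
        exact Or.inr ⟨t, hw⟩
    | inr u =>
      refine UsesIn.append ?_ h
      intro c hc w hw
      simp only [List.mem_singleton] at hc
      subst hc
      rcases hw with rfl | rfl
      · exact Or.inl List.mem_cons_self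
      · exact Or.inr ⟨t, rfl⟩

theorem usesIn_circuitProg (val : ℕ → ω) (C : List (ℕ × ℕ)) (t : ℕ) :
    UsesIn (circuitProg val C t : List (ClassicalOp n ω)) fun w => ∃ i, w = val i := by
  induction C generalizing t with
  | nil => intro c hc; simp [circuitProg] at hc
  | cons p C ih =>
    refine UsesIn.append ?_ (ih (t + 1))
    intro c hc w hw
    unfold nandProg at hc
    split_ifs at hc <;> simp only [List.mem_cons, List.not_mem_nil, or_false] at hc
    · subst hc
      exact ⟨_, hw⟩
    · rcases hc with rfl | rfl
      · rcases hw with rfl | rfl <;> exact ⟨_, rfl⟩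
      · exact ⟨_, hw⟩
    · rcases hc with rfl | rfl
      · rcases hw with rfl | rfl | rfl <;> exact ⟨_, rfl⟩
      · exact ⟨_, hw⟩

/-- The work register `val` contains the list `v`, followed by zeros. -/
def Holds (val : ℕ → ω) (B : ℕ) (v : List Bool) (s : ω → Bool) : Prop :=
  ∀ i ≤ B, s (val i) = v.getD i false

theorem Holds.update {val : ℕ → ω} {B : ℕ} (hval : ∀ i ≤ B, ∀ j ≤ B, val i = val j → i = j)
    {v : List Bool} {s : ω → Bool} (h : Holds val B v s) (hv : v.length ≤ B) (b : Bool) :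
    Holds val B (v ++ [b]) (Function.update s (val v.length) b) := by
  intro i hi
  by_cases hiv : i = v.length
  · subst hiv
    simp
  · rw [Function.update_of_ne (fun hh => hiv (hval i hi _ hv hh)), h i hi]
    rcases lt_or_gt_of_ne hiv with h1 | h1
    · simp [List.getD_eq_getElem?_getD, List.getElem?_append_left h1]
    · rw [List.getD_eq_default _ _ h1.le, List.getD_eq_default]
      simp; omega

theorem holds_loadProg (g : Bits n → Bits (3 * n)) {val : ℕ → ω} {B : ℕ}
    (hval : ∀ i ≤ B, ∀ j ≤ B, val i = val j → i = j) (l : List (Bool ⊕ ω))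
    (hl : ∀ w, Sum.inr w ∈ l → ∀ i, w ≠ val i) (v : List Bool) (hv : v.length + l.length ≤ B)
    (s : ω → Bool) (h : Holds val B v s) :
    Holds val B (v ++ l.map (Sum.elim id s)) (evalProg g (loadProg val l v.length) s) := by
  induction l generalizing v s with
  | nil => simpa [loadProg] using h
  | cons a l ih =>
    rw [List.length_cons] at hv
    have key : ∀ (b : Bool), Sum.elim id s a = b →
        Holds val B (v ++ (a :: l).map (Sum.elim id s))
          (evalProg g (loadProg val l (v.length + 1)) (Function.update s (val v.length) b)) := by
      intro b hb
      have h1 := ih (fun w hw => hl w (List.mem_cons_of_mem _ hw)) (v ++ [b]) (by simp; omega) _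
        (h.update hval (by omega) b)
      rw [List.length_append, List.length_singleton, List.append_assoc] at h1
      rw [List.map_cons, hb]
      have h2 : l.map (Sum.elim id (Function.update s (val v.length) b)) = l.map (Sum.elim id s) := by
        refine List.map_congr_left fun a ha => ?_
        cases a with
        | inl b => rfl
        | inr w => exact Function.update_of_ne (hl w (List.mem_cons_of_mem _ ha) _) _ _
      rw [h2] at h1
      exact h1
    have h0 : s (val v.length) = false := by
      rw [h _ (by omega), List.getD_eq_default _ _ le_rfl]
    cases a with
    | inl b =>
      cases b with
      | false =>
        have := key false rfl
        rw [Function.update_eq_self_iff.2 h0.symm] at this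
        exact this
      | true =>
        have := key true rfl
        simpa [loadProg, ClassicalOp.eval, h0] using this
    | inr w =>
      have := key (s w) rfl
      simpa [loadProg, ClassicalOp.eval, h0, hl w List.mem_cons_self] using this

/-- The work register always mirrors the list of values of the straight-line evaluation; each gate
fills the first unused, hence zero, position. -/
theorem holds_circuitProg (g : Bits n → Bits (3 * n)) {val : ℕ → ω} {B : ℕ}
    (hval : ∀ i ≤ B, ∀ j ≤ B, val i = val j → i = j) (C : List (ℕ × ℕ)) (v : List Bool)
    (hv : v.length + C.length ≤ B) (s : ω → Bool) (h : Holds val B v s) :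
    Holds val B (evalCircuit C v) (evalProg g (circuitProg val C v.length) s) := by
  induction C generalizing v s with
  | nil => exact h
  | cons p C ih =>
    rw [List.length_cons] at hv
    have h0 : s (val v.length) = false := by
      rw [h _ (by omega), List.getD_eq_default _ _ le_rfl]
    have hne : ∀ i < v.length, val i ≠ val v.length := fun i hi hh => by
      have := hval i (by omega) _ (by omega) hh
      omega
    have hstep : evalProg g (nandProg val p v.length) s = Function.update s (val v.length)
        (!(v.getD p.1 false && v.getD p.2 false)) := by
      unfold nandProg
      split_ifs with h1 h2
      · have : (v.getD p.1 false && v.getD p.2 false) = false := by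
          rcases h1 with h1 | h1
          · rw [List.getD_eq_default _ _ h1, Bool.false_and]
          · rw [List.getD_eq_default v _ h1, Bool.and_false]
        rw [this]
        simp [ClassicalOp.eval, h0]
      · push Not at h1
        rw [← h p.1 (by omega), ← h2, ← h p.1 (by omega)]
        simp [ClassicalOp.eval, h0, hne _ h1.1]
      · push Not at h1
        have h3 : ¬ (val p.1 = val v.length ∨ val p.2 = val v.length ∨ val p.1 = val p.2) := by
          rintro (h3 | h3 | h3)
          · exact hne _ h1.1 h3
          · exact hne _ h1.2 h3
          · exact h2 (hval _ (by omega) _ (by omega) h3)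
        rw [← h p.1 (by omega), ← h p.2 (by omega)]
        simp only [evalProg_cons, evalProg_nil, ClassicalOp.eval, if_neg h3, h0,
          Function.update_self, Function.update_idem, Bool.false_xor]
    rw [circuitProg, evalProg_append, hstep]
    have := ih (v ++ [!(v.getD p.1 false && v.getD p.2 false)]) (by simp; omega) _
      (h.update hval (by omega) _)
    rw [List.length_append, List.length_singleton] at this
    exact this

theorem length_evalCircuit (C : List (ℕ × ℕ)) (v : List Bool) :
    (evalCircuit C v).length = v.length + C.length := by
  induction C generalizing v with
  | nil => rfl
  | cons p C ih =>
    have := ih (v ++ [!(v.getD p.1 false && v.getD p.2 false)])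
    simp only [evalCircuit, List.foldl_cons] at this ⊢
    rw [this]
    simp; omega

/-- A function that is computed by a circuit can be called like an oracle, with the help of a work
register. -/
theorem exists_circuit_query (val : ℕ → ω) {B : ℕ} (hval : ∀ i ≤ B, ∀ j ≤ B, val i = val j → i = j)
    (C : List (ℕ × ℕ)) (out : Fin (3 * n) → ℕ) (k : Bits n) (h : Bits n → Bits (3 * n))
    (hB : 2 * n + C.length ≤ B)
    (hC : ∀ x j, (evalCircuit C (List.ofFn k ++ List.ofFn x)).getD (out j) false = h x j)
    (e : Pos n ↪ ω) (he : ∀ p i, e p ≠ val i) :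
    ∃ Q : List (ClassicalOp n ω), Q.length ≤ 7 * n + 4 * C.length ∧
      UsesIn Q (fun w => (∃ p, w = e p) ∨ ∃ i, w = val i) ∧
      WritesIn Q (fun w => (∃ j, w = e (Sum.inr j)) ∨ ∃ i, w = val i) ∧
      ∀ (g : Bits n → Bits (3 * n)) (s : ω → Bool), (∀ i, s (val i) = false) →
        evalProg g Q s = xorAt (fun j => e (Sum.inr j)) (h fun i => s (e (Sum.inl i))) s := by
  let src : List (Bool ⊕ ω) := List.ofFn (fun i => Sum.inl (k i)) ++
    List.ofFn (fun i => Sum.inr (e (Sum.inl i)))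
  let P : List (ClassicalOp n ω) := loadProg val src 0 ++ circuitProg val C (2 * n)
  -- Output indices may exceed the register. Truncating them at `B` is harmless: position `B` lies
  -- beyond all `2 * n + C.length` values and holds `false`, which is also the default value of the
  -- circuit.
  let W : List (ClassicalOp n ω) := (List.finRange (3 * n)).map
    fun j => .cnot (val (min (out j) B)) (e (Sum.inr j))
  have hsrc : ∀ w, Sum.inr w ∈ src → ∃ i, w = e (Sum.inl i) := by
    intro w hw
    simp only [src, List.mem_append, List.mem_ofFn] at hw
    rcases hw with ⟨i, hi⟩ | ⟨i, hi⟩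
    · cases hi
    · exact ⟨i, (Sum.inr_injective hi).symm⟩
  have hsrcl : src.length = 2 * n := by simp [src]; omega
  have hPu : UsesIn P (fun w => (∃ i, w = e (Sum.inl i)) ∨ ∃ i, w = val i) :=
    UsesIn.append ((usesIn_loadProg val src 0).mono fun w hw => hw.imp (hsrc w) id)
      ((usesIn_circuitProg val C _).mono fun w hw => Or.inr hw)
  have hPw : WritesIn P (fun w => ∃ i, w = val i) := by
    refine WritesIn.append ?_ (usesIn_circuitProg val C _).writesIn
    have : ∀ (l : List (Bool ⊕ ω)) (t : ℕ), WritesIn (loadProg val l t : List (ClassicalOp n ω))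
        (fun w => ∃ i, w = val i) := by
      intro l
      induction l with
      | nil => intro t c hc; simp [loadProg] at hc
      | cons a l ih =>
        intro t
        cases a with
        | inl b =>
          refine WritesIn.append ?_ (ih _)
          intro c hc w hw
          cases b
          · simp at hc
          · simp only [if_true, List.mem_singleton] at hc
            subst hc
            exact ⟨t, hw⟩
        | inr u =>
          refine WritesIn.append ?_ (ih _)
          intro c hc w hw
          simp only [List.mem_singleton] at hc
          subst hc
          exact ⟨t, hw⟩
    exact this src 0
  have hWu : UsesIn W (fun w => (∃ p, w = e p) ∨ ∃ i, w = val i) := by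
    intro c hc w hw
    obtain ⟨j, _, rfl⟩ := List.mem_map.1 hc
    rcases hw with rfl | rfl
    · exact Or.inr ⟨_, rfl⟩
    · exact Or.inl ⟨_, rfl⟩
  have hWw : WritesIn W (fun w => (∃ j, w = e (Sum.inr j)) ∨ ∃ i, w = val i) := by
    intro c hc w hw
    obtain ⟨j, _, rfl⟩ := List.mem_map.1 hc
    exact Or.inl ⟨_, hw⟩
  have hPu' := hPu.mono (T := fun w => (∃ p, w = e p) ∨ ∃ i, w = val i)
    fun w hw => hw.imp (fun ⟨i, hi⟩ => ⟨_, hi⟩) id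
  refine ⟨P ++ W ++ P.reverse, ?_, (hPu'.append hWu).append hPu'.reverse, ?_, ?_⟩
  · have h1 := length_loadProg (n := n) val src 0
    have h2 := length_circuitProg (n := n) val C (2 * n)
    simp only [P, W, List.length_append, List.length_map, List.length_finRange, List.length_reverse]
    omega
  · refine WritesIn.append (WritesIn.append (fun c hc w hw => Or.inr (hPw c hc w hw)) hWw) ?_
    exact fun c hc w hw => Or.inr (hPw c (List.mem_reverse.1 hc) w hw)
  · intro g s hs
    refine hPu.eval_conj g _ _ s ?_ ?_
    · rintro j (⟨i, hi⟩ | ⟨i, hi⟩)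
      · simpa using e.injective hi
      · exact he _ _ hi
    · have hload := holds_loadProg g hval src (fun w hw i => by
          obtain ⟨i', rfl⟩ := hsrc w hw
          exact he _ _) [] (by rw [hsrcl]; simp; omega) s (fun i _ => by simp [hs])
      have hcirc := holds_circuitProg g hval C ([] ++ src.map (Sum.elim id s))
        (by rw [List.nil_append, List.length_map, hsrcl]; exact hB) _ hload
      have hin : [] ++ src.map (Sum.elim id s) =
          List.ofFn k ++ List.ofFn (fun i => s (e (Sum.inl i))) := by
        simp [src, List.map_ofFn, Function.comp_def]
      have hl2 : (List.ofFn k ++ List.ofFn (fun i => s (e (Sum.inl i)))).length = 2 * n := by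
        simp; omega
      rw [hin, hl2, List.length_nil, ← evalProg_append] at hcirc
      rw [evalProg_cnots g (fun j => val (min (out j) B)) (fun j => e (Sum.inr j))
        (fun i j hij => by simpa using e.injective hij) (fun i j => (he _ _).symm) _
        (List.nodup_finRange _) List.mem_finRange]
      congr 1
      funext j
      rw [← hC, show evalProg g P s (val (min (out j) B)) = _ from hcirc _ (min_le_right _ _)]
      rcases le_total (out j) B with h1 | h1
      · rw [min_eq_left h1]
      · rw [min_eq_right h1, List.getD_eq_default, List.getD_eq_default]
        · rw [length_evalCircuit, hl2]; omega
        · rw [length_evalCircuit, hl2]; omega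

end Classical

/-! ### Decryption as a reversible program -/

/-- The ancillas of the simulation: sixteen registers of `K + 1` bits. -/
abbrev Ancilla (K : ℕ) : Type := Fin 16 × Fin (K + 1)

/-- The wires of the simulation: those of the simulated adversary and the ancillas. -/
abbrev Wire (m K : ℕ) : Type := Fin m ⊕ Ancilla K

/-- Bit `i` of the ancilla register `k`. -/
def anc {m K : ℕ} (k : Fin 16) (i : ℕ) : Wire m K := Sum.inr (k, Fin.ofNat (K + 1) i)

@[simp] theorem anc_ne_inl {m K : ℕ} (k : Fin 16) (i : ℕ) (q : Fin m) :
    (anc k i : Wire m K) ≠ Sum.inl q := Sum.inr_ne_inl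

@[simp] theorem inl_ne_anc {m K : ℕ} (k : Fin 16) (i : ℕ) (q : Fin m) :
    (Sum.inl q : Wire m K) ≠ anc k i := Sum.inl_ne_inr

theorem anc_ne {m K : ℕ} {k k' : Fin 16} (h : k ≠ k') (i j : ℕ) :
    (anc k i : Wire m K) ≠ anc k' j := by
  intro h'
  exact h (congrArg Prod.fst (Sum.inr_injective h'))

theorem anc_injOn {m K : ℕ} (k : Fin 16) : ∀ i ≤ K, ∀ j ≤ K, (anc k i : Wire m K) = anc k j → i = j := by
  intro i hi j hj h
  have := congrArg (fun p => (Prod.snd p).val) (Sum.inr_injective h)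
  simpa [Fin.ofNat, Nat.mod_eq_of_lt (Nat.lt_succ_of_le hi), Nat.mod_eq_of_lt (Nat.lt_succ_of_le hj)]
    using this

/-- The wires that hold the challenge ciphertext. -/
def chalWire {n m K : ℕ} : Pos n → Wire m K :=
  Sum.elim (fun i => anc 9 i) (fun j => anc 10 j)

/-- The wire that tells whether the challenge has been sent. -/
def liveWire {m K : ℕ} : Wire m K := anc 11 0

/-- The work registers are zero. -/
def Clean {m K : ℕ} (s : Wire m K → Bool) : Prop := ∀ k : Fin 16, k.val < 9 → ∀ i, s (anc k i) = false

/-- `h` is evaluated by the circuit `C`, with some constants as a part of the input. -/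
def ComputedBy {n : ℕ} (C : List (ℕ × ℕ)) (h : Bits n → Bits (3 * n)) : Prop :=
  ∃ (out : Fin (3 * n) → ℕ) (k : Bits n), ∀ x j,
    (evalCircuit C (List.ofFn k ++ List.ofFn x)).getD (out j) false = h x j

/-- The function in the attacked slot is one oracle call; the other one is its circuit, with ancilla
register 0 as workspace. Both have the same external behaviour for every `g`. -/
theorem exists_slot_query {n m K : ℕ} {C : List (ℕ × ℕ)} {h : Bits n → Bits (3 * n)}
    (hC : ComputedBy C h) (hK : 4 * n + C.length ≤ K) (slot b : Bool) (e : Pos n ↪ Wire m K)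
    (he : ∀ p i, e p ≠ anc 0 i) :
    ∃ Q : List (ClassicalOp n (Wire m K)), Q.length ≤ 7 * n + 4 * C.length + 1 ∧
      UsesIn Q (fun w => (∃ p, w = e p) ∨ ∃ i, w = anc 0 i) ∧
      WritesIn Q (fun w => (∃ j, w = e (Sum.inr j)) ∨ ∃ i, w = anc 0 i) ∧
      ∀ (g : Bits n → Bits (3 * n)) (s : Wire m K → Bool), (∀ i, s (anc 0 i) = false) →
        evalProg g Q s =
          xorAt (fun j => e (Sum.inr j)) (slotPair slot g h b fun i => s (e (Sum.inl i))) s := by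
  by_cases hb : b = slot
  · refine ⟨[.query e], by simp, ?_, ?_, ?_⟩
    · intro c hc w hw
      rw [List.mem_singleton] at hc
      subst hc
      exact Or.inl hw
    · intro c hc w hw
      rw [List.mem_singleton] at hc
      subst hc
      exact Or.inl hw
    · intro g s _
      simp only [slotPair, if_pos hb]
      rfl
  · obtain ⟨out, k, hC⟩ := hC
    obtain ⟨Q, h1, h2, h3, h4⟩ := exists_circuit_query (anc 0) (anc_injOn (m := m) (K := K) 0) C out k h
      (by omega) hC e he
    refine ⟨Q, by omega, h2, h3, fun g s hs => ?_⟩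
    simp only [slotPair, if_neg hb]
    exact h4 g s hs

/-- The answer bits are `E0 ∨ E1` and `E1 ∧ ¬ E0`, the latter because slot 0 has priority. They are
written as XOR polynomials so that CNOT and Toffoli gates produce them. -/
theorem encodeAnswer_dec (dead p q : Prop) [Decidable dead] [Decidable p] [Decidable q]
    {E0 E1 : Bool} (h0 : E0 = true ↔ ¬ dead ∧ p) (h1 : E1 = true ↔ ¬ dead ∧ q) :
    encodeAnswer (if dead then none else if p then some false else if q then some true else none) =
      ![xor (xor E0 E1) (E0 && E1), xor E1 (E0 && E1)] := by
  by_cases hd : dead <;> by_cases hp : p <;> by_cases hq : q <;>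
    simp only [hd, hp, hq, not_true, not_false_iff, and_true, and_false, true_and, false_and,
      iff_true, iff_false, Bool.not_eq_true] at h0 h1 <;>
    simp [encodeAnswer, hd, hp, hq, h0, h1]

/-- Both function values are computed and compared with the ciphertext, subject to the query not
being the stored challenge; then the answer is copied and everything is uncomputed. The same program
serves both phases, as puncturing is switched on by the live wire. The bound on `K` leaves room for
`4 n` comparisons and for the circuit. -/
theorem exists_dec_program {n m K : ℕ} {C : List (ℕ × ℕ)} {h : Bits n → Bits (3 * n)}
    (hC : ComputedBy C h) (hK : 4 * n + C.length ≤ K) (slot : Bool) (e : Pos n ⊕ Fin 2 ↪ Fin m) :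
    ∃ P : List (ClassicalOp n (Wire m K)), P.length ≤ 200 * (n + C.length + 1) ∧
      ∀ (g : Bits n → Bits (3 * n)) (s : Wire m K → Bool), Clean s →
        evalProg g P s = xorAt (fun j => Sum.inl (e (Sum.inr j)))
          (encodeAnswer (if s liveWire = true ∧
              (fun p => s (Sum.inl (e (Sum.inl p)))) = (fun p => s (chalWire p)) then none
            else pairDec (slotPair slot g h) (fun p => s (Sum.inl (e (Sum.inl p)))))) s := by
  have hne : ∀ {k k' : Fin 16}, k ≠ k' → ∀ i j, (anc k i : Wire m K) ≠ anc k' j := anc_ne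
  -- the registers for the values of the two functions, and the calls
  let kR : Bool → Fin 16 := fun b => if b then 2 else 1
  let kreg : Bool → Fin 16 := fun b => if b then 4 else 3
  let kacc : Bool → Fin 16 := fun b => if b then 7 else 6
  let er : Bool → Pos n ↪ Wire m K := fun b =>
    ⟨Sum.elim (fun i => Sum.inl (e (Sum.inl (Sum.inl i)))) (fun j => anc (kR b) j), by
      rintro (i | i) (j | j) hij
      · simpa using hij
      · simp at hij
      · simp at hij
      · have := anc_injOn (kR b) i.val (by omega) j.val (by omega) hij
        rw [Fin.ext this]⟩
  have her : ∀ b p i, er b p ≠ anc 0 i := by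
    rintro b (i | i) j
    · exact inl_ne_anc _ _ _
    · refine hne ?_ _ _
      cases b <;> decide
  choose Q hQl hQu hQw hQ using fun b => exists_slot_query hC hK slot b (er b) (her b)
  -- the program
  let cw : Pos n → Wire m K := fun p => Sum.inl (e (Sum.inl p))
  let pC : List (Wire m K × Wire m K) := Finset.univ.toList.map fun p : Pos n => (cw p, chalWire p)
  let pF : Bool → List (Wire m K × Wire m K) := fun b =>
    (List.finRange (3 * n)).map fun j => (cw (Sum.inr j), anc (kR b) j)
  have hpC : pC.length = 4 * n := by
    simp only [pC, List.length_map, Finset.length_toList, Finset.card_univ, Fintype.card_sum,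
      Fintype.card_fin]
    omega
  have hpF : ∀ b, (pF b).length = 3 * n := fun b => by simp [pF]
  -- The conjunction of the challenge comparison starts from the live bit, so before the challenge
  -- nothing is punctured.
  let P0 : List (ClassicalOp n (Wire m K)) := [.cnot liveWire (anc 8 0)]
  let P1 : List (ClassicalOp n (Wire m K)) := eqProg (anc 5) (anc 8) pC 0
  -- The accumulators of the two value comparisons start from the negated result of the challenge
  -- test.
  let P2 : List (ClassicalOp n (Wire m K)) :=
    [.x (anc 6 0), .cnot (anc 8 (4 * n)) (anc 6 0), .x (anc 7 0), .cnot (anc 8 (4 * n)) (anc 7 0)]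
  let P4 : Bool → List (ClassicalOp n (Wire m K)) := fun b => eqProg (anc (kreg b)) (anc (kacc b)) (pF b) 0
  let P : List (ClassicalOp n (Wire m K)) := P0 ++ P1 ++ P2 ++ Q false ++ Q true ++ P4 false ++ P4 true
  let aw : Fin 2 → Wire m K := fun j => Sum.inl (e (Sum.inr j))
  let W : List (ClassicalOp n (Wire m K)) :=
    [.cnot (anc 7 (3 * n)) (aw 1), .toffoli (anc 6 (3 * n)) (anc 7 (3 * n)) (aw 1),
      .cnot (anc 6 (3 * n)) (aw 0), .cnot (anc 7 (3 * n)) (aw 0),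
      .toffoli (anc 6 (3 * n)) (anc 7 (3 * n)) (aw 0)]
  have haw : Function.Injective aw := fun i j hij => by simpa [aw] using hij
  -- Everything except the answer wires: the computation stays inside `S`, so it can be undone after
  -- copying.
  let S : Wire m K → Prop := fun w => ∀ j, w ≠ aw j
  have hSanc : ∀ k i, S (anc k i) := fun k i j => anc_ne_inl _ _ _
  have hScw : ∀ p, S (cw p) := fun p j hj => by
    have := e.injective (Sum.inl_injective hj)
    simp at this
  have hSchal : ∀ p : Pos n, S (chalWire p) := by
    rintro (i | i) <;> exact hSanc _ _
  have hPu : UsesIn P S := by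
    have h1 : UsesIn P0 S := by
      intro c hc w hw
      rw [List.mem_singleton] at hc
      subst hc
      rcases hw with rfl | rfl <;> exact hSanc _ _
    have h2 : UsesIn P1 S := by
      refine (usesIn_eqProg _ _ _ _).mono ?_
      rintro w (⟨p, hp, hw⟩ | ⟨i, rfl⟩ | ⟨i, rfl⟩)
      · obtain ⟨q, _, rfl⟩ := List.mem_map.1 hp
        rcases hw with rfl | rfl
        · exact hScw q
        · exact hSchal q
      · exact hSanc _ _
      · exact hSanc _ _
    have h3 : UsesIn P2 S := by
      intro c hc w hw
      simp only [P2, List.mem_cons, List.not_mem_nil, or_false] at hc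
      rcases hc with rfl | rfl | rfl | rfl <;> simp only [ClassicalOp.uses] at hw
      · rw [hw]; exact hSanc _ _
      · rcases hw with rfl | rfl <;> exact hSanc _ _
      · rw [hw]; exact hSanc _ _
      · rcases hw with rfl | rfl <;> exact hSanc _ _
    have h4 : ∀ b, UsesIn (Q b) S := by
      intro b
      refine (hQu b).mono ?_
      rintro w (⟨p | p, rfl⟩ | ⟨i, rfl⟩)
      · exact hScw (Sum.inl p)
      · exact hSanc _ _
      · exact hSanc _ _
    have h5 : ∀ b, UsesIn (P4 b) S := by
      intro b
      refine (usesIn_eqProg _ _ _ _).mono ?_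
      rintro w (⟨p, hp, hw⟩ | ⟨i, rfl⟩ | ⟨i, rfl⟩)
      · obtain ⟨q, _, rfl⟩ := List.mem_map.1 hp
        rcases hw with rfl | rfl
        · exact hScw _
        · exact hSanc _ _
      · exact hSanc _ _
      · exact hSanc _ _
    exact (((((h1.append h2).append h3).append (h4 _)).append (h4 _)).append (h5 _)).append (h5 _)
  refine ⟨P ++ W ++ P.reverse, ?_, fun g s hs => hPu.eval_conj g _ _ s (fun j hj => hj j rfl) ?_⟩
  · have h1 := hQl false
    have h2 := hQl true
    simp only [P, W, P0, P1, P2, P4, List.length_append, length_eqProg, List.length_reverse, hpC, hpF,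
      List.length_cons, List.length_nil]
    omega
  -- evaluation of the two test bits
  set c : Pos n → Bool := fun p => s (cw p) with hc
  set dead : Prop := s liveWire = true ∧ c = fun p => s (chalWire p) with hdead
  have hclean : ∀ k : Fin 16, k.val < 9 → ∀ i, s (anc k i) = false := hs
  let s1 := evalProg g P0 s
  let s2 := evalProg g P1 s1
  let s3 := evalProg g P2 s2
  let s4 := evalProg g (Q false) s3
  let s5 := evalProg g (Q true) s4
  let s6 := evalProg g (P4 false) s5
  let s7 := evalProg g (P4 true) s6
  have hs7 : evalProg g P s = s7 := by
    simp only [P, evalProg_append]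
    rfl
  have f1 : ∀ w, w ≠ anc 8 0 → s1 w = s w := fun w hw => Function.update_of_ne hw _ _
  have f1' : s1 (anc 8 0) = s liveWire := by
    change evalProg g P0 s (anc 8 0) = _
    have : (liveWire : Wire m K) ≠ anc 8 0 := hne (by decide) _ _
    simp [P0, ClassicalOp.eval, this, hclean 8 (by decide)]
  have f2 : ∀ w, (∀ i, w ≠ anc 5 i) → (∀ i, w ≠ anc 8 i) → s2 w = s1 w := fun w h5 h8 =>
    (writesIn_eqProg _ _ _ _).eval_eq g (by
      rintro (⟨i, hi⟩ | ⟨i, hi⟩)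
      · exact h5 i hi
      · exact h8 i hi) s1
  have f2' : s2 (anc 8 (4 * n)) = true ↔ dead := by
    have := evalProg_eqProg g (B := K) (anc_injOn 5) (anc_injOn 8) (hne (by decide)) pC 0
      (by omega) (by
        intro p hp
        obtain ⟨q, _, rfl⟩ := List.mem_map.1 hp
        refine ⟨fun i => ⟨inl_ne_anc _ _ _, inl_ne_anc _ _ _⟩, fun i => ?_⟩
        rcases q with q | q <;> exact ⟨hne (by decide) _ _, hne (by decide) _ _⟩) s1
      (fun i _ _ => by rw [f1 _ (hne (by decide) _ _), hclean 5 (by decide)])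
      (fun i hi hiB => by
        rw [f1 _ (fun hh => by have := anc_injOn 8 _ hiB _ (by omega) hh; omega), hclean 8 (by decide)])
    rw [zero_add, hpC] at this
    change evalProg g P1 s1 _ = true ↔ _
    rw [this, f1', Bool.and_eq_true, hdead]
    refine and_congr_right fun _ => ?_
    simp only [pC, List.all_map, List.all_eq_true, Finset.mem_toList, Finset.mem_univ, true_implies,
      Function.comp, beq_iff_eq, funext_iff]
    refine forall_congr' fun p => ?_
    rw [f1 _ (inl_ne_anc _ _ _), f1 (chalWire p)]
    rcases p with p | p <;> exact hne (by decide) _ _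
  have f3 : ∀ w, w ≠ anc 6 0 → w ≠ anc 7 0 → s3 w = s2 w := by
    intro w h6 h7
    refine WritesIn.eval_eq (S := fun w' => w' = anc 6 0 ∨ w' = anc 7 0) ?_ g (by simp [h6, h7]) s2
    intro c hc w hw
    simp only [P2, List.mem_cons, List.not_mem_nil, or_false] at hc
    rcases hc with rfl | rfl | rfl | rfl <;> simp only [ClassicalOp.writes] at hw
    · exact Or.inl hw
    · exact Or.inl hw
    · exact Or.inr hw
    · exact Or.inr hw
  have z2 : ∀ k : Fin 16, k.val < 8 → k ≠ 5 → ∀ i, s2 (anc k i) = false := by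
    intro k hk hk5 i
    have hk8 : k ≠ 8 := by rintro rfl; exact absurd hk (by decide)
    rw [f2 _ (hne hk5 _) (hne hk8 _), f1 _ (hne hk8 _ _), hclean k (by omega)]
  have f3' : ∀ b, s3 (anc (kacc b) 0) = true ↔ ¬ dead := by
    intro b
    have h86 : (anc 8 (4 * n) : Wire m K) ≠ anc 6 0 := hne (by decide) _ _
    have h87 : (anc 8 (4 * n) : Wire m K) ≠ anc 7 0 := hne (by decide) _ _
    have h67 : (anc 6 0 : Wire m K) ≠ anc 7 0 := hne (by decide) _ _
    rw [← f2']
    change evalProg g P2 s2 _ = true ↔ _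
    have z6 := z2 6 (by decide) (by decide) 0
    have z7 := z2 7 (by decide) (by decide) 0
    cases b
    · simp [P2, kacc, ClassicalOp.eval, h86, h87, h67, z6, z7]
    · simp [P2, kacc, ClassicalOp.eval, h86, h87, h67.symm, z6, z7]
  have f4 : s4 = xorAt (fun j => er false (Sum.inr j))
      (slotPair slot g h false fun i => s3 (er false (Sum.inl i))) s3 := hQ false g s3 fun i => by
    rw [f3 _ (hne (by decide) _ _) (hne (by decide) _ _), z2 0 (by decide) (by decide)]
  have f4n : ∀ w, (∀ j, anc 1 j ≠ w) → s4 w = s3 w := fun w hw => by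
    rw [f4]
    exact xorAt_of_ne _ _ fun j => hw j
  have f5 : s5 = xorAt (fun j => er true (Sum.inr j))
      (slotPair slot g h true fun i => s4 (er true (Sum.inl i))) s4 := hQ true g s4 fun i => by
    rw [f4n _ fun j => hne (by decide) _ _, f3 _ (hne (by decide) _ _) (hne (by decide) _ _),
      z2 0 (by decide) (by decide)]
  have f5n : ∀ w, (∀ j, anc 2 j ≠ w) → s5 w = s4 w := fun w hw => by
    rw [f5]
    exact xorAt_of_ne _ _ fun j => hw j
  have m3 : ∀ q, s3 (Sum.inl q) = s (Sum.inl q) := fun q => by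
    rw [f3 _ (inl_ne_anc _ _ _) (inl_ne_anc _ _ _), f2 _ (inl_ne_anc _ · _) (inl_ne_anc _ · _),
      f1 _ (inl_ne_anc _ _ _)]
  have m4 : ∀ q, s4 (Sum.inl q) = s (Sum.inl q) := fun q => by
    rw [f4n _ (anc_ne_inl _ · _), m3]
  have m5 : ∀ q, s5 (Sum.inl q) = s (Sum.inl q) := fun q => by
    rw [f5n _ (anc_ne_inl _ · _), m4]
  have r5 : ∀ b (j : Fin (3 * n)),
      s5 (anc (kR b) j) = slotPair slot g h b (c ∘ Sum.inl) j := by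
    intro b j
    cases b
    · rw [f5n _ fun i => hne (by decide) _ _, f4]
      refine (xorAt_apply (fun i j hij => by simpa using (er false).injective hij) _ s3 j).trans ?_
      have h1 : s3 (er false (Sum.inr j)) = false := by
        change s3 (anc 1 j) = false
        rw [f3 _ (hne (by decide) _ _) (hne (by decide) _ _), z2 1 (by decide) (by decide)]
      rw [h1, Bool.false_xor]
      congr 2
      funext i
      exact m3 _
    · rw [f5]
      refine (xorAt_apply (fun i j hij => by simpa using (er true).injective hij) _ s4 j).trans ?_
      have h1 : s4 (er true (Sum.inr j)) = false := by
        change s4 (anc 2 j) = false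
        rw [f4n _ fun i => hne (by decide) _ _, f3 _ (hne (by decide) _ _) (hne (by decide) _ _),
          z2 2 (by decide) (by decide)]
      rw [h1, Bool.false_xor]
      congr 2
      funext i
      exact m4 _
  have z5 : ∀ k : Fin 16, k.val < 8 → k ≠ 5 → k ≠ 1 → k ≠ 2 → ∀ i,
      (anc k i : Wire m K) ≠ anc 6 0 → (anc k i : Wire m K) ≠ anc 7 0 → s5 (anc k i) = false := by
    intro k hk h5 h1 h2 i h6 h7
    rw [f5n _ fun j => hne h2.symm _ _, f4n _ fun j => hne h1.symm _ _, f3 _ h6 h7, z2 k hk h5]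
  have a5 : ∀ b, s5 (anc (kacc b) 0) = true ↔ ¬ dead := by
    intro b
    rw [f5n _ fun j => hne (by cases b <;> decide) _ _,
      f4n _ fun j => hne (by cases b <;> decide) _ _, f3']
  -- The state is left general because the second comparison starts only after the first one has
  -- changed its own registers.
  have e4 : ∀ b s', (∀ q, s' (Sum.inl q) = s (Sum.inl q)) → (∀ j, s' (anc (kR b) j) = s5 (anc (kR b) j)) →
      (∀ i, s' (anc (kreg b) i) = s5 (anc (kreg b) i)) →
      (∀ i, s' (anc (kacc b) i) = s5 (anc (kacc b) i)) →
      (evalProg g (P4 b) s' (anc (kacc b) (3 * n)) = true ↔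
        ¬ dead ∧ slotPair slot g h b (c ∘ Sum.inl) = c ∘ Sum.inr) := by
    intro b s' hm hr hreg hacc
    have h1 : kacc b ≠ kreg b := by cases b <;> decide
    have h2 : kR b ≠ kreg b := by cases b <;> decide
    have h3 : kR b ≠ kacc b := by cases b <;> decide
    have h6 : kreg b ≠ 6 := by cases b <;> decide
    have h7 : kreg b ≠ 7 := by cases b <;> decide
    have h8 : ∀ i, 0 < i → i ≤ K → (anc (kacc b) i : Wire m K) ≠ anc 6 0 := by
      intro i hi hiK hh
      cases b
      · have := anc_injOn 6 i hiK 0 (by omega) hh; omega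
      · exact hne (by decide) _ _ hh
    have h9 : ∀ i, 0 < i → i ≤ K → (anc (kacc b) i : Wire m K) ≠ anc 7 0 := by
      intro i hi hiK hh
      cases b
      · exact hne (by decide) _ _ hh
      · have := anc_injOn 7 i hiK 0 (by omega) hh; omega
    have := evalProg_eqProg g (B := K) (anc_injOn (kreg b)) (anc_injOn (kacc b)) (hne h1) (pF b) 0
      (by have := hpF b; omega) (by
        intro p hp
        obtain ⟨q, _, rfl⟩ := List.mem_map.1 hp
        exact ⟨fun i => ⟨inl_ne_anc _ _ _, inl_ne_anc _ _ _⟩, fun i => ⟨hne h2 _ _, hne h3 _ _⟩⟩) s'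
      (fun i _ _ => by
        rw [hreg]
        exact z5 _ (by cases b <;> decide) (by cases b <;> decide) (by cases b <;> decide)
          (by cases b <;> decide) i (hne h6 _ _) (hne h7 _ _))
      (fun i hi hiB => by
        rw [hacc]
        exact z5 _ (by cases b <;> decide) (by cases b <;> decide) (by cases b <;> decide)
          (by cases b <;> decide) i (h8 i hi hiB) (h9 i hi hiB))
    rw [zero_add, hpF] at this
    rw [this, Bool.and_eq_true, hacc, a5]
    refine and_congr_right fun _ => ?_
    simp only [pF, List.all_map, List.all_eq_true, List.mem_finRange, true_implies,
      Function.comp, beq_iff_eq, funext_iff]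
    refine forall_congr' fun j => ?_
    rw [hr, r5, hm]
    exact eq_comm
  have f6 : ∀ w, (∀ i, w ≠ anc 3 i) → (∀ i, w ≠ anc 6 i) → s6 w = s5 w := fun w h3 h6 =>
    (writesIn_eqProg _ _ _ _).eval_eq g (by
      rintro (⟨i, hi⟩ | ⟨i, hi⟩)
      · exact h3 i hi
      · exact h6 i hi) s5
  have f7 : ∀ w, (∀ i, w ≠ anc 4 i) → (∀ i, w ≠ anc 7 i) → s7 w = s6 w := fun w h4 h7 =>
    (writesIn_eqProg _ _ _ _).eval_eq g (by
      rintro (⟨i, hi⟩ | ⟨i, hi⟩)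
      · exact h4 i hi
      · exact h7 i hi) s6
  have E0 : s7 (anc 6 (3 * n)) = true ↔ ¬ dead ∧ slotPair slot g h false (c ∘ Sum.inl) = c ∘ Sum.inr := by
    rw [f7 _ (hne (by decide) _) (hne (by decide) _)]
    exact e4 false s5 m5 (fun _ => rfl) (fun _ => rfl) (fun _ => rfl)
  have E1 : s7 (anc 7 (3 * n)) = true ↔ ¬ dead ∧ slotPair slot g h true (c ∘ Sum.inl) = c ∘ Sum.inr :=
    e4 true s6 (fun q => by rw [f6 _ (inl_ne_anc _ · _) (inl_ne_anc _ · _), m5])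
      (fun j => f6 _ (hne (by decide) _) (hne (by decide) _))
      (fun j => f6 _ (hne (by decide) _) (hne (by decide) _))
      (fun j => f6 _ (hne (by decide) _) (hne (by decide) _))
  have henc := encodeAnswer_dec dead _ _ E0 E1
  rw [hs7]
  unfold pairDec
  rw [henc]
  have h67 : (anc 6 (3 * n) : Wire m K) ≠ anc 7 (3 * n) := hne (by decide) _ _
  have h6a : ∀ j, (anc 6 (3 * n) : Wire m K) ≠ aw j := fun j => anc_ne_inl _ _ _
  have h7a : ∀ j, (anc 7 (3 * n) : Wire m K) ≠ aw j := fun j => anc_ne_inl _ _ _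
  have h01 : aw 0 ≠ aw 1 := fun hh => by simpa using haw hh
  have hw : ∀ j, ¬ (anc 6 (3 * n) = aw j ∨ anc 7 (3 * n) = aw j ∨ (anc 6 (3 * n) : Wire m K) = anc 7 (3 * n)) := by
    rintro j (h | h | h)
    · exact h6a j h
    · exact h7a j h
    · exact h67 h
  simp only [W, evalProg_cons, evalProg_nil, ClassicalOp.eval, if_neg (h6a _), if_neg (h7a _),
    if_neg (hw _), Function.update_of_ne (h6a _), Function.update_of_ne (h7a _), Function.update_self,
    Function.update_of_ne h01]
  funext w
  change _ = xorAt aw _ s7 w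
  by_cases h0 : w = aw 0
  · subst h0
    rw [xorAt_apply haw]
    simp [h01, Bool.xor_assoc]
  · by_cases h1 : w = aw 1
    · subst h1
      rw [xorAt_apply haw]
      simp [h01.symm, Bool.xor_assoc]
    · rw [xorAt_of_ne]
      · simp [Function.update_of_ne h0, Function.update_of_ne h1]
      · intro j
        fin_cases j
        · exact fun hh => h0 hh.symm
        · exact fun hh => h1 hh.symm

/-! ### Channels that permute the computational basis -/

/-- Conjugation by a permutation matrix relabels rows and columns by the inverse permutation, which
here is the permutation itself. -/
theorem applyUnitary_involution_apply {ι : Type} [Fintype ι] [DecidableEq ι] {m : ℕ} (e : ι ↪ Fin m)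
    {A : Op ι} {π : (ι → Bool) → (ι → Bool)} (hπ : Function.Involutive π)
    (hA : ∀ s t, A s t = if s = π t then 1 else 0) (ρ : Op (Fin m)) (s t : Fin m → Bool) :
    applyUnitary e A ρ s t =
      ρ (overwrite e (π (s ∘ e)) s) (overwrite e (π (t ∘ e)) t) := by
  have h : ∀ s t, s = π t ↔ t = π s := fun s t =>
    ⟨fun h => by rw [h, hπ t], fun h => by rw [h, hπ s]⟩
  simp only [applyUnitary, channel_apply, Fintype.sum_unique, hA, h, ite_mul, one_mul, zero_mul,
    Finset.sum_ite_eq', Finset.mem_univ, if_true, apply_ite (star : ℂ → ℂ), star_zero, star_one,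
    mul_ite, mul_one, mul_zero]

theorem xorOp_apply {ι κ : Type} [Fintype ι] [Fintype κ] (g : (ι → Bool) → (κ → Bool))
    (s t : ι ⊕ κ → Bool) : xorOp g s t = if s = xorMap g t then 1 else 0 := by
  simp only [xorOp, xorMap, Matrix.of_apply]
  congr

/-- The classical map of an oracle call on the wires `e`. -/
noncomputable def xorWires {ι κ : Type} {m : ℕ} (e : ι ⊕ κ ↪ Fin m)
    (g : (ι → Bool) → (κ → Bool)) (s : Fin m → Bool) : Fin m → Bool :=
  overwrite e (xorMap g (s ∘ e)) s

theorem xorWires_involutive {ι κ : Type} {m : ℕ} (e : ι ⊕ κ ↪ Fin m)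
    (g : (ι → Bool) → (κ → Bool)) : Function.Involutive (xorWires e g) := by
  intro s
  simp [xorWires, xorMap_involutive g (s ∘ e)]

theorem xorWires_inr {ι κ : Type} {m : ℕ} (e : ι ⊕ κ ↪ Fin m)
    (g : (ι → Bool) → (κ → Bool)) (s : Fin m → Bool) (j : κ) :
    xorWires e g s (e (Sum.inr j)) = xor (s (e (Sum.inr j))) (g (fun i => s (e (Sum.inl i))) j) := by
  rw [xorWires, overwrite_apply]
  rfl

theorem xorWires_of_ne {ι κ : Type} {m : ℕ} (e : ι ⊕ κ ↪ Fin m)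
    (g : (ι → Bool) → (κ → Bool)) (s : Fin m → Bool) {q : Fin m} (hq : ∀ j, e (Sum.inr j) ≠ q) :
    xorWires e g s q = s q := by
  by_cases h : ∃ i, e (Sum.inl i) = q
  · obtain ⟨i, rfl⟩ := h
    rw [xorWires, overwrite_apply]
    rfl
  · push Not at h
    exact overwrite_of_notMem e _ _ fun p => by
      cases p with
      | inl i => exact h i
      | inr j => exact hq j

theorem applyUnitary_xorOp_apply {ι κ : Type} [Fintype ι] [Fintype κ] [DecidableEq ι] [DecidableEq κ]
    {m : ℕ} (e : ι ⊕ κ ↪ Fin m) (g : (ι → Bool) → (κ → Bool)) (ρ : Op (Fin m)) :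
    applyUnitary e (xorOp g) ρ = ρ.submatrix (xorWires e g) (xorWires e g) := by
  ext s t
  exact applyUnitary_involution_apply e (xorMap_involutive g) (xorOp_apply g) ρ s t

/-! ### From classical programs to quantum circuits -/

/-- The oracle of a pseudorandom-function adversary. -/
noncomputable def prfOracle {n M : ℕ} (g : Bits n → Bits (3 * n)) :
    (Pos n ↪ Fin M) → Op (Fin M) → Op (Fin M) :=
  fun e ρ => applyUnitary e (xorOp g) ρ

theorem isQuantumOp_prfOracle {n M : ℕ} (g : Bits n → Bits (3 * n)) (e : Pos n ↪ Fin M) :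
    IsQuantumOp (prfOracle g e) := IsQuantumOp.applyUnitary e _ (xorOp_unitary g)

section Compile

variable {n M : ℕ} {ω : Type} [DecidableEq ω] (w : ω ≃ Fin M)

theorem injective_vec_two {c t : ω} (h : c ≠ t) : Function.Injective ![w c, w t] := by
  intro i j hij
  fin_cases i <;> fin_cases j <;> simp_all

theorem injective_vec_three {a b t : ω} (h : ¬ (a = t ∨ b = t ∨ a = b)) :
    Function.Injective ![w a, w b, w t] := by
  push Not at h
  obtain ⟨h1, h2, h3⟩ := h
  intro i j hij
  fin_cases i <;> fin_cases j <;> simp_all [eq_comm]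

/-- The circuit for a classical operation. -/
def compileOp : ClassicalOp n ω → List (Instr M (Pos n ↪ Fin M))
  | .x t => [.gate .x ⟨fun _ => w t, fun _ _ _ => Subsingleton.elim _ _⟩]
  | .cnot c t => if h : c = t then [] else [.gate .cnot ⟨![w c, w t], injective_vec_two w h⟩]
  | .toffoli a b t => if h : a = t ∨ b = t ∨ a = b then [] else
      [.gate .toffoli ⟨![w a, w b, w t], injective_vec_three w h⟩]
  | .query e => [.query (e.trans w.toEmbedding)]

/-- Each operation becomes a gate or call that permutes the basis. Colliding operations become the
empty circuit, because gates require distinct wires. -/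
theorem run_compileOp_apply (g : Bits n → Bits (3 * n)) (c : ClassicalOp n ω) (ρ : Op (Fin M))
    (s t : ω → Bool) :
    run (prfOracle g) (compileOp w c) ρ (s ∘ w.symm) (t ∘ w.symm) =
      ρ (c.eval g s ∘ w.symm) (c.eval g t ∘ w.symm) := by
  cases c with
  | x u =>
    have h : ∀ s : ω → Bool, overwrite (m := M) (ι := Fin 1)
        ⟨fun _ => w u, fun _ _ _ => Subsingleton.elim _ _⟩
        (fun i => !((s ∘ w.symm) (w u))) (s ∘ w.symm) = (ClassicalOp.x u).eval g s ∘ w.symm := by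
      intro s
      symm
      rw [eq_overwrite_iff]
      constructor
      · funext i
        change (ClassicalOp.x u).eval g s (w.symm (w u)) = _
        simp [ClassicalOp.eval]
      · intro q hq
        have : w.symm q ≠ u := fun h => hq 0 (by simp [← h])
        simp [ClassicalOp.eval, this]
    rw [← h, ← h]
    refine applyUnitary_involution_apply _ (π := fun t i => !(t i)) (fun t => by simp) ?_ ρ _ _
    intro s t
    have : s = (fun i => !(t i)) ↔ s 0 = !(t 0) :=
      ⟨fun h => congrFun h 0, fun h => by funext i; rw [Subsingleton.elim i 0]; exact h⟩
    simp only [Gate.op, Matrix.of_apply, this]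
  | cnot c u =>
    by_cases hcu : c = u
    · simp [compileOp, ClassicalOp.eval, hcu]
    · have h : ∀ s : ω → Bool, overwrite (m := M) (ι := Fin 2) ⟨![w c, w u], injective_vec_two w hcu⟩
          ![s c, xor (s u) (s c)] (s ∘ w.symm) = (ClassicalOp.cnot c u).eval g s ∘ w.symm := by
        intro s
        symm
        rw [eq_overwrite_iff]
        constructor
        · funext i
          fin_cases i <;> simp [ClassicalOp.eval, hcu]
        · intro q hq
          have : w.symm q ≠ u := fun h => hq 1 (by simp [← h])
          simp [ClassicalOp.eval, this, hcu]
      rw [← h, ← h]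
      simp only [compileOp, dif_neg hcu]
      have h2 := applyUnitary_involution_apply ⟨![w c, w u], injective_vec_two w hcu⟩
        (A := Gate.cnot.op) (π := fun t => ![t 0, xor (t 1) (t 0)])
        (fun t => by funext i; fin_cases i <;> simp) (fun s t => rfl) ρ (s ∘ w.symm) (t ∘ w.symm)
      simp only [run_cons, run_nil, Instr.apply, h2]
      simp
  | toffoli a b u =>
    by_cases hab : a = u ∨ b = u ∨ a = b
    · simp [compileOp, ClassicalOp.eval, hab]
    · have h : ∀ s : ω → Bool, overwrite (m := M) (ι := Fin 3)
          ⟨![w a, w b, w u], injective_vec_three w hab⟩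
          ![s a, s b, xor (s u) (s a && s b)] (s ∘ w.symm) =
            (ClassicalOp.toffoli a b u).eval g s ∘ w.symm := by
        intro s
        symm
        rw [eq_overwrite_iff]
        constructor
        · have h1 : a ≠ u := fun h => hab (Or.inl h)
          have h2 : b ≠ u := fun h => hab (Or.inr (Or.inl h))
          rw [ClassicalOp.eval, if_neg hab]
          funext i
          fin_cases i <;> simp [h1, h2]
        · intro q hq
          have : w.symm q ≠ u := fun h => hq 2 (by simp [← h])
          rw [ClassicalOp.eval, if_neg hab]
          simp [this]
      rw [← h, ← h]
      simp only [compileOp, dif_neg hab]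
      have h2 := applyUnitary_involution_apply ⟨![w a, w b, w u], injective_vec_three w hab⟩
        (A := Gate.toffoli.op) (π := fun t => ![t 0, t 1, xor (t 2) (t 0 && t 1)])
        (fun t => by funext i; fin_cases i <;> simp) (fun s t => rfl) ρ (s ∘ w.symm) (t ∘ w.symm)
      simp only [run_cons, run_nil, Instr.apply, h2]
      simp
  | query e =>
    have h : ∀ s : ω → Bool, xorWires (e.trans w.toEmbedding) g (s ∘ w.symm) =
        (ClassicalOp.query e).eval g s ∘ w.symm := by
      intro s
      funext q
      by_cases hq : ∃ j, e.trans w.toEmbedding (Sum.inr j) = q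
      · obtain ⟨j, rfl⟩ := hq
        rw [xorWires_inr]
        simp only [ClassicalOp.eval, Function.comp_apply, Function.Embedding.trans_apply,
          Equiv.coe_toEmbedding, Equiv.symm_apply_apply]
        have hz : Function.Injective fun j => e (Sum.inr j) := fun i j hij => by
          simpa using e.injective hij
        exact (xorAt_apply hz _ _ j).symm
      · push Not at hq
        rw [xorWires_of_ne _ _ _ hq]
        symm
        change xorAt (fun j => e (Sum.inr j)) _ s (w.symm q) = s (w.symm q)
        refine xorAt_of_ne _ _ fun j hj => hq j ?_
        simp [hj]
    rw [← h, ← h]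
    simp only [compileOp, run_cons, run_nil, Instr.apply, prfOracle, applyUnitary_xorOp_apply,
      Matrix.submatrix_apply]

/-- The circuit for a classical program. -/
def compile (P : List (ClassicalOp n ω)) : List (Instr M (Pos n ↪ Fin M)) := P.flatMap (compileOp w)

theorem length_compile (P : List (ClassicalOp n ω)) : (compile w P).length ≤ P.length := by
  induction P with
  | nil => exact le_rfl
  | cons c P ih =>
    have : (compileOp w c).length ≤ 1 := by
      cases c <;> simp only [compileOp] <;> try split_ifs
      all_goals simp
    simp only [compile, List.flatMap_cons, List.length_append, List.length_cons] at ih ⊢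
    omega

/-- Entries are pulled back along the inverse permutation, hence the reversed program. -/
theorem run_compile_apply (g : Bits n → Bits (3 * n)) (P : List (ClassicalOp n ω)) (ρ : Op (Fin M))
    (s t : ω → Bool) :
    run (prfOracle g) (compile w P) ρ (s ∘ w.symm) (t ∘ w.symm) =
      ρ (evalProg g P.reverse s ∘ w.symm) (evalProg g P.reverse t ∘ w.symm) := by
  induction P generalizing ρ with
  | nil => rfl
  | cons c P ih =>
    have h : compile w (c :: P) = compileOp w c ++ compile w P := List.flatMap_cons
    rw [h, run_append, ih, run_compileOp_apply, List.reverse_cons, evalProg_append, evalProg_append]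
    rfl

end Compile

/-! ### Adding ancillas -/

section Embed

variable {n m K M : ℕ} (w : Wire m K ≃ Fin M)

/-- The state `ρ` together with ancillas in the basis state `a`. -/
def embedState (a : Ancilla K → Bool) (ρ : Op (Fin m)) : Op (Fin M) :=
  Matrix.of fun s t => if (fun i => s (w (Sum.inr i))) = a ∧ (fun i => t (w (Sum.inr i))) = a then
    ρ (fun q => s (w (Sum.inl q))) (fun q => t (w (Sum.inl q))) else 0

theorem embedState_apply (a : Ancilla K → Bool) (ρ : Op (Fin m)) (s t : Wire m K → Bool) :
    embedState w a ρ (s ∘ w.symm) (t ∘ w.symm) =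
      if s ∘ Sum.inr = a ∧ t ∘ Sum.inr = a then ρ (s ∘ Sum.inl) (t ∘ Sum.inl) else 0 := by
  have h : ∀ s : Wire m K → Bool, (fun i => (s ∘ w.symm) (w (Sum.inr i))) = s ∘ Sum.inr := fun s => by
    funext i; simp
  have h' : ∀ s : Wire m K → Bool, (fun i => (s ∘ w.symm) (w (Sum.inl i))) = s ∘ Sum.inl := fun s => by
    funext i; simp
  simp only [embedState, Matrix.of_apply, h, h']

theorem op_ext {ρ σ : Op (Fin M)} (h : ∀ s t : Wire m K → Bool,
    ρ (s ∘ w.symm) (t ∘ w.symm) = σ (s ∘ w.symm) (t ∘ w.symm)) : ρ = σ := by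
  ext s t
  have := h (s ∘ w) (t ∘ w)
  simpa [Function.comp_assoc] using this

/-- A wire of the simulated adversary. -/
def mainWires {ι : Type} (e : ι ↪ Fin m) : ι ↪ Fin M :=
  e.trans (Function.Embedding.inl.trans w.toEmbedding)

/-- Kraus operators on the simulated wires leave the ancilla contents of rows and columns alone. -/
theorem channel_embedState {ι κ : Type} [Fintype ι] [DecidableEq ι] [Fintype κ] (e : ι ↪ Fin m)
    (Kr : κ → Op ι) (a : Ancilla K → Bool) (ρ : Op (Fin m)) :
    channel (mainWires w e) Kr (embedState w a ρ) = embedState w a (channel e Kr ρ) := by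
  have h1 : ∀ (r : ι → Bool) (s : Fin M → Bool), (fun i => overwrite (mainWires w e) r s (w (Sum.inr i))) =
      fun i => s (w (Sum.inr i)) := by
    intro r s
    funext i
    refine overwrite_of_notMem _ _ _ fun j hj => ?_
    simp [mainWires] at hj
  have h2 : ∀ (r : ι → Bool) (s : Fin M → Bool), (fun q => overwrite (mainWires w e) r s (w (Sum.inl q))) =
      overwrite e r (fun q => s (w (Sum.inl q))) := by
    intro r s
    rw [eq_overwrite_iff]
    constructor
    · funext i
      exact overwrite_apply (mainWires w e) r s i
    · intro q hq
      refine overwrite_of_notMem _ _ _ fun i hi => hq i ?_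
      simpa [mainWires] using hi
  have h3 : ∀ s : Fin M → Bool, s ∘ mainWires w e = (fun q => s (w (Sum.inl q))) ∘ e := fun s => rfl
  ext s t
  rw [channel_apply]
  simp only [embedState, Matrix.of_apply, h1, h2, h3]
  by_cases h : (fun i => s (w (Sum.inr i))) = a ∧ (fun i => t (w (Sum.inr i))) = a
  · simp only [if_pos h]
    rw [channel_apply]
  · simp only [if_neg h, mul_zero, Finset.sum_const_zero, zero_mul]

theorem embedState_sum {κ : Type} [Fintype κ] (a : Ancilla K → Bool) (ρ : κ → Op (Fin m)) :
    embedState w a (∑ k, ρ k) = ∑ k, embedState w a (ρ k) := by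
  ext s t
  simp only [embedState, Matrix.of_apply, Matrix.sum_apply]
  split_ifs <;> simp

theorem embedState_zeroState : embedState w (fun _ => false) (zeroState m) = zeroState M := by
  refine op_ext w fun s t => ?_
  rw [embedState_apply]
  have h : ∀ s : Wire m K → Bool, s ∘ w.symm = (fun _ => false) ↔
      s ∘ Sum.inr = (fun _ => false) ∧ s ∘ Sum.inl = fun _ => false := by
    intro s
    constructor
    · intro h
      have : ∀ i, s i = false := fun i => by simpa using congrFun h (w i)
      exact ⟨funext fun i => this _, funext fun i => this _⟩
    · rintro ⟨h1, h2⟩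
      funext q
      change s (w.symm q) = false
      rcases w.symm q with i | i
      · exact congrFun h2 i
      · exact congrFun h1 i
  simp only [zeroState, basisProj, Matrix.of_apply, h]
  by_cases h1 : s ∘ Sum.inr = (fun _ => false) ∧ t ∘ Sum.inr = fun _ => false
  · simp [h1.1, h1.2]
  · rw [if_neg h1, if_neg]
    rintro ⟨⟨h2, _⟩, h3, _⟩
    exact h1 ⟨h2, h3⟩

/-- A classical program that acts on the ancillas and, by an involution, on the simulated wires. -/
theorem run_compile_embedState (g : Bits n → Bits (3 * n)) (P : List (ClassicalOp n (Wire m K)))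
    {a a' : Ancilla K → Bool} {F : (Fin m → Bool) → Fin m → Bool} (hF : Function.Involutive F)
    (hP : ∀ u, evalProg g P (Sum.elim u a) = Sum.elim (F u) a') (ρ : Op (Fin m)) :
    run (prfOracle g) (compile w P) (embedState w a ρ) = embedState w a' (ρ.submatrix F F) := by
  refine op_ext w fun s t => ?_
  rw [run_compile_apply, embedState_apply, embedState_apply]
  have h1 : ∀ s : Wire m K → Bool, s ∘ Sum.inr = a' →
      evalProg g P.reverse s = Sum.elim (F (s ∘ Sum.inl)) a := by
    intro s hs
    have h2 := evalProg_reverse g P (Sum.elim (F (s ∘ Sum.inl)) a)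
    rw [hP, hF, ← hs, Sum.elim_comp_inl_inr] at h2
    exact h2
  have h3 : ∀ s : Wire m K → Bool, evalProg g P.reverse s ∘ Sum.inr = a ↔ s ∘ Sum.inr = a' := by
    intro s
    constructor
    · intro h
      have h4 := evalProg_reverse' g P s
      rw [← Sum.elim_comp_inl_inr (evalProg g P.reverse s), h, hP] at h4
      rw [← h4, Sum.elim_comp_inr]
    · intro h
      rw [h1 s h, Sum.elim_comp_inr]
  simp only [h3]
  by_cases h : s ∘ Sum.inr = a' ∧ t ∘ Sum.inr = a'
  · rw [if_pos h, if_pos h, h1 s h.1, h1 t h.2]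
    rfl
  · rw [if_neg h, if_neg h]

/-- A classical program that changes only the ancillas, on the support of `ρ`. -/
theorem run_compile_embedState_of_support (g : Bits n → Bits (3 * n))
    (P : List (ClassicalOp n (Wire m K))) {a a' : Ancilla K → Bool} {U : (Fin m → Bool) → Prop}
    (hP : ∀ u, U u → evalProg g P (Sum.elim u a) = Sum.elim u a')
    (hPm : ∀ s q, evalProg g P s (Sum.inl q) = s (Sum.inl q)) {ρ : Op (Fin m)}
    (hρ : ∀ s t, ¬ (U s ∧ U t) → ρ s t = 0) :
    run (prfOracle g) (compile w P) (embedState w a ρ) = embedState w a' ρ := by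
  -- Since the inverse also fixes the simulated wires, membership in `U` can be read off before or
  -- after the run.
  have hrm : ∀ s q, evalProg g P.reverse s (Sum.inl q) = s (Sum.inl q) := by
    intro s q
    rw [← hPm (evalProg g P.reverse s), evalProg_reverse']
  refine op_ext w fun s t => ?_
  rw [run_compile_apply, embedState_apply, embedState_apply]
  have hm : ∀ s : Wire m K → Bool, evalProg g P.reverse s ∘ Sum.inl = s ∘ Sum.inl := fun s =>
    funext fun q => hrm s q
  rw [hm, hm]
  by_cases hU : U (s ∘ Sum.inl) ∧ U (t ∘ Sum.inl)
  · have h3 : ∀ s : Wire m K → Bool, U (s ∘ Sum.inl) →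
        (evalProg g P.reverse s ∘ Sum.inr = a ↔ s ∘ Sum.inr = a') := by
      intro s hs
      constructor
      · intro h
        have h4 := evalProg_reverse' g P s
        rw [← Sum.elim_comp_inl_inr (evalProg g P.reverse s), h, hm, hP _ hs] at h4
        rw [← h4, Sum.elim_comp_inr]
      · intro h
        have h2 := evalProg_reverse g P (Sum.elim (s ∘ Sum.inl) a)
        rw [hP _ hs, ← h, Sum.elim_comp_inl_inr] at h2
        rw [h2, Sum.elim_comp_inr]
    simp only [h3 s hU.1, h3 t hU.2]
  · rw [hρ _ _ hU, ite_self, ite_self]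

end Embed

/-! ### Register-wide operations as sequences of elementary steps -/

/-- The oracle of a circuit without oracle calls. -/
def noOracle {m : ℕ} : Empty → Op (Fin m) → Op (Fin m) := fun o => o.elim

section Registers

variable {ι : Type} [Fintype ι] [DecidableEq ι] {m : ℕ}

theorem comp_oneWire_eq_iff (q : Fin m) (s t : Fin m → Bool) :
    s ∘ oneWire q = t ∘ oneWire q ↔ s q = t q :=
  ⟨fun h => congrFun h (), fun h => funext fun _ => h⟩

theorem run_measures_apply (e : ι ↪ Fin m) (l : List ι) (ρ : Op (Fin m)) (s t : Fin m → Bool) :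
    run noOracle (l.map fun i => .measure (e i)) ρ s t =
      if ∀ i ∈ l, s (e i) = t (e i) then ρ s t else 0 := by
  induction l generalizing ρ with
  | nil => simp
  | cons i l ih =>
    rw [List.map_cons, run_cons, ih]
    simp only [Instr.apply, measureWires_apply, comp_oneWire_eq_iff, List.forall_mem_cons]
    by_cases h1 : s (e i) = t (e i) <;> by_cases h2 : ∀ i ∈ l, s (e i) = t (e i) <;> simp [h1, h2]

/-- Each measurement kills the entries whose row and column differ on its wire; together they kill
those that differ anywhere on `e`. -/
theorem run_measures (e : ι ↪ Fin m) (ρ : Op (Fin m)) :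
    run noOracle ((Finset.univ : Finset ι).toList.map fun i => .measure (e i)) ρ = measureWires e ρ := by
  ext s t
  rw [run_measures_apply, measureWires_apply]
  simp [funext_iff]

/-- The partial trace over the wires `e`. -/
noncomputable def traceOut (e : ι ↪ Fin m) (ρ : Op (Fin m)) (s t : Fin m → Bool) : ℂ :=
  ∑ v, ρ (overwrite e v s) (overwrite e v t)

theorem prepare_oneWire_ket_apply (q : Fin m) (ρ : Op (Fin m)) (s t : Fin m → Bool) :
    prepare (oneWire q) (ket fun _ => false) ρ s t =
      if s q = false ∧ t q = false then
        ∑ b, ρ (Function.update s q b) (Function.update t q b) else 0 := by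
  have h1 : ∀ s : Fin m → Bool, s ∘ oneWire q = (fun _ => false) ↔ s q = false := fun s =>
    ⟨fun h => congrFun h (), fun h => funext fun _ => h⟩
  have h2 : ∀ (v : Unit → Bool) (s : Fin m → Bool), overwrite (oneWire q) v s =
      Function.update s q (v ()) := by
    intro v s
    symm
    rw [eq_overwrite_iff]
    refine ⟨funext fun _ => Function.update_self _ _ _, fun q' hq' => ?_⟩
    exact Function.update_of_ne (fun h => hq' () h.symm) _ _
  rw [prepare_apply, ← (Equiv.funUnique Unit Bool).symm.sum_comp]
  simp only [ket, h1, h2, Equiv.funUnique_symm_apply, uniqueElim_const]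
  by_cases hs : s q = false <;> by_cases ht : t q = false <;> simp [hs, ht]

theorem update_overwrite (e : ι ↪ Fin m) (v : ι → Bool) (s : Fin m → Bool) (i : ι) (b : Bool) :
    Function.update (overwrite e v s) (e i) b = overwrite e (Function.update v i b) s := by
  rw [eq_overwrite_iff]
  constructor
  · funext j
    by_cases h : j = i
    · subst h; simp
    · simp [h, Function.update_of_ne (fun hh => h (e.injective hh))]
  · intro q hq
    rw [Function.update_of_ne (fun h => hq i h.symm), overwrite_of_notMem e _ _ hq]

/-- Strings with a zero at `i`, together with a bit `b` to put there, enumerate all strings;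
flipping the bit at `i` by `b` is the bijection. -/
theorem sum_reset_bit (i : ι) (f : (ι → Bool) → ℂ) :
    ∑ v : ι → Bool, (if v i = false then ∑ b, f (Function.update v i b) else 0) = ∑ v, f v := by
  have h1 : ∀ b : Bool, ∑ v : ι → Bool, (if v i = false then f (Function.update v i b) else 0) =
      ∑ v : ι → Bool, if v i = b then f v else 0 := by
    intro b
    let τ : (ι → Bool) → (ι → Bool) := fun v => Function.update v i (xor (v i) b)
    have hτ : Function.Involutive τ := by
      intro v
      simp [τ]
    refine Fintype.sum_equiv hτ.toPerm _ _ fun v => ?_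
    change _ = if τ v i = b then f (τ v) else 0
    by_cases hv : v i = false
    · simp [τ, hv]
    · rw [if_neg hv, if_neg]
      simp [τ, hv]
  calc _ = ∑ v : ι → Bool, ∑ b, (if v i = false then f (Function.update v i b) else 0) := by
        refine Finset.sum_congr rfl fun v _ => ?_
        split_ifs <;> simp
    _ = ∑ b, ∑ v : ι → Bool, (if v i = b then f v else 0) := by
        rw [Finset.sum_comm]
        exact Finset.sum_congr rfl fun b _ => h1 b
    _ = _ := by
        rw [Finset.sum_comm]
        simp

theorem traceOut_reset (e : ι ↪ Fin m) (i : ι) (ρ : Op (Fin m)) :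
    traceOut e (prepare (oneWire (e i)) (ket fun _ => false) ρ) = traceOut e ρ := by
  funext s t
  simp only [traceOut, prepare_oneWire_ket_apply, overwrite_apply, and_self, update_overwrite]
  exact sum_reset_bit i fun v => ρ (overwrite e v s) (overwrite e v t)

theorem run_resets_traceOut (e : ι ↪ Fin m) (l : List ι) (ρ : Op (Fin m)) :
    traceOut e (run noOracle (l.map fun i => .reset (e i)) ρ) = traceOut e ρ := by
  induction l generalizing ρ with
  | nil => rfl
  | cons i l ih =>
    rw [List.map_cons, run_cons, ih]
    exact traceOut_reset e i ρ

theorem run_resets_support (e : ι ↪ Fin m) (l : List ι) (S : ι → Prop) (ρ : Op (Fin m))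
    (hρ : ∀ s t i, S i → ¬ (s (e i) = false ∧ t (e i) = false) → ρ s t = 0) :
    ∀ s t i, (S i ∨ i ∈ l) → ¬ (s (e i) = false ∧ t (e i) = false) →
      run noOracle (l.map fun i => .reset (e i)) ρ s t = 0 := by
  induction l generalizing ρ S with
  | nil => simpa using hρ
  | cons j l ih =>
    intro s t i hi hst
    rw [List.map_cons, run_cons]
    refine ih (fun i => S i ∨ i = j) _ ?_ s t i ?_ hst
    · intro s t i hi hst
      change prepare (oneWire (e j)) (ket fun _ => false) ρ s t = 0
      rw [prepare_oneWire_ket_apply]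
      by_cases hij : i = j
      · rw [if_neg (hij ▸ hst)]
      · split_ifs
        · refine Finset.sum_eq_zero fun b _ => hρ _ _ i (hi.resolve_right hij) ?_
          have : e i ≠ e j := fun h => hij (e.injective h)
          rwa [Function.update_of_ne this, Function.update_of_ne this]
        · rfl
    · rcases hi with hi | hi
      · exact Or.inl (Or.inl hi)
      · rcases List.mem_cons.1 hi with hi | hi
        · exact Or.inl (Or.inr hi)
        · exact Or.inr hi

/-- Two facts determine the result: each reset preserves the partial trace over `e`, and at the end
only entries with zeros on all of `e` survive. -/
theorem run_resets (e : ι ↪ Fin m) (ρ : Op (Fin m)) :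
    run noOracle ((Finset.univ : Finset ι).toList.map fun i => .reset (e i)) ρ =
      prepare e (ket fun _ => false) ρ := by
  set σ := run noOracle ((Finset.univ : Finset ι).toList.map fun i => .reset (e i)) ρ with hσ
  have hsupp : ∀ s t i, ¬ (s (e i) = false ∧ t (e i) = false) → σ s t = 0 := fun s t i h =>
    run_resets_support e _ (fun _ => False) ρ (fun _ _ _ h => h.elim) s t i
      (Or.inr (Finset.mem_toList.2 (Finset.mem_univ i))) h
  have htr : traceOut e σ = traceOut e ρ := run_resets_traceOut e _ ρ
  ext s t
  rw [prepare_apply]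
  change _ = _ * traceOut e ρ s t
  rw [← htr]
  by_cases h : s ∘ e = (fun _ => false) ∧ t ∘ e = fun _ => false
  · rw [h.1, h.2]
    simp only [ket, if_true, star_one, one_mul]
    rw [traceOut, Finset.sum_eq_single (fun _ => false)]
    · have hs := overwrite_self e s
      have ht := overwrite_self e t
      rw [h.1] at hs
      rw [h.2] at ht
      rw [hs, ht]
    · intro v _ hv
      obtain ⟨i, hi⟩ := Function.ne_iff.1 hv
      refine hsupp _ _ i ?_
      simp only [overwrite_apply, and_self]
      exact hi
    · simp
  · have h1 : σ s t = 0 := by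
      by_contra hne
      apply h
      have : ∀ i, s (e i) = false ∧ t (e i) = false := fun i => by
        by_contra hi
        exact hne (hsupp s t i hi)
      exact ⟨funext fun i => (this i).1, funext fun i => (this i).2⟩
    rw [h1]
    rcases not_and_or.1 h with h | h <;> simp [ket, h]

/-- A one-qubit gate that is applied to a freshly prepared register. -/
theorem applyUnitary_prepare (e : ι ↪ Fin m) (i : ι) (A : Op (Fin 1)) (φ : (ι → Bool) → ℂ)
    (ρ : Op (Fin m)) :
    applyUnitary ⟨fun _ => e i, fun _ _ _ => Subsingleton.elim _ _⟩ A (prepare e φ ρ) =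
      prepare e (fun s => ∑ b, A (fun _ => s i) (fun _ => b) * φ (Function.update s i b)) ρ := by
  have h2 : ∀ (v : Fin 1 → Bool) (s : Fin m → Bool),
      overwrite (m := m) (ι := Fin 1) ⟨fun _ => e i, fun _ _ _ => Subsingleton.elim _ _⟩ v s =
      Function.update s (e i) (v 0) := by
    intro v s
    symm
    rw [eq_overwrite_iff]
    refine ⟨funext fun j => ?_, fun q' hq' => ?_⟩
    · rw [Subsingleton.elim j 0]
      exact Function.update_self _ _ _
    · exact Function.update_of_ne (fun h => hq' 0 h.symm) _ _
  have h3 : ∀ (b : Bool) (s : Fin m → Bool), Function.update s (e i) b ∘ e =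
      Function.update (s ∘ e) i b := by
    intro b s
    have := update_overwrite e (s ∘ e) s i b
    rw [overwrite_self] at this
    rw [this, overwrite_comp]
  have h4 : ∀ (b : Bool) (v : ι → Bool) (s : Fin m → Bool),
      overwrite e v (Function.update s (e i) b) = overwrite e v s := by
    intro b v s
    have := update_overwrite e (s ∘ e) s i b
    rw [overwrite_self] at this
    rw [this, overwrite_overwrite]
  have h5 : ∀ s : Fin m → Bool, s ∘ (⟨fun _ => e i, fun _ _ _ => Subsingleton.elim _ _⟩ : Fin 1 ↪ Fin m) =
      fun _ => s (e i) := fun s => rfl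
  have h6 : ∀ b : Bool, (uniqueElim b : Fin 1 → Bool) = fun _ => b := fun b => by
    funext i
    rw [Subsingleton.elim i 0]
    rfl
  ext s t
  simp only [applyUnitary, channel_apply, Fintype.sum_unique, prepare_apply, h2, h3, h4, h5,
    Function.comp_apply]
  rw [← (Equiv.funUnique (Fin 1) Bool).symm.sum_comp]
  simp only [← (Equiv.funUnique (Fin 1) Bool).symm.sum_comp (fun r : Fin 1 → Bool => A _ r * _),
    Equiv.funUnique_symm_apply, h6]
  simp only [Fintype.sum_bool, star_add, star_mul']
  ring

theorem h_op_apply (b b' : Bool) : (Gate.h.op : Op (Fin 1)) (fun _ => b) (fun _ => b') =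
    (if b && b' then -1 else 1) / (Real.sqrt 2 : ℂ) := rfl

/-- `S` collects the positions already rotated: the register is uniform on them and zero elsewhere,
and every gate adds a position and a factor `1 / √2`. -/
theorem run_hadamards (e : ι ↪ Fin m) (l : List ι) (hl : l.Nodup) (S : ι → Prop) [DecidablePred S]
    (hS : ∀ i ∈ l, ¬ S i) (c : ℂ) (ρ : Op (Fin m)) :
    run noOracle (l.map fun i => .gate .h ⟨fun _ => e i, fun _ _ _ => Subsingleton.elim _ _⟩)
        (prepare e (fun s => if ∀ i, ¬ S i → s i = false then c else 0) ρ) =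
      prepare e (fun s => if ∀ i, ¬ (S i ∨ i ∈ l) → s i = false then
        c / (Real.sqrt 2 : ℂ) ^ l.length else 0) ρ := by
  induction l generalizing S c with
  | nil => simp
  | cons j l ih =>
    rw [List.nodup_cons] at hl
    have hj := hS j List.mem_cons_self
    have hstep : (fun s : ι → Bool => ∑ b, (Gate.h.op : Op (Fin 1)) (fun _ => s j) (fun _ => b) *
        (if ∀ i, ¬ S i → Function.update s j b i = false then c else 0)) =
        fun s => if ∀ i, ¬ (S i ∨ i = j) → s i = false then c / (Real.sqrt 2 : ℂ) else 0 := by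
      funext s
      have h1 : ¬ ∀ i, ¬ S i → Function.update s j true i = false := fun h => by
        simpa using h j hj
      have h2 : (∀ i, ¬ S i → Function.update s j false i = false) ↔
          ∀ i, ¬ (S i ∨ i = j) → s i = false := by
        refine forall_congr' fun i => ?_
        by_cases hij : i = j
        · simp [hij]
        · simp [hij]
      rw [Fintype.sum_bool, if_neg h1, mul_zero, zero_add, h_op_apply]
      simp only [h2, Bool.and_false, Bool.false_eq_true, if_false]
      split_ifs
      · ring
      · simp
    rw [List.map_cons, run_cons]
    change run noOracle _ (applyUnitary _ _ (prepare e _ ρ)) = _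
    rw [applyUnitary_prepare, hstep, ih hl.2 (fun i => S i ∨ i = j)]
    · congr 1
      funext s
      have h3 : ∀ i, (¬ ((S i ∨ i = j) ∨ i ∈ l) → s i = false) ↔
          (¬ (S i ∨ i ∈ j :: l) → s i = false) := fun i => by
        rw [List.mem_cons, or_assoc]
      simp only [h3, List.length_cons, pow_succ', div_div]
    · intro i hi h
      rcases h with h | rfl
      · exact hS i (List.mem_cons_of_mem _ hi) h
      · exact hl.1 hi

end Registers

/-- A basis permutation inside a freshly prepared register acts on the prepared pure state only. -/
theorem prepare_submatrix_xorWires {ι κ κ' : Type} [Fintype ι] [DecidableEq ι] [Fintype κ]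
    [DecidableEq κ] [Fintype κ'] [DecidableEq κ'] {m : ℕ} (e : ι ↪ Fin m) (e' : κ ⊕ κ' ↪ ι)
    (g : (κ → Bool) → (κ' → Bool)) (φ : (ι → Bool) → ℂ) (ρ : Op (Fin m)) :
    (prepare e φ ρ).submatrix (xorWires (e'.trans e) g) (xorWires (e'.trans e) g) =
      prepare e (fun s => φ (Function.extend e' (xorMap g (s ∘ e')) s)) ρ := by
  have h0 : ∀ s : Fin m → Bool, xorWires (e'.trans e) g s =
      overwrite e (Function.extend e' (xorMap g ((s ∘ e) ∘ e')) (s ∘ e)) s := by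
    intro s
    rw [eq_overwrite_iff]
    constructor
    · funext i
      by_cases hi : ∃ p, e' p = i
      · obtain ⟨p, rfl⟩ := hi
        rw [e'.injective.extend_apply]
        exact overwrite_apply (e'.trans e) _ s p
      · rw [Function.extend_apply' _ _ _ hi]
        exact overwrite_of_notMem (e'.trans e) _ s fun p hp => hi ⟨p, e.injective hp⟩
    · intro q hq
      exact overwrite_of_notMem _ _ _ fun p => hq _
  ext s t
  simp only [Matrix.submatrix_apply, prepare_apply, h0, overwrite_comp, overwrite_overwrite]

/-- The public key of a pair of functions is prepared from zeros by Hadamard gates and oracle calls. -/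
theorem prepare_pairQpk {n m : ℕ} (F : Bool → Bits n → Bits (3 * n)) (e : Bool × Pos n ↪ Fin m)
    (eb : Bool → Pos n ↪ Fin m) (heb : ∀ b p, eb b p = e (b, p)) (ρ : Op (Fin m)) :
    ((run noOracle (((Finset.univ : Finset (Bool × Fin n)).toList.map
        fun p => (p.1, Sum.inl p.2)).map
          fun i => .gate .h ⟨fun _ => e i, fun _ _ _ => Subsingleton.elim _ _⟩)
      (prepare e (ket fun _ => false) ρ)).submatrix
        (xorWires (eb false) (F false)) (xorWires (eb false) (F false))).submatrix
        (xorWires (eb true) (F true)) (xorWires (eb true) (F true)) =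
      prepare e (pairQpk F) ρ := by
  set l : List (Bool × Pos n) := (Finset.univ : Finset (Bool × Fin n)).toList.map
    fun p => (p.1, Sum.inl p.2) with hl
  have hnd : l.Nodup := by
    refine (Finset.nodup_toList _).map fun p q h => ?_
    simp only [Prod.mk.injEq, Sum.inl.injEq] at h
    exact Prod.ext h.1 h.2
  have hlen : l.length = 2 * n := by
    simp [hl]
  have hmem : ∀ i, i ∈ l ↔ ∃ b j, i = (b, Sum.inl j) := by
    rintro ⟨b, p⟩
    simp only [hl, List.mem_map, Finset.mem_toList, Finset.mem_univ, true_and, Prod.exists,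
      Prod.mk.injEq]
    constructor
    · rintro ⟨b', j, rfl, rfl⟩; exact ⟨_, _, rfl, rfl⟩
    · rintro ⟨b', j, rfl, rfl⟩; exact ⟨_, _, rfl, rfl⟩
  have hket : (ket fun _ => false : (Bool × Pos n → Bool) → ℂ) =
      fun s => if ∀ i, ¬ False → s i = false then 1 else 0 := by
    funext s
    simp [ket, funext_iff]
  let e' : Bool → Pos n ↪ Bool × Pos n := fun b => ⟨fun p => (b, p), fun p q h => by simpa using h⟩
  have he' : ∀ b, eb b = (e' b).trans e := fun b => by
    ext p
    rw [heb]
    rfl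
  rw [hket, run_hadamards e l hnd (fun _ => False) (by simp) 1 ρ, he', he',
    prepare_submatrix_xorWires, prepare_submatrix_xorWires]
  congr 1
  funext s
  have hval : ∀ (s : Bool × Pos n → Bool),
      (∀ i, ¬ (False ∨ i ∈ l) → s i = false) ↔ ∀ b j, s (b, Sum.inr j) = false := by
    intro s
    constructor
    · intro h b j
      refine h _ ?_
      simp [hmem]
    · rintro h ⟨b, p | p⟩ hi
      · exact absurd (Or.inr ((hmem _).2 ⟨b, p, rfl⟩)) hi
      · exact h b p
  have hx : ∀ (b b' : Bool) (s : Bool × Pos n → Bool) (p : Pos n),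
      Function.extend (e' b) (xorMap (F b) (s ∘ e' b)) s (b', p) =
        if b' = b then xorMap (F b) (fun p => s (b, p)) p else s (b', p) := by
    intro b b' s p
    split_ifs with h
    · subst h
      exact (e' b').injective.extend_apply _ _ p
    · refine Function.extend_apply' _ _ _ ?_
      rintro ⟨q, hq⟩
      exact h (congrArg Prod.fst hq).symm
  -- There are `2 n` Hadamard gates, `n` for each half of the public key.
  have h2 : (1 : ℂ) / (Real.sqrt 2 : ℂ) ^ l.length =
      1 / (Real.sqrt (2 ^ n) : ℂ) * (1 / (Real.sqrt (2 ^ n) : ℂ)) := by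
    rw [hlen, pow_mul, ← Complex.ofReal_pow, ← Complex.ofReal_pow, Real.sq_sqrt (by norm_num),
      div_mul_div_comm, one_mul, ← Complex.ofReal_mul, Real.mul_self_sqrt (by positivity)]
  have hxor : ∀ a b : Bool, xor a b = false ↔ a = b := by decide
  let p : Bool → Prop := fun b =>
    (fun i => s (b, i)) ∘ Sum.inr = F b ((fun i => s (b, i)) ∘ Sum.inl)
  have h3 : ∀ s' : Bool × Pos n → Bool, (∀ b q, s' (b, q) = xorMap (F b) (fun q => s (b, q)) q) →
      ((∀ i, ¬ (False ∨ i ∈ l) → s' i = false) ↔ p false ∧ p true) := by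
    intro s' hs'
    rw [hval]
    simp only [hs', p, Bool.forall_bool, xorMap, Sum.elim_inr, funext_iff, hxor]
    rfl
  -- Pulling `s` back through both calls adds the function values to the output registers, which
  -- become zero exactly when both halves lie on their graphs.
  let s1 := Function.extend (e' true) (xorMap (F true) (s ∘ e' true)) s
  let s2 := Function.extend (e' false) (xorMap (F false) (s1 ∘ e' false)) s1
  have h4 := h3 s2 (by
    intro b q
    refine (hx false b s1 q).trans ?_
    cases b
    · rw [if_pos rfl]
      congr 1
      funext q
      exact (hx true false s q).trans (if_neg (by decide))
    · rw [if_neg (by decide)]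
      exact (hx true true s q).trans (if_pos rfl))
  change _ = (if p false then _ else _) * (if p true then _ else _)
  by_cases hf : p false
  · by_cases ht : p true
    · rw [if_pos hf, if_pos ht, ← h2]
      exact if_pos (h4.2 ⟨hf, ht⟩)
    · rw [if_neg ht, mul_zero]
      exact if_neg fun h => ht (h4.1 h).2
  · rw [if_neg hf, zero_mul]
    exact if_neg fun h => hf (h4.1 h).1

/-! ### Simulating the chosen-ciphertext game -/

theorem xorWires_eq_xorAt {ι κ : Type} {m : ℕ} (e : ι ⊕ κ ↪ Fin m) (g : (ι → Bool) → (κ → Bool))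
    (s : Fin m → Bool) :
    xorWires e g s = xorAt (fun j => e (Sum.inr j)) (g fun i => s (e (Sum.inl i))) s := by
  funext q
  by_cases hq : ∃ j, e (Sum.inr j) = q
  · obtain ⟨j, rfl⟩ := hq
    have hz : Function.Injective fun j => e (Sum.inr j) := fun i j hij => by
      simpa using e.injective hij
    rw [xorWires_inr]
    exact (xorAt_apply hz _ _ j).symm
  · push Not at hq
    rw [xorWires_of_ne _ _ _ hq, xorAt_of_ne _ _ hq]

theorem xorAt_inl {m : ℕ} {ω κ : Type} [DecidableEq ω] {z : κ → Fin m} (hz : Function.Injective z) (v : κ → Bool)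
    (u : Fin m → Bool) (a : ω → Bool) :
    xorAt (fun j => (Sum.inl (z j) : Fin m ⊕ ω)) v (Sum.elim u a) = Sum.elim (xorAt z v u) a := by
  funext p
  rcases p with q | i
  · by_cases h : ∃ j, z j = q
    · obtain ⟨j, rfl⟩ := h
      rw [Sum.elim_inl, xorAt_apply hz]
      exact xorAt_apply (Sum.inl_injective.comp hz) _ _ j
    · push Not at h
      rw [Sum.elim_inl, xorAt_of_ne _ _ h, xorAt_of_ne _ _ fun j hj => h j (Sum.inl_injective hj)]
      rfl
  · rw [Sum.elim_inr, xorAt_of_ne _ _ fun j => Sum.inl_ne_inr]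
    rfl

theorem xorAt_inr {m : ℕ} {ω κ : Type} [DecidableEq ω] {z : κ → ω} (hz : Function.Injective z) (v : κ → Bool)
    (u : Fin m → Bool) (a : ω → Bool) :
    xorAt (fun j => (Sum.inr (z j) : Fin m ⊕ ω)) v (Sum.elim u a) = Sum.elim u (xorAt z v a) := by
  funext p
  rcases p with q | i
  · rw [Sum.elim_inl, xorAt_of_ne _ _ fun j => Sum.inr_ne_inl]
    rfl
  · by_cases h : ∃ j, z j = i
    · obtain ⟨j, rfl⟩ := h
      rw [Sum.elim_inr, xorAt_apply hz]
      exact xorAt_apply (Sum.inr_injective.comp hz) _ _ j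
    · push Not at h
      rw [Sum.elim_inr, xorAt_of_ne _ _ h, xorAt_of_ne _ _ fun j hj => h j (Sum.inr_injective hj)]
      rfl

section Simulates

variable {n m K M : ℕ} {Γ : Type}

/-- With oracle access to `gf γ`, a circuit of length at most `N` maps `ρ` with the ancillas `a γ` to
`Φ γ ρ` with the ancillas `a' γ`. -/
def Simulates (gf : Γ → Bits n → Bits (3 * n)) (w : Wire m K ≃ Fin M) (a a' : Γ → Ancilla K → Bool)
    (Φ : Γ → Op (Fin m) → Op (Fin m)) (N : ℕ) : Prop :=
  ∃ P : List (Instr M (Pos n ↪ Fin M)), P.length ≤ N ∧ ∀ γ ρ,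
    run (prfOracle (gf γ)) P (embedState w (a γ) ρ) = embedState w (a' γ) (Φ γ ρ)

variable {gf : Γ → Bits n → Bits (3 * n)} {w : Wire m K ≃ Fin M} {a a' a'' : Γ → Ancilla K → Bool}
  {Φ Ψ : Γ → Op (Fin m) → Op (Fin m)} {N N' : ℕ}

theorem Simulates.mono (h : Simulates gf w a a' Φ N) (hN : N ≤ N') : Simulates gf w a a' Φ N' := by
  obtain ⟨P, h1, h2⟩ := h
  exact ⟨P, h1.trans hN, h2⟩

theorem Simulates.congr (h : Simulates gf w a a' Φ N) (hΦ : ∀ γ ρ, Φ γ ρ = Ψ γ ρ) :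
    Simulates gf w a a' Ψ N := by
  obtain ⟨P, h1, h2⟩ := h
  exact ⟨P, h1, fun γ ρ => by rw [h2, hΦ]⟩

theorem Simulates.comp (h : Simulates gf w a a' Φ N) (h' : Simulates gf w a' a'' Ψ N') :
    Simulates gf w a a'' (fun γ ρ => Ψ γ (Φ γ ρ)) (N + N') := by
  obtain ⟨P, h1, h2⟩ := h
  obtain ⟨P', h1', h2'⟩ := h'
  refine ⟨P ++ P', by rw [List.length_append]; omega, fun γ ρ => ?_⟩
  rw [run_append, h2, h2']

/-- A step without oracle calls, on the simulated wires. -/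
def liftInstr (n : ℕ) (w : Wire m K ≃ Fin M) : Instr m Empty → Instr M (Pos n ↪ Fin M)
  | .gate g e => .gate g (mainWires w e)
  | .measure q => .measure (w (Sum.inl q))
  | .reset q => .reset (w (Sum.inl q))
  | .query o => o.elim

theorem Simulates.noOracle (P : List (Instr m Empty)) :
    Simulates gf w a a (fun _ => run QuantumPKE.noOracle P) P.length := by
  refine ⟨P.map (liftInstr n w), by simp, fun γ ρ => ?_⟩
  induction P generalizing ρ with
  | nil => rfl
  | cons i P ih =>
    rw [List.map_cons, run_cons]
    refine Eq.trans ?_ (ih (i.apply QuantumPKE.noOracle ρ))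
    congr 1
    cases i with
    | gate g e => exact channel_embedState w e (fun _ : Unit => g.op) (a γ) ρ
    | measure q =>
      exact channel_embedState w (oneWire q) (fun v : Unit → Bool => basisProj v) (a γ) ρ
    | reset q =>
      exact channel_embedState w (oneWire q)
        (fun v : Unit → Bool => Matrix.of fun s t => if t = v then ket (fun _ => false) s else 0) (a γ) ρ
    | query o => exact o.elim

theorem Simulates.classical {P : List (ClassicalOp n (Wire m K))} (hN : P.length ≤ N)
    {F : Γ → (Fin m → Bool) → Fin m → Bool} (hF : ∀ γ, Function.Involutive (F γ))
    (hP : ∀ γ u, evalProg (gf γ) P (Sum.elim u (a γ)) = Sum.elim (F γ u) (a' γ)) :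
    Simulates gf w a a' (fun γ ρ => ρ.submatrix (F γ) (F γ)) N :=
  ⟨compile w P, (length_compile w P).trans hN,
    fun γ ρ => run_compile_embedState w (gf γ) P (hF γ) (hP γ) ρ⟩

/-- The challenge has been sent. -/
def ancLive (a : Ancilla K → Bool) : Bool := a (11, Fin.ofNat (K + 1) 0)

/-- The stored challenge. -/
def ancChal (n : ℕ) (a : Ancilla K → Bool) : Pos n → Bool :=
  Sum.elim (fun i => a (9, Fin.ofNat (K + 1) i)) (fun j => a (10, Fin.ofNat (K + 1) j))

/-- The decryption function in the game. -/
noncomputable def gameDec (F : Bool → Bits n → Bits (3 * n)) (a : Ancilla K → Bool) (c : Pos n → Bool) :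
    Option Bool :=
  if ancLive a = true ∧ c = ancChal n a then none else pairDec F c

/-- The work registers are zero. -/
def AncClean (a : Ancilla K → Bool) : Prop :=
  ∀ k : Fin 16, k.val < 9 → ∀ i, a (k, i) = false

theorem AncClean.clean {a : Ancilla K → Bool} (h : AncClean a) (u : Fin m → Bool) :
    Clean (Sum.elim u a) := fun k hk i => h k hk (Fin.ofNat (K + 1) i)

variable {C : List (ℕ × ℕ)} {h : Bits n → Bits (3 * n)}

/-- The query wires are measured one by one, and then the reversible decryption program runs; it
returns the ancillas to their former contents, so they can be reused. -/
theorem Simulates.dec (hC : ComputedBy C h) (hK : 4 * n + C.length ≤ K) (slot : Bool)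
    (ha : ∀ γ, AncClean (a γ)) (e : Pos n ⊕ Fin 2 ↪ Fin m) :
    Simulates gf w a a (fun γ => pairOracle (pairQpk (slotPair slot (gf γ) h))
      (gameDec (slotPair slot (gf γ) h) (a γ)) (.dec e)) (250 * (n + C.length + 1)) := by
  obtain ⟨P, hPl, hP⟩ := exists_dec_program (m := m) hC hK slot e
  have h1 := Simulates.noOracle (gf := gf) (w := w) (a := a)
    ((Finset.univ : Finset (Pos n)).toList.map
      fun p => .measure ((Function.Embedding.inl.trans e : Pos n ↪ Fin m) p))
  have h2 : Simulates gf w a a (fun γ ρ => ρ.submatrix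
      (xorWires e fun c => encodeAnswer (gameDec (slotPair slot (gf γ) h) (a γ) c))
      (xorWires e fun c => encodeAnswer (gameDec (slotPair slot (gf γ) h) (a γ) c)))
      (200 * (n + C.length + 1)) := by
    refine Simulates.classical hPl (fun γ => xorWires_involutive _ _) fun γ u => ?_
    rw [hP _ _ ((ha γ).clean u), xorWires_eq_xorAt, xorAt_inl]
    · have hch : (fun p : Pos n => Sum.elim u (a γ) (chalWire p)) = ancChal n (a γ) := by
        funext p
        rcases p with p | p <;> rfl
      rw [hch]
      rfl
    · exact fun i j hij => by simpa using hij
  have h3 := (h1.comp h2).mono (N' := 250 * (n + C.length + 1)) (by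
    simp only [List.length_map, Finset.length_toList, Finset.card_univ, Fintype.card_sum,
      Fintype.card_fin]
    omega)
  refine h3.congr fun γ ρ => ?_
  rw [run_measures, pairOracle, applyUnitary_xorOp_apply]

theorem Simulates.slotQuery (hC : ComputedBy C h) (hK : 4 * n + C.length ≤ K) (slot b : Bool)
    (ha : ∀ γ, AncClean (a γ)) (e : Pos n ↪ Fin m) :
    Simulates gf w a a (fun γ ρ => ρ.submatrix (xorWires e (slotPair slot (gf γ) h b))
      (xorWires e (slotPair slot (gf γ) h b))) (7 * n + 4 * C.length + 1) := by
  obtain ⟨Q, hQl, _, _, hQ⟩ := exists_slot_query (m := m) hC hK slot b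
    (e.trans Function.Embedding.inl) (fun p i => inl_ne_anc _ _ _)
  refine Simulates.classical hQl (fun γ => xorWires_involutive _ _) fun γ u => ?_
  rw [hQ _ _ fun i => ha γ 0 (by decide) _, xorWires_eq_xorAt]
  exact xorAt_inl (fun i j hij => by simpa using e.injective hij) _ _ _

/-- Reset, Hadamard gates, and one evaluation of each function. The decryption function plays no
role in this call and may be arbitrary. -/
theorem Simulates.qpk (hC : ComputedBy C h) (hK : 4 * n + C.length ≤ K) (slot : Bool)
    (ha : ∀ γ, AncClean (a γ)) (e : Bool × Pos n ↪ Fin m) (D : Γ → (Pos n → Bool) → Option Bool) :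
    Simulates gf w a a (fun γ => pairOracle (pairQpk (slotPair slot (gf γ) h)) (D γ) (.qpk e))
      (250 * (n + C.length + 1)) := by
  let eb : Bool → Pos n ↪ Fin m := fun b =>
    ⟨fun p => e (b, p), fun p q hpq => by simpa using e.injective hpq⟩
  have h1 := Simulates.noOracle (gf := gf) (w := w) (a := a)
    ((Finset.univ : Finset (Bool × Pos n)).toList.map fun i => .reset (e i))
  have h2 := Simulates.noOracle (gf := gf) (w := w) (a := a)
    (((Finset.univ : Finset (Bool × Fin n)).toList.map fun p => (p.1, (Sum.inl p.2 : Pos n))).map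
          fun i => .gate .h ⟨fun _ => e i, fun _ _ _ => Subsingleton.elim _ _⟩)
  have h3 := Simulates.slotQuery (gf := gf) (w := w) hC hK slot false ha (eb false)
  have h4 := Simulates.slotQuery (gf := gf) (w := w) hC hK slot true ha (eb true)
  have h5 := (((h1.comp h2).comp h3).comp h4).mono (N' := 250 * (n + C.length + 1)) (by
    simp only [List.length_map, Finset.length_toList, Finset.card_univ, Fintype.card_sum,
      Fintype.card_fin, Fintype.card_prod, Fintype.card_bool]
    omega)
  refine h5.congr fun γ ρ => ?_
  rw [run_resets]
  exact prepare_pairQpk (slotPair slot (gf γ) h) e eb (fun _ _ => rfl) ρ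

theorem Simulates.instr (hC : ComputedBy C h) (hK : 4 * n + C.length ≤ K) (slot : Bool)
    (ha : ∀ γ, AncClean (a γ)) (i : Instr m (CCAQuery m (Bool × Pos n) (Pos n))) :
    Simulates gf w a a (fun γ => i.apply (pairOracle (pairQpk (slotPair slot (gf γ) h))
      (gameDec (slotPair slot (gf γ) h) (a γ)))) (250 * (n + C.length + 1)) := by
  cases i with
  | gate g e => exact (Simulates.noOracle [.gate g e]).mono (by simp; omega)
  | measure q => exact (Simulates.noOracle [.measure q]).mono (by simp; omega)
  | reset q => exact (Simulates.noOracle [.reset q]).mono (by simp; omega)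
  | query o =>
    cases o with
    | qpk e => exact Simulates.qpk hC hK slot ha e fun γ => gameDec (slotPair slot (gf γ) h) (a γ)
    | dec e => exact Simulates.dec hC hK slot ha e

theorem Simulates.run (hC : ComputedBy C h) (hK : 4 * n + C.length ≤ K) (slot : Bool)
    (ha : ∀ γ, AncClean (a γ)) (P : List (Instr m (CCAQuery m (Bool × Pos n) (Pos n)))) :
    Simulates gf w a a (fun γ => QuantumPKE.run (pairOracle (pairQpk (slotPair slot (gf γ) h))
      (gameDec (slotPair slot (gf γ) h) (a γ))) P) (P.length * (250 * (n + C.length + 1))) := by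
  induction P with
  | nil => exact ⟨[], by simp, fun γ ρ => rfl⟩
  | cons i P ih =>
    refine ((Simulates.instr hC hK slot ha i).comp ih).mono ?_
    rw [List.length_cons, add_mul]
    omega

/-- Outcome probabilities see only the diagonal, which a classical program permutes. -/
theorem outcomeProb_run_compile (g : Bits n → Bits (3 * n)) (P : List (ClassicalOp n (Wire m K)))
    (a : Ancilla K → Bool) (ρ : Op (Fin m)) (r : Wire m K) (b : Bool) :
    outcomeProb (w r) b (QuantumPKE.run (prfOracle g) (compile w P) (embedState w a ρ)) =
      ∑ u, if evalProg g P (Sum.elim u a) r = b then (ρ u u).re else 0 := by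
  let ε : (Wire m K → Bool) ≃ (Fin M → Bool) := Equiv.arrowCongr w (Equiv.refl Bool)
  have hε : ∀ s, ε s = s ∘ w.symm := fun s => rfl
  let π : (Wire m K → Bool) ≃ (Wire m K → Bool) :=
    ⟨evalProg g P, evalProg g P.reverse, evalProg_reverse g P, evalProg_reverse' g P⟩
  rw [outcomeProb, ← ε.sum_comp, ← π.sum_comp,
    ← (Equiv.sumArrowEquivProdArrow (Fin m) (Ancilla K) Bool).symm.sum_comp, Fintype.sum_prod_type]
  refine Finset.sum_congr rfl fun u _ => ?_
  have h1 : ∀ a', (Equiv.sumArrowEquivProdArrow (Fin m) (Ancilla K) Bool).symm (u, a') =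
      Sum.elim u a' := fun a' => rfl
  have h2 : ∀ s, π s = evalProg g P s := fun s => rfl
  simp only [h1, h2, hε, run_compile_apply, evalProg_reverse, embedState_apply, Sum.elim_comp_inr,
    Sum.elim_comp_inl, and_self, Function.comp_apply, Equiv.symm_apply_apply]
  rw [Finset.sum_eq_single a]
  · simp
  · intro a' _ ha'
    simp [ha']
  · simp

end Simulates

theorem evalProg_consts {n : ℕ} {ω κ : Type} [DecidableEq ω] (g : Bits n → Bits (3 * n)) (z : κ → ω)
    (hz : Function.Injective z) (v : κ → Bool) (l : List κ) (hl : l.Nodup) (hmem : ∀ j, j ∈ l)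
    (s : ω → Bool) :
    evalProg g (l.flatMap fun j => if v j then [ClassicalOp.x (z j)] else []) s = xorAt z v s := by
  have key : ∀ (l : List κ) (s : ω → Bool), l.Nodup → ∀ w,
      evalProg g (l.flatMap fun j => if v j then [ClassicalOp.x (z j)] else []) s w =
        xor (s w) (decide (∃ j ∈ l, v j = true ∧ z j = w)) := by
    intro l
    induction l with
    | nil => intro s _ w; simp
    | cons i l ih =>
      intro s hl w
      rw [List.nodup_cons] at hl
      rw [List.flatMap_cons, evalProg_append, ih _ hl.2]
      by_cases hv : v i = true
      · by_cases hw : z i = w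
        · subst hw
          have h1 : ¬ ∃ j ∈ l, v j = true ∧ z j = z i := by
            rintro ⟨j, hj, _, h⟩
            exact hl.1 (hz h ▸ hj)
          have h2 : ∃ j ∈ i :: l, v j = true ∧ z j = z i := ⟨i, List.mem_cons_self, hv, rfl⟩
          rw [decide_eq_false h1, decide_eq_true h2]
          simp [hv, ClassicalOp.eval]
        · have h1 : (∃ j ∈ i :: l, v j = true ∧ z j = w) ↔ ∃ j ∈ l, v j = true ∧ z j = w := by
            simp [hw]
          have h2 : decide (∃ j ∈ i :: l, v j = true ∧ z j = w) =
              decide (∃ j ∈ l, v j = true ∧ z j = w) := decide_eq_decide.2 h1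
          rw [h2]
          simp [hv, ClassicalOp.eval, Function.update_of_ne (Ne.symm hw)]
      · have h1 : (∃ j ∈ i :: l, v j = true ∧ z j = w) ↔ ∃ j ∈ l, v j = true ∧ z j = w := by
          simp [hv]
        simp [hv, h1]
  funext w
  rw [key l s hl]
  by_cases hw : ∃ j, z j = w
  · obtain ⟨j, rfl⟩ := hw
    rw [xorAt_apply hz]
    congr 1
    rw [Bool.eq_iff_iff, decide_eq_true_iff]
    constructor
    · rintro ⟨i, _, hi, h⟩
      rwa [← hz h]
    · intro h
      exact ⟨j, hmem j, h, rfl⟩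
  · push Not at hw
    rw [xorAt_of_ne _ _ hw, decide_eq_false, Bool.xor_false]
    rintro ⟨j, _, _, h⟩
    exact hw j h

theorem length_flatMap_le {κ α : Type} (l : List κ) (f : κ → List α) (hf : ∀ j, (f j).length ≤ 1) :
    (l.flatMap f).length ≤ l.length := by
  induction l with
  | nil => exact le_rfl
  | cons i l ih =>
    rw [List.flatMap_cons, List.length_append, List.length_cons]
    have := hf i
    omega

/-! ### The reduction -/

theorem xorAt_sumElim {ω κ κ' : Type} [DecidableEq ω] {z : κ ⊕ κ' → ω} (hz : Function.Injective z)
    (v : κ → Bool) (v' : κ' → Bool) (s : ω → Bool) :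
    xorAt z (Sum.elim v v') s =
      xorAt (fun j => z (Sum.inr j)) v' (xorAt (fun i => z (Sum.inl i)) v s) := by
  have hl : Function.Injective fun i => z (Sum.inl i) := hz.comp Sum.inl_injective
  have hr : Function.Injective fun j => z (Sum.inr j) := hz.comp Sum.inr_injective
  funext q
  by_cases h : ∃ p, z p = q
  · obtain ⟨p, rfl⟩ := h
    rw [xorAt_apply hz]
    rcases p with i | j
    · rw [xorAt_of_ne _ _ fun j hj => Sum.inr_ne_inl (hz hj)]
      exact (xorAt_apply hl _ _ i).symm
    · refine Eq.trans ?_ (xorAt_apply hr _ _ j).symm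
      rw [xorAt_of_ne _ _ fun i hi => Sum.inl_ne_inr (hz hi)]
      rfl
  · push Not at h
    rw [xorAt_of_ne _ _ h, xorAt_of_ne _ _ fun _ => h _, xorAt_of_ne _ _ fun _ => h _]

/-! ### Storing and delivering the challenge, testing the messages -/

section Programs

variable {n m K : ℕ}

/-- The ancillas that hold the challenge. -/
def chalAnc : Pos n → Ancilla K :=
  Sum.elim (fun i => (9, Fin.ofNat (K + 1) i)) (fun j => (10, Fin.ofNat (K + 1) j))

theorem chalAnc_injective (hK : 4 * n ≤ K) : Function.Injective (chalAnc : Pos n → Ancilla K) := by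
  have h : ∀ k : Fin 16, ∀ i ≤ K, ∀ j ≤ K,
      ((k, Fin.ofNat (K + 1) i) : Ancilla K) = (k, Fin.ofNat (K + 1) j) → i = j :=
    fun k i hi j hj hij => anc_injOn (m := 0) k i hi j hj (congrArg Sum.inr hij)
  rintro (i | i) (j | j) hij
  · rw [Fin.ext (h 9 i (by omega) j (by omega) hij)]
  · exact absurd (congrArg Prod.fst hij) (by decide : (9 : Fin 16) ≠ 10)
  · exact absurd (congrArg Prod.fst hij) (by decide : (10 : Fin 16) ≠ 9)
  · rw [Fin.ext (h 10 i (by omega) j (by omega) hij)]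

/-- The ancillas after the challenge `c` has been stored. -/
noncomputable def storeChal (c : Pos n → Bool) (a : Ancilla K → Bool) : Ancilla K → Bool :=
  xorAt chalAnc c (xorAt (fun _ : Unit => ((11, Fin.ofNat (K + 1) 0) : Ancilla K)) (fun _ => true) a)

theorem storeChal_of_ne (c : Pos n → Bool) (a : Ancilla K → Bool) {k : Fin 16} (i : Fin (K + 1))
    (h9 : k ≠ 9) (h10 : k ≠ 10) (h11 : k ≠ 11) : storeChal c a (k, i) = a (k, i) := by
  rw [storeChal, xorAt_of_ne, xorAt_of_ne]
  · exact fun _ h => h11 (congrArg Prod.fst h).symm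
  · rintro (j | j) h
    · exact h9 (congrArg Prod.fst h).symm
    · exact h10 (congrArg Prod.fst h).symm

theorem ancLive_storeChal (c : Pos n → Bool) {a : Ancilla K → Bool} (ha : ancLive a = false) :
    ancLive (storeChal c a) = true := by
  rw [ancLive, storeChal, xorAt_of_ne]
  · have := xorAt_apply (z := fun _ : Unit => ((11, Fin.ofNat (K + 1) 0) : Ancilla K))
      (fun _ _ _ => rfl) (fun _ => true) a ()
    rw [this]
    rw [ancLive] at ha
    rw [ha]
    rfl
  · rintro (j | j) h
    · exact absurd (congrArg Prod.fst h) (by decide : (9 : Fin 16) ≠ 11)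
    · exact absurd (congrArg Prod.fst h) (by decide : (10 : Fin 16) ≠ 11)

theorem storeChal_chalAnc (hK : 4 * n ≤ K) (c : Pos n → Bool) {a : Ancilla K → Bool} (p : Pos n)
    (ha : a (chalAnc p) = false) : storeChal c a (chalAnc p) = c p := by
  rw [storeChal, xorAt_apply (chalAnc_injective hK), xorAt_of_ne, ha, Bool.false_xor]
  rcases p with p | p
  · exact fun _ h => absurd (congrArg Prod.fst h) (by decide : (11 : Fin 16) ≠ 9)
  · exact fun _ h => absurd (congrArg Prod.fst h) (by decide : (11 : Fin 16) ≠ 10)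

theorem ancChal_storeChal (hK : 4 * n ≤ K) (c : Pos n → Bool) {a : Ancilla K → Bool}
    (ha : ∀ p : Pos n, a (chalAnc p) = false) : ancChal n (storeChal c a) = c := by
  funext p
  rw [← storeChal_chalAnc hK c p (ha p)]
  rcases p with p | p <;> rfl

/-- Without a prescribed `y`, one oracle call on the stored `x` produces `g x`; this is the only
place where the real and the random challenge differ in the simulation. -/
theorem exists_challenge_program (m : ℕ) (hK : 4 * n ≤ K) (x : Bits n) (y : Option (Bits (3 * n))) :
    ∃ P : List (ClassicalOp n (Wire m K)), P.length ≤ 4 * n + 2 ∧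
      ∀ (g : Bits n → Bits (3 * n)) (u : Fin m → Bool) (a : Ancilla K → Bool),
        (∀ p : Pos n, a (chalAnc p) = false) →
          evalProg g P (Sum.elim u a) = Sum.elim u (storeChal (Sum.elim x (y.getD (g x))) a) := by
  have hz := chalAnc_injective hK
  have hl : Function.Injective fun i : Fin n => (chalAnc (Sum.inl i : Pos n) : Ancilla K) :=
    hz.comp Sum.inl_injective
  have hr : Function.Injective fun j : Fin (3 * n) => (chalAnc (Sum.inr j : Pos n) : Ancilla K) :=
    hz.comp Sum.inr_injective
  let P0 : List (ClassicalOp n (Wire m K)) :=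
    -- A single flip, written in the shape to which `evalProg_consts` applies.
    [()].flatMap fun _ => if true then [.x (Sum.inr (11, Fin.ofNat (K + 1) 0))] else []
  let P1 : List (ClassicalOp n (Wire m K)) :=
    (List.finRange n).flatMap fun i => if x i then [.x (Sum.inr (chalAnc (Sum.inl i : Pos n)))] else []
  let P2 : List (ClassicalOp n (Wire m K)) := match y with
    | none => [.query ⟨fun p => Sum.inr (chalAnc p), Sum.inr_injective.comp hz⟩]
    | some y => (List.finRange (3 * n)).flatMap fun j =>
        if y j then [.x (Sum.inr (chalAnc (Sum.inr j : Pos n)))] else []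
  have hP1 : P1.length ≤ n := (length_flatMap_le _ _ fun i => by split_ifs <;> simp).trans (by simp)
  have hP2 : P2.length ≤ 3 * n + 1 := by
    cases y with
    | none => simp [P2]
    | some y =>
      refine (length_flatMap_le _ _ fun i => by split_ifs <;> simp).trans ?_
      simp
  refine ⟨P0 ++ P1 ++ P2, ?_, fun g u a ha => ?_⟩
  · have : P0.length = 1 := rfl
    simp only [List.length_append]
    omega
  set a1 := xorAt (fun _ : Unit => ((11, Fin.ofNat (K + 1) 0) : Ancilla K)) (fun _ => true) a with ha1
  set a2 := xorAt (fun i : Fin n => (chalAnc (Sum.inl i : Pos n) : Ancilla K)) x a1 with ha2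
  have h0 : evalProg g P0 (Sum.elim u a) = Sum.elim u a1 := by
    rw [ha1, ← xorAt_inr (fun _ _ _ => rfl)]
    exact evalProg_consts g (fun _ : Unit => (Sum.inr (11, Fin.ofNat (K + 1) 0) : Wire m K))
      (fun _ _ _ => rfl) (fun _ => true) [()] (by simp) (by simp) _
  have h1 : evalProg g P1 (Sum.elim u a1) = Sum.elim u a2 := by
    rw [ha2, ← xorAt_inr hl]
    exact evalProg_consts g (fun i => (Sum.inr (chalAnc (Sum.inl i : Pos n)) : Wire m K))
      (Sum.inr_injective.comp hl) x _ (List.nodup_finRange n) (List.mem_finRange ·) _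
  have h2 : evalProg g P2 (Sum.elim u a2) = Sum.elim u
      (xorAt (fun j : Fin (3 * n) => (chalAnc (Sum.inr j : Pos n) : Ancilla K)) (y.getD (g x)) a2) := by
    rw [← xorAt_inr hr]
    cases y with
    | none =>
      have h3 : (fun i : Fin n => a2 (chalAnc (Sum.inl i : Pos n))) = x := by
        funext i
        rw [ha2]
        refine (xorAt_apply hl x a1 i).trans ?_
        rw [ha1, xorAt_of_ne, ha, Bool.false_xor]
        exact fun _ h => absurd (congrArg Prod.fst h) (by decide : (11 : Fin 16) ≠ 9)
      change xorAt _ (g fun i : Fin n => a2 (chalAnc (Sum.inl i : Pos n))) _ = _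
      rw [h3]
      rfl
    | some y =>
      exact evalProg_consts g (fun j => (Sum.inr (chalAnc (Sum.inr j : Pos n)) : Wire m K))
        (Sum.inr_injective.comp hr) y _ (List.nodup_finRange _) (List.mem_finRange ·) _
  rw [evalProg_append, evalProg_append, h0, h1, h2, storeChal, xorAt_sumElim hz]

/-- A program that tests whether the wires `e` hold `v`. -/
theorem exists_flag_program (K : ℕ) (e : Fin 2 ↪ Fin m) (v : Bits 2) :
    ∃ P : List (ClassicalOp n (Wire m K)), P.length ≤ 5 ∧
      ∀ (g : Bits n → Bits (3 * n)) (s : Wire m K → Bool),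
        evalProg g P s = xorAt (fun _ : Unit => anc 12 0)
          (fun _ => decide ((fun j => s (Sum.inl (e j))) = v)) s := by
  have hz : Function.Injective fun j => (Sum.inl (e j) : Wire m K) := Sum.inl_injective.comp e.injective
  -- Flipping the wires where `v` is 0 turns the test into a conjunction of two bits; the flips are
  -- undone afterwards.
  let P : List (ClassicalOp n (Wire m K)) :=
    (List.finRange 2).flatMap fun j => if !(v j) then [.x (Sum.inl (e j))] else []
  have hP : P.length ≤ 2 := (length_flatMap_le _ _ fun i => by split_ifs <;> simp).trans (by simp)
  let W : List (ClassicalOp n (Wire m K)) := [.toffoli (Sum.inl (e 0)) (Sum.inl (e 1)) (anc 12 0)]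
  refine ⟨P ++ W ++ P.reverse, ?_, fun g s => ?_⟩
  · have : W.length = 1 := rfl
    simp only [List.length_append, List.length_reverse]
    omega
  have hu : UsesIn P fun w => ∃ q, w = Sum.inl q := by
    intro c hc w hw
    obtain ⟨j, _, hj⟩ := List.mem_flatMap.1 hc
    split_ifs at hj
    · rw [List.mem_singleton] at hj
      subst hj
      exact ⟨_, hw⟩
    · simp at hj
  refine hu.eval_conj g _ _ s (fun _ ⟨q, hq⟩ => anc_ne_inl _ _ _ hq) ?_
  have h1 : evalProg g P s = xorAt (fun j => Sum.inl (e j)) (fun j => !(v j)) s :=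
    evalProg_consts g _ hz (fun j => !(v j)) _ (List.nodup_finRange 2) (List.mem_finRange ·) s
  have h2 : ∀ j, evalProg g P s (Sum.inl (e j)) = xor (s (Sum.inl (e j))) (!(v j)) := fun j => by
    rw [h1]
    exact xorAt_apply hz _ s j
  have h3 : ¬ ((Sum.inl (e 0) : Wire m K) = anc 12 0 ∨ (Sum.inl (e 1) : Wire m K) = anc 12 0 ∨
      (Sum.inl (e 0) : Wire m K) = Sum.inl (e 1)) := by
    rintro (h | h | h)
    · exact inl_ne_anc _ _ _ h
    · exact inl_ne_anc _ _ _ h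
    · exact absurd (hz h) (by decide)
  have h4 : (evalProg g P s (Sum.inl (e 0)) && evalProg g P s (Sum.inl (e 1))) =
      decide ((fun j => s (Sum.inl (e j))) = v) := by
    rw [h2, h2, Bool.eq_iff_iff, decide_eq_true_iff, funext_iff, Fin.forall_fin_two]
    generalize s (Sum.inl (e 0)) = a
    generalize s (Sum.inl (e 1)) = b
    generalize v 0 = a'
    generalize v 1 = b'
    revert a b a' b'
    decide
  rw [← h4]
  simp only [W, evalProg_cons, evalProg_nil, ClassicalOp.eval, if_neg h3]
  funext w
  by_cases hw : w = anc 12 0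
  · subst hw
    rw [Function.update_self]
    exact (xorAt_apply (z := fun _ : Unit => (anc 12 0 : Wire m K)) (fun _ _ _ => rfl)
      (fun _ => evalProg g P s (Sum.inl (e 0)) && evalProg g P s (Sum.inl (e 1)))
      (evalProg g P s) ()).symm
  · rw [Function.update_of_ne hw, xorAt_of_ne]
    exact fun _ h => hw h.symm

theorem prepare_submatrix_xorAt {ι : Type} [Fintype ι] [DecidableEq ι] (e : ι ↪ Fin m) (c : ι → Bool)
    (ρ : Op (Fin m)) :
    (prepare e (ket fun _ => false) ρ).submatrix (xorAt e c) (xorAt e c) = prepare e (ket c) ρ := by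
  have h1 : ∀ s : Fin m → Bool, (ket (fun _ => false) (xorAt e c s ∘ e) : ℂ) = ket c (s ∘ e) := by
    intro s
    have : xorAt e c s ∘ e = (fun _ => false) ↔ s ∘ e = c := by
      simp only [funext_iff, Function.comp_apply, xorAt_apply e.injective]
      refine forall_congr' fun i => ?_
      generalize s (e i) = a
      generalize c i = b
      revert a b
      decide
    simp only [ket, this]
  have h2 : ∀ (v : ι → Bool) (s : Fin m → Bool), overwrite e v (xorAt e c s) = overwrite e v s := by
    intro v s
    rw [eq_overwrite_iff]
    refine ⟨overwrite_comp _ _ _, fun q hq => ?_⟩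
    rw [overwrite_of_notMem e _ _ hq, xorAt_of_ne _ _ hq]
  ext s t
  simp only [Matrix.submatrix_apply, prepare_apply, h1, h2]

theorem xorAt_involutive {ω κ : Type} [DecidableEq ω] (z : κ → ω) (v : κ → Bool) :
    Function.Involutive (xorAt z v) := fun s => by
  funext w
  simp [xorAt]

/-- The challenge is a basis state in the ancillas, so it can be copied by CNOT gates onto wires
that have been reset. -/
theorem Simulates.deliver {M : ℕ} {Γ : Type} {gf : Γ → Bits n → Bits (3 * n)} {w : Wire m K ≃ Fin M}
    {a : Γ → Ancilla K → Bool} (e : Pos n ↪ Fin m) {c : Γ → Pos n → Bool}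
    (hc : ∀ γ p, a γ (chalAnc p) = c γ p) :
    Simulates gf w a a (fun γ => prepare e (ket (c γ))) (8 * n) := by
  have h1 := Simulates.noOracle (gf := gf) (w := w) (a := a)
    ((Finset.univ : Finset (Pos n)).toList.map fun i => .reset (e i))
  have hz : Function.Injective fun p => (Sum.inl (e p) : Wire m K) := Sum.inl_injective.comp e.injective
  have h2 : Simulates gf w a a (fun γ ρ => ρ.submatrix (xorAt e (c γ)) (xorAt e (c γ))) (4 * n) := by
    refine Simulates.classical (P := (Finset.univ : Finset (Pos n)).toList.map
      fun p => .cnot (Sum.inr (chalAnc p)) (Sum.inl (e p))) ?_ (fun γ => xorAt_involutive _ _)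
      fun γ u => ?_
    · simp only [List.length_map, Finset.length_toList, Finset.card_univ, Fintype.card_sum,
        Fintype.card_fin]
      omega
    · rw [evalProg_cnots (gf γ) (fun p : Pos n => (Sum.inr (chalAnc p) : Wire m K)) _ hz
        (fun _ _ => Sum.inr_ne_inl) _ (Finset.nodup_toList _) (by simp), xorAt_inl e.injective]
      congr 2
      funext p
      exact hc γ p
  refine ((h1.comp h2).mono (N' := 8 * n) (by
    simp only [List.length_map, Finset.length_toList, Finset.card_univ, Fintype.card_sum,
      Fintype.card_fin]
    omega)).congr fun γ ρ => ?_
  rw [run_resets, prepare_submatrix_xorAt]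

end Programs

theorem gameDec_of_not_live {n K : ℕ} (F : Bool → Bits n → Bits (3 * n)) {a : Ancilla K → Bool}
    (h : ancLive a = false) : gameDec F a = pairDec F := by
  funext c
  simp [gameDec, h]

theorem gameDec_of_live {n K : ℕ} (F : Bool → Bits n → Bits (3 * n)) {a : Ancilla K → Bool}
    {c : Pos n → Bool} (h : ancLive a = true) (hc : ancChal n a = c) :
    gameDec F a = puncture c (pairDec F) := by
  funext c'
  simp [gameDec, puncture, h, hc]

/-- The ancillas when the flag is set to `b`. -/
def flagAnc (K : ℕ) (b : Bool) : Ancilla K → Bool :=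
  fun p => if p = (12, Fin.ofNat (K + 1) 0) then b else false

theorem flagAnc_of_ne {K : ℕ} (b : Bool) {k : Fin 16} (h : k ≠ 12) (i : Fin (K + 1)) :
    flagAnc K b (k, i) = false := if_neg fun h' => h (congrArg Prod.fst h')

theorem flagAnc_chalAnc {n K : ℕ} (b : Bool) (p : Pos n) : flagAnc K b (chalAnc p) = false := by
  rcases p with p | p
  · exact flagAnc_of_ne b (by decide) _
  · exact flagAnc_of_ne b (by decide) _

/-! ### Assembling the distinguisher -/

section Reduction

variable {n : ℕ} {C : List (ℕ × ℕ)} {h : Bits n → Bits (3 * n)}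

/-- The first part of the game, up to the measurement of the messages. -/
theorem simulates_find (A : CCAAdversary (Bool × Pos n) (Pos n)) (hC : ComputedBy C h) {K M : ℕ}
    (hK : 4 * n + C.length ≤ K) (w : Wire A.qubits K ≃ Fin M) (slot : Bool) :
    Simulates (fun g => g) w (fun _ _ => false) (fun _ _ => false)
      (fun g ρ => measureWires A.msg (run (pairOracle (pairQpk (slotPair slot g h))
        (pairDec (slotPair slot g h))) A.find ρ))
      (A.find.length * (250 * (n + C.length + 1)) + 2) := by
  have h1 := Simulates.run (gf := fun g : Bits n → Bits (3 * n) => g) (w := w)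
    (a := fun _ _ => false) hC hK slot (fun _ _ _ _ => rfl) A.find
  have h2 := Simulates.noOracle (gf := fun g : Bits n → Bits (3 * n) => g) (w := w)
    (a := fun _ _ => false) ((Finset.univ : Finset (Fin 2)).toList.map fun i => .measure (A.msg i))
  refine ((h1.comp h2).mono (N' := A.find.length * (250 * (n + C.length + 1)) + 2) (by simp)).congr
    fun g ρ => ?_
  rw [run_measures, gameDec_of_not_live _ rfl]

/-- The part of the game from the challenge on. -/
theorem simulates_guess (A : CCAAdversary (Bool × Pos n) (Pos n)) (hC : ComputedBy C h) {K M : ℕ}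
    (hK : 4 * n + C.length ≤ K) (w : Wire A.qubits K ≃ Fin M) (slot : Bool) (x : Bits n)
    (y : Option (Bits (3 * n))) :
    Simulates (fun γ : (Bits n → Bits (3 * n)) × Bool => γ.1) w (fun γ => flagAnc K γ.2)
      (fun γ => storeChal (Sum.elim x (y.getD (γ.1 x))) (flagAnc K γ.2))
      (fun γ ρ => run (pairOracle (pairQpk (slotPair slot γ.1 h))
        (puncture (Sum.elim x (y.getD (γ.1 x))) (pairDec (slotPair slot γ.1 h)))) A.guess
          (prepare A.chal (ket (Sum.elim x (y.getD (γ.1 x)))) ρ))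
      (4 * n + 2 + 8 * n + A.guess.length * (250 * (n + C.length + 1))) := by
  have hK' : 4 * n ≤ K := by omega
  obtain ⟨P, hPl, hP⟩ := exists_challenge_program A.qubits hK' x y
  -- The message flag is part of the parameter `γ`: one circuit must work for both of its values as
  -- well as for every `g`.
  have h1 : Simulates (fun γ : (Bits n → Bits (3 * n)) × Bool => γ.1) w (fun γ => flagAnc K γ.2)
      (fun γ => storeChal (Sum.elim x (y.getD (γ.1 x))) (flagAnc K γ.2))
      (fun _ ρ => ρ) (4 * n + 2) :=
    (Simulates.classical (F := fun _ u => u) hPl (fun _ _ => rfl)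
      fun γ u => hP γ.1 u _ (flagAnc_chalAnc γ.2)).congr fun _ _ => rfl
  have h2 := Simulates.deliver (gf := fun γ : (Bits n → Bits (3 * n)) × Bool => γ.1) (w := w)
    (a := fun γ => storeChal (Sum.elim x (y.getD (γ.1 x))) (flagAnc K γ.2)) A.chal
    (c := fun γ => Sum.elim x (y.getD (γ.1 x)))
    fun γ p => storeChal_chalAnc hK' _ p (flagAnc_chalAnc γ.2 p)
  have h3 := Simulates.run (gf := fun γ : (Bits n → Bits (3 * n)) × Bool => γ.1) (w := w)
    (a := fun γ => storeChal (Sum.elim x (y.getD (γ.1 x))) (flagAnc K γ.2)) hC hK slot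
    (fun γ k hk i => by
      have hne : ∀ k' : Fin 16, 9 ≤ k'.val → k ≠ k' := by
        rintro k' hk' rfl
        omega
      rw [storeChal_of_ne _ _ _ (hne 9 (by decide)) (hne 10 (by decide)) (hne 11 (by decide)),
        flagAnc_of_ne _ (hne 12 (by decide))]) A.guess
  refine ((h1.comp h2).comp h3).congr fun γ ρ => ?_
  have hlive : ancLive (flagAnc K γ.2) = false := flagAnc_of_ne γ.2 (by decide) _
  rw [gameDec_of_live _ (ancLive_storeChal _ hlive) (ancChal_storeChal hK' _ (flagAnc_chalAnc γ.2))]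

/-- The final test. -/
def acceptProg {m K : ℕ} (n : ℕ) (q : Fin m) (b : Bool) : List (ClassicalOp n (Wire m K)) :=
  (if b then [] else [.x (Sum.inl q)]) ++ [.toffoli (Sum.inl q) (anc 12 0) (anc 13 0)]

theorem evalProg_acceptProg {m K : ℕ} (q : Fin m) (b : Bool) (g : Bits n → Bits (3 * n))
    (s : Wire m K → Bool) (hs : s (anc 13 0) = false) :
    evalProg g (acceptProg n q b) s (anc 13 0) = true ↔ s (Sum.inl q) = b ∧ s (anc 12 0) = true := by
  have h1 : (anc 12 0 : Wire m K) ≠ anc 13 0 := anc_ne (by decide) _ _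
  cases b <;> simp [acceptProg, ClassicalOp.eval, h1, hs]

/-- One run of the game, with the challenge ciphertext `(x, y)` or `(x, g x)`, as a test of `g`. -/
theorem exists_reduction (A : CCAAdversary (Bool × Pos n) (Pos n)) (hC : ComputedBy C h)
    (slot : Bool) (v : Bits 2) (b' : Bool) (x : Bits n) (y : Option (Bits (3 * n))) :
    ∃ B : PRFAdversary n, B.size ≤ 400 * (A.size + 1) * (n + C.length + 1) ∧
      ∀ g, B.acceptProb g = gameProb A (slotPair slot g h) v b' (Sum.elim x (y.getD (g x))) := by
  obtain ⟨K, hK⟩ : ∃ K, K = 4 * n + C.length := ⟨_, rfl⟩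
  let M := Fintype.card (Wire A.qubits K)
  let w : Wire A.qubits K ≃ Fin M := Fintype.equivFin _
  obtain ⟨P1, hl1, h1⟩ := simulates_find A hC hK.ge w slot
  obtain ⟨P2, hl2, h2⟩ := exists_flag_program (n := n) K A.msg v
  obtain ⟨P3, hl3, h3⟩ := simulates_guess A hC hK.ge w slot x y
  have hl4 : (acceptProg (K := K) n A.out b').length ≤ 2 := by
    cases b' <;> simp [acceptProg]
  let T : List (Instr M (Pos n ↪ Fin M)) := compile w P2 ++ P3 ++ compile w (acceptProg n A.out b')
  refine ⟨⟨M, P1 ++ T, w (anc 13 0)⟩, ?_, fun g => ?_⟩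
  · have hM : M = A.qubits + 16 * (K + 1) := by simp [M]
    have hc2 := length_compile w P2
    have hc4 := length_compile w (acceptProg (K := K) n A.out b')
    simp only [PRFAdversary.size, T, List.length_append, CCAAdversary.size]
    set X := n + C.length + 1 with hX
    have e1 : 400 * (A.qubits + A.find.length + A.guess.length + 1) * X =
        400 * (A.qubits * X) + 400 * (A.find.length * X) + 400 * (A.guess.length * X) + 400 * X := by
      ring
    have e2 : A.find.length * (250 * X) = 250 * (A.find.length * X) := by ring
    have e3 : A.guess.length * (250 * X) = 250 * (A.guess.length * X) := by ring
    have e4 : A.qubits ≤ A.qubits * X := Nat.le_mul_of_pos_right _ (by omega)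
    rw [e1]
    rw [e2] at hl1
    rw [e3] at hl3
    omega
  · set F := slotPair slot g h with hF
    set c := Sum.elim x (y.getD (g x)) with hc
    set ρ := run (pairOracle (pairQpk F) (pairDec F)) A.find (zeroState A.qubits) with hρ
    have hE : IsEffect fun σ => outcomeProb (w (anc 13 0)) true (run (prfOracle g) T σ) :=
      (isEffect_outcomeProb _ _).comp (isQuantumOp_run (isQuantumOp_prfOracle g) T)
    -- The circuit cannot select an outcome, so it carries the mixture over all messages `v'` and
    -- records in a flag whether `v' = v`.
    have hP1 : run (prfOracle g) P1 (zeroState M) =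
        ∑ v', embedState w (fun _ => false) (postMeasure A.msg v' ρ) := by
      have h1g := h1 g (zeroState A.qubits)
      beta_reduce at h1g
      rw [← embedState_zeroState w, h1g, measureWires_eq_sum, embedState_sum]
    change outcomeProb (w (anc 13 0)) true (run (prfOracle g) (P1 ++ T) (zeroState M)) = _
    rw [run_append, hP1, hE.map_sum]
    have hflag : ∀ v', run (prfOracle g) (compile w P2)
        (embedState w (fun _ => false) (postMeasure A.msg v' ρ)) =
          embedState w (flagAnc K (decide (v' = v))) (postMeasure A.msg v' ρ) := by
      intro v'
      refine run_compile_embedState_of_support w g P2 (U := fun u => u ∘ A.msg = v') ?_ ?_ ?_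
      · intro u hu
        rw [h2]
        have hu' : (fun j => Sum.elim u (fun _ : Ancilla K => false) (Sum.inl (A.msg j))) = v' := hu
        rw [hu']
        refine (xorAt_inr (z := fun _ : Unit => ((12, Fin.ofNat (K + 1) 0) : Ancilla K))
          (fun _ _ _ => rfl) _ u _).trans ?_
        congr 1
        funext p
        by_cases hp : p = (12, Fin.ofNat (K + 1) 0)
        · rw [hp]
          refine (xorAt_apply (z := fun _ : Unit => ((12, Fin.ofNat (K + 1) 0) : Ancilla K))
            (fun _ _ _ => rfl) (fun _ => decide (v' = v)) (fun _ => false) ()).trans ?_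
          rw [flagAnc, if_pos rfl, Bool.false_xor]
        · rw [xorAt_of_ne _ _ fun _ hh => hp hh.symm, flagAnc, if_neg hp]
      · intro s q
        rw [h2, xorAt_of_ne _ _ fun _ => anc_ne_inl _ _ _]
      · intro s t hst
        rw [postMeasure_apply, if_neg hst]
    -- Only the branch with the prescribed messages can be accepted, because the final Toffoli gate
    -- is controlled by the flag.
    have hterm : ∀ v', outcomeProb (w (anc 13 0)) true (run (prfOracle g) T
        (embedState w (fun _ => false) (postMeasure A.msg v' ρ))) =
          if v' = v then gameProb A F v b' c else 0 := by
      intro v'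
      simp only [T, run_append]
      rw [hflag, h3 (g, decide (v' = v)), outcomeProb_run_compile]
      have h13 : ∀ (b : Bool) (u : Fin A.qubits → Bool), Sum.elim u (storeChal c (flagAnc K b)) (anc 13 0) = false :=
        fun b u =>
        (storeChal_of_ne c _ _ (by decide) (by decide) (by decide)).trans
          (flagAnc_of_ne b (by decide) _)
      have h12 : ∀ (b : Bool) (u : Fin A.qubits → Bool), Sum.elim u (storeChal c (flagAnc K b)) (anc 12 0) = b := fun b u =>
        (storeChal_of_ne c _ _ (by decide) (by decide) (by decide)).trans (if_pos rfl)
      have hacc : ∀ u : Fin A.qubits → Bool, evalProg g (acceptProg n A.out b')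
          (Sum.elim u (storeChal c (flagAnc K (decide (v' = v))))) (anc 13 0) = true ↔
            u A.out = b' ∧ v' = v := fun u => by
        rw [evalProg_acceptProg _ _ _ _ (h13 _ _), h12, decide_eq_true_iff, Sum.elim_inl]
      change (∑ u, if evalProg g (acceptProg n A.out b')
          (Sum.elim u (storeChal c (flagAnc K (decide (v' = v))))) (anc 13 0) = true then
            (run (pairOracle (pairQpk F) (puncture c (pairDec F))) A.guess
              (prepare A.chal (ket c) (findState A F v')) u u).re else 0) = _
      simp only [hacc]
      by_cases hv : v' = v
      · subst hv
        simp only [and_true, if_true]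
        rfl
      · simp only [hv, and_false, if_false, Finset.sum_const_zero]
    simp only [hterm, Finset.sum_ite_eq', Finset.mem_univ, if_true]

end Reduction

/-! ### The game as a combination of games with a fixed challenge -/

/-- The pair of functions of a decryption key. -/
def keyPair (f : KeyedFun) (n : ℕ) (dk : Bits n × Bits n) : Bool → Bits n → Bits (3 * n) :=
  fun b => if b then f n dk.2 else f n dk.1

theorem ccaOracle_bitScheme (f : KeyedFun) (n : ℕ) (dk : Bits n × Bits n)
    (D : (Pos n → Bool) → Option Bool) {m : ℕ} :
    (ccaOracle (bitScheme f n) dk D : CCAQuery m (Bool × Pos n) (Pos n) → Op (Fin m) → Op (Fin m)) =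
      pairOracle (pairQpk (keyPair f n dk)) D := by
  funext o ρ
  cases o <;> rfl

theorem dec_bitScheme (f : KeyedFun) (n : ℕ) (dk : Bits n × Bits n) :
    (bitScheme f n).dec dk = pairDec (keyPair f n dk) := rfl

theorem norm_graphState_sq {n : ℕ} (g : Bits n → Bits (3 * n)) (c : Pos n → Bool) :
    ‖graphState g c‖ ^ 2 = if c ∘ Sum.inr = g (c ∘ Sum.inl) then ((2 : ℝ) ^ n)⁻¹ else 0 := by
  rw [graphState]
  split_ifs
  · rw [norm_div, norm_one, Complex.norm_real, Real.norm_of_nonneg (Real.sqrt_nonneg _), div_pow,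
      Real.sq_sqrt (by positivity), one_pow, one_div]
  · simp

/-- The half of the public key that is not measured sums to its norm, which is 1. -/
theorem encProb_bitScheme (f : KeyedFun) (n : ℕ) (dk : Bits n × Bits n) (b : Bool) (c : Pos n → Bool) :
    (bitScheme f n).encProb dk b c =
      if c ∘ Sum.inr = keyPair f n dk b (c ∘ Sum.inl) then ((2 : ℝ) ^ n)⁻¹ else 0 := by
  rw [← norm_graphState_sq]
  have h1 : ∀ s, ‖((bitScheme f n).enc b c *ᵥ (bitScheme f n).qpk dk) s‖ ^ 2 =
      if (fun i => s (b, i)) = c then ‖graphState (f n dk.1) (fun i => s (false, i))‖ ^ 2 *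
        ‖graphState (f n dk.2) (fun i => s (true, i))‖ ^ 2 else 0 := by
    intro s
    have : ((bitScheme f n).enc b c *ᵥ (bitScheme f n).qpk dk) s =
        (if (fun i => s (b, i)) = c then 1 else 0) * (graphState (f n dk.1) (fun i => s (false, i)) *
          graphState (f n dk.2) (fun i => s (true, i))) := Matrix.mulVec_diagonal _ _ _
    rw [this]
    split_ifs
    · rw [one_mul, norm_mul, mul_pow]
    · simp
  rw [BitQPKE.encProb]
  simp only [h1]
  rw [← ((Equiv.boolArrowEquivProd (Pos n → Bool)).symm.trans
      (Equiv.curry Bool (Pos n) Bool).symm).sum_comp, Fintype.sum_prod_type]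
  cases b
  · calc _ = ∑ a : Pos n → Bool, ∑ a' : Pos n → Bool, (if a = c then
          ‖graphState (f n dk.1) a‖ ^ 2 * ‖graphState (f n dk.2) a'‖ ^ 2 else 0) := rfl
      _ = ∑ a : Pos n → Bool, if a = c then ‖graphState (f n dk.1) a‖ ^ 2 else 0 := by
        refine Finset.sum_congr rfl fun a _ => ?_
        split_ifs
        · rw [← Finset.mul_sum, graphState_norm, mul_one]
        · simp
      _ = _ := by
        rw [Finset.sum_ite_eq' Finset.univ c, if_pos (Finset.mem_univ _)]
        rfl
  · calc _ = ∑ a : Pos n → Bool, ∑ a' : Pos n → Bool, (if a' = c then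
          ‖graphState (f n dk.1) a‖ ^ 2 * ‖graphState (f n dk.2) a'‖ ^ 2 else 0) := rfl
      _ = ∑ a : Pos n → Bool, ‖graphState (f n dk.1) a‖ ^ 2 * ‖graphState (f n dk.2) c‖ ^ 2 := by
        simp
      _ = _ := by
        rw [← Finset.sum_mul, graphState_norm, one_mul]
        rfl

theorem ccaOutputProb_bitScheme (f : KeyedFun) (n : ℕ) (A : CCAAdversary (Bool × Pos n) (Pos n))
    (dk : Bits n × Bits n) (b b' : Bool) :
    ccaOutputProb (bitScheme f n) A dk b b' = ∑ v : Bits 2, uniformAvg fun x : Bits n =>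
      gameProb A (keyPair f n dk) v b'
        (Sum.elim x (keyPair f n dk (v (if b then 1 else 0)) x)) := by
  have h1 : ∀ v : Bits 2, ∑ c : Pos n → Bool, (bitScheme f n).encProb dk (v (if b then 1 else 0)) c *
      gameProb A (keyPair f n dk) v b' c = uniformAvg fun x : Bits n =>
        gameProb A (keyPair f n dk) v b'
          (Sum.elim x (keyPair f n dk (v (if b then 1 else 0)) x)) := by
    intro v
    simp only [encProb_bitScheme]
    rw [← (Equiv.sumArrowEquivProdArrow (Fin n) (Fin (3 * n)) Bool).symm.sum_comp,
      Fintype.sum_prod_type, uniformAvg, Finset.sum_div]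
    refine Finset.sum_congr rfl fun x _ => ?_
    calc _ = ∑ y : Bits (3 * n), (if y = keyPair f n dk (v (if b then 1 else 0)) x then
          ((2 : ℝ) ^ n)⁻¹ else 0) * gameProb A (keyPair f n dk) v b' (Sum.elim x y) := rfl
      _ = _ := by
        simp only [ite_mul, zero_mul, Finset.sum_ite_eq', Finset.mem_univ, if_true]
        rw [div_eq_inv_mul]
        congr 2
        simp
  rw [ccaOutputProb, ← Finset.sum_congr rfl fun v _ => h1 v]
  simp only [ccaOracle_bitScheme, dec_bitScheme]
  rfl

/-! ### Averages -/

section Avg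

variable {α β : Type} [Fintype α] [Fintype β]

theorem uniformAvg_mono {F G : α → ℝ} (h : ∀ a, F a ≤ G a) : uniformAvg F ≤ uniformAvg G :=
  div_le_div_of_nonneg_right (Finset.sum_le_sum fun a _ => h a) (Nat.cast_nonneg _)

theorem uniformAvg_add_const [Nonempty α] (F : α → ℝ) (c : ℝ) :
    uniformAvg (fun a => F a + c) = uniformAvg F + c := by
  have : (Fintype.card α : ℝ) ≠ 0 := Nat.cast_ne_zero.2 Fintype.card_ne_zero
  rw [uniformAvg, uniformAvg, Finset.sum_add_distrib, Finset.sum_const, Finset.card_univ, nsmul_eq_mul]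
  field_simp

theorem uniformAvg_const [Nonempty α] (c : ℝ) : uniformAvg (fun _ : α => c) = c := by
  have : (Fintype.card α : ℝ) ≠ 0 := Nat.cast_ne_zero.2 Fintype.card_ne_zero
  rw [uniformAvg, Finset.sum_const, Finset.card_univ, nsmul_eq_mul]
  field_simp

theorem uniformAvg_comm (F : α → β → ℝ) :
    uniformAvg (fun a => uniformAvg (F a)) = uniformAvg fun b => uniformAvg fun a => F a b := by
  simp only [uniformAvg, ← Finset.sum_div]
  rw [Finset.sum_comm, div_right_comm]

theorem uniformAvg_sum {κ : Type} (s : Finset κ) (F : κ → α → ℝ) :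
    uniformAvg (fun a => ∑ i ∈ s, F i a) = ∑ i ∈ s, uniformAvg (F i) := by
  simp only [uniformAvg, ← Finset.sum_div]
  rw [Finset.sum_comm]

theorem uniformAvg_prod (F : α × β → ℝ) :
    uniformAvg F = uniformAvg fun a => uniformAvg fun b => F (a, b) := by
  simp only [uniformAvg, ← Finset.sum_div, Fintype.sum_prod_type, Fintype.card_prod, Nat.cast_mul]
  rw [div_div, mul_comm]

end Avg

/-- The two keys are independent and identically distributed, so either may be called the attacked
one. -/
theorem uniformAvg_keyPair (f : KeyedFun) (n : ℕ) (slot : Bool)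
    (G : (Bool → Bits n → Bits (3 * n)) → ℝ) :
    uniformAvg (fun dk : Bits n × Bits n => G (keyPair f n dk)) =
      uniformAvg fun k' : Bits n => uniformAvg fun k : Bits n => G (slotPair slot (f n k) (f n k')) := by
  have h0 : ∀ k k' : Bits n, keyPair f n (k, k') = slotPair false (f n k) (f n k') := fun k k' => by
    funext b; cases b <;> rfl
  have h1 : ∀ k k' : Bits n, keyPair f n (k', k) = slotPair true (f n k) (f n k') := fun k k' => by
    funext b; cases b <;> rfl
  rw [uniformAvg_prod]
  cases slot
  · rw [uniformAvg_comm]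
    simp only [h0]
  · simp only [h1]

theorem uniformAvg_gameProb_le {n : ℕ} (A : CCAAdversary (Bool × Pos n) (Pos n)) (slot : Bool)
    (h : Bits n → Bits (3 * n)) (v : Bits 2) (b' : Bool) :
    uniformAvg (fun g : Bits n → Bits (3 * n) => uniformAvg fun x : Bits n =>
        gameProb A (slotPair slot g h) v b' (Sum.elim x (g x))) ≤
      uniformAvg (fun g : Bits n → Bits (3 * n) => uniformAvg fun x : Bits n =>
        uniformAvg fun y : Bits (3 * n) => gameProb A (slotPair slot g h) v b' (Sum.elim x y)) +
          6 * A.size * stepError n := by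
  have key := sum_gameProb_le A slot h v b'
  have hG : (0 : ℝ) < Fintype.card (Bits n → Bits (3 * n)) := Nat.cast_pos.2 Fintype.card_pos
  have hX : (0 : ℝ) < Fintype.card (Bits n) := Nat.cast_pos.2 Fintype.card_pos
  have hY : (0 : ℝ) < Fintype.card (Bits (3 * n)) := Nat.cast_pos.2 Fintype.card_pos
  simp only [uniformAvg, ← Finset.sum_div]
  simp only [Finset.sum_const, Finset.card_univ, nsmul_eq_mul, ← Finset.mul_sum] at key
  generalize (Fintype.card (Bits n → Bits (3 * n)) : ℝ) = cG at *
  generalize (Fintype.card (Bits n) : ℝ) = cX at *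
  generalize (Fintype.card (Bits (3 * n)) : ℝ) = cY at *
  rw [div_div, div_div, div_div, div_add' _ _ _ (by positivity),
    div_le_div_iff₀ (by positivity) (by positivity)]
  nlinarith [mul_le_mul_of_nonneg_right key (by positivity : 0 ≤ cX * cG)]

/-! ### Security -/

/-- One bound has to cover exponentially many parameters. As adversaries are non-uniform, the worst
parameters at each `n` can be hardwired. -/
theorem exists_advantage_bound {f : KeyedFun} (hf : IsQuantumSecurePRF f)
    (A : ∀ n, CCAAdversary (Bool × Pos n) (Pos n)) (hA : PolyBounded fun n => (A n).size) :
    ∃ μ : ℕ → ℝ, Negligible μ ∧ ∀ n (slot : Bool) (v : Bits 2) (b' : Bool) (k' x : Bits n)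
      (y : Option (Bits (3 * n))),
        |uniformAvg (fun k : Bits n => gameProb (A n) (slotPair slot (f n k) (f n k')) v b'
            (Sum.elim x (y.getD (f n k x)))) -
          uniformAvg (fun g : Bits n → Bits (3 * n) => gameProb (A n) (slotPair slot g (f n k')) v b'
            (Sum.elim x (y.getD (g x))))| ≤ μ n := by
  obtain ⟨⟨C, out, ⟨q, hq⟩, hout⟩, hsec⟩ := hf
  obtain ⟨p, hp⟩ := hA
  let Param : ℕ → Type := fun n => Bool × Bits 2 × Bool × Bits n × Bits n × Option (Bits (3 * n))
  let D : ∀ n, Param n → (Bits n → Bits (3 * n)) → ℝ := fun n t g =>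
    gameProb (A n) (slotPair t.1 g (f n t.2.2.2.1)) t.2.1 t.2.2.1
      (Sum.elim t.2.2.2.2.1 (t.2.2.2.2.2.getD (g t.2.2.2.2.1)))
  -- There are finitely many parameters at each `n`, so the maximal advantage is attained.
  have hmax : ∀ n, ∃ t0 : Param n, ∀ t : Param n,
      |uniformAvg (fun k : Bits n => D n t (f n k)) - uniformAvg (D n t)| ≤
        |uniformAvg (fun k : Bits n => D n t0 (f n k)) - uniformAvg (D n t0)| := fun n => by
    have : Finite (Param n) := by dsimp only [Param]; infer_instance
    have : Nonempty (Param n) := by dsimp only [Param]; infer_instance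
    exact Finite.exists_max _
  choose t ht using hmax
  have hB : ∀ n, ∃ B : PRFAdversary n,
      B.size ≤ 400 * ((A n).size + 1) * (n + (C n).length + 1) ∧ ∀ g, B.acceptProb g = D n (t n) g :=
    fun n => exists_reduction (A n) ⟨out n, (t n).2.2.2.1, hout n _⟩ (t n).1 (t n).2.1 (t n).2.2.1
      (t n).2.2.2.2.1 (t n).2.2.2.2.2
  choose B hBs hBp using hB
  obtain ⟨μ, hμ, h⟩ := hsec B ⟨400 * (p + 1) * (Polynomial.X + q + 1), fun n => (hBs n).trans (by
    simp only [Polynomial.eval_mul, Polynomial.eval_add, Polynomial.eval_one, Polynomial.eval_X,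
      Polynomial.eval_ofNat]
    have := hp n
    have := hq n
    gcongr)⟩
  refine ⟨μ, hμ, fun n slot v b' k' x y => ?_⟩
  refine (ht n (slot, v, b', k', x, y)).trans ?_
  have h1 := h n
  simp only [hBp] at h1
  exact h1

theorem superpolynomialDecay_stepError : Negligible stepError := by
  intro z
  refine tendsto_pow_const_mul_const_pow_of_abs_lt_one z ?_
  rw [abs_of_pos (by positivity)]
  refine inv_lt_one_of_one_lt₀ ?_
  rw [Real.lt_sqrt (by norm_num)]
  norm_num

/-- For each bit `b` and messages `v`, the slot under attack is known and its challenge is exchanged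
at cost `δ`: one `μ` to leave the PRF, the statistical error, and one `μ` to return. -/
theorem ccaWinProb_le {f : KeyedFun} {n : ℕ} (A : CCAAdversary (Bool × Pos n) (Pos n)) {μ : ℝ}
    (hμ : ∀ (slot : Bool) (v : Bits 2) (b' : Bool) (k' x : Bits n) (y : Option (Bits (3 * n))),
        |uniformAvg (fun k : Bits n => gameProb A (slotPair slot (f n k) (f n k')) v b'
            (Sum.elim x (y.getD (f n k x)))) -
          uniformAvg (fun g : Bits n → Bits (3 * n) => gameProb A (slotPair slot g (f n k')) v b'
            (Sum.elim x (y.getD (g x))))| ≤ μ) :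
    ccaWinProb (bitScheme f n) A ≤ 1 / 2 + 4 * (2 * μ + 6 * A.size * stepError n) := by
  set δ := 2 * μ + 6 * A.size * stepError n with hδ
  -- a real challenge can be replaced by a random one
  have hslot : ∀ (slot : Bool) (v : Bits 2) (b' : Bool) (k' : Bits n),
      uniformAvg (fun k : Bits n => uniformAvg fun x : Bits n =>
        gameProb A (slotPair slot (f n k) (f n k')) v b' (Sum.elim x (f n k x))) ≤
      uniformAvg (fun k : Bits n => uniformAvg fun x : Bits n => uniformAvg fun y : Bits (3 * n) =>
        gameProb A (slotPair slot (f n k) (f n k')) v b' (Sum.elim x y)) + δ := by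
    intro slot v b' k'
    have h1 : uniformAvg (fun k : Bits n => uniformAvg fun x : Bits n =>
        gameProb A (slotPair slot (f n k) (f n k')) v b' (Sum.elim x (f n k x))) ≤
        uniformAvg (fun g : Bits n → Bits (3 * n) => uniformAvg fun x : Bits n =>
          gameProb A (slotPair slot g (f n k')) v b' (Sum.elim x (g x))) + μ := by
      rw [uniformAvg_comm, uniformAvg_comm (α := Bits n → Bits (3 * n)), ← uniformAvg_add_const]
      refine uniformAvg_mono fun x => ?_
      -- `none` stands for the real challenge, whose second half comes from the oracle.
      have := (abs_le.1 (hμ slot v b' k' x none)).2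
      simp only [Option.getD_none] at this
      linarith
    have h2 := uniformAvg_gameProb_le A slot (f n k') v b'
    have h3 : uniformAvg (fun g : Bits n → Bits (3 * n) => uniformAvg fun x : Bits n =>
        uniformAvg fun y : Bits (3 * n) => gameProb A (slotPair slot g (f n k')) v b' (Sum.elim x y)) ≤
        uniformAvg (fun k : Bits n => uniformAvg fun x : Bits n => uniformAvg fun y : Bits (3 * n) =>
          gameProb A (slotPair slot (f n k) (f n k')) v b' (Sum.elim x y)) + μ := by
      rw [uniformAvg_comm, uniformAvg_comm (α := Bits n) (β := Bits n), ← uniformAvg_add_const]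
      refine uniformAvg_mono fun x => ?_
      rw [uniformAvg_comm, uniformAvg_comm (α := Bits n), ← uniformAvg_add_const]
      refine uniformAvg_mono fun y => ?_
      -- On the way back the challenge is the constant `(x, y)`.
      have := (abs_le.1 (hμ slot v b' k' x (some y))).1
      simp only [Option.getD_some] at this
      linarith
    linarith
  -- the same for a random decryption key
  have hkey : ∀ (b : Bool) (v : Bits 2), uniformAvg (fun dk : Bits n × Bits n =>
      uniformAvg fun x : Bits n => gameProb A (keyPair f n dk) v b
        (Sum.elim x (keyPair f n dk (v (if b then 1 else 0)) x))) ≤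
      uniformAvg (fun dk : Bits n × Bits n => uniformAvg fun x : Bits n =>
        uniformAvg fun y : Bits (3 * n) => gameProb A (keyPair f n dk) v b (Sum.elim x y)) + δ := by
    intro b v
    set slot := v (if b then 1 else 0)
    rw [uniformAvg_keyPair f n slot fun F => uniformAvg fun x : Bits n =>
        gameProb A F v b (Sum.elim x (F slot x)),
      uniformAvg_keyPair f n slot fun F => uniformAvg fun x : Bits n =>
        uniformAvg fun y : Bits (3 * n) => gameProb A F v b (Sum.elim x y), ← uniformAvg_add_const]
    refine uniformAvg_mono fun k' => ?_
    refine le_trans (le_of_eq ?_) (hslot slot v b k')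
    simp only [slotPair, if_true]
  have hideal : ∑ b : Bool, ∑ v : Bits 2, uniformAvg (fun dk : Bits n × Bits n =>
      uniformAvg fun x : Bits n => uniformAvg fun y : Bits (3 * n) =>
        gameProb A (keyPair f n dk) v b (Sum.elim x y)) = 1 := by
    simp only [← uniformAvg_sum]
    have : ∀ dk x y, ∑ b : Bool, ∑ v : Bits 2,
        gameProb A (keyPair f n dk) v b (Sum.elim x y) = 1 := fun dk x y => by
      rw [Finset.sum_comm]
      exact sum_gameProb_eq_one A _ _
    simp only [this, uniformAvg_const]
  have hwin : ccaWinProb (bitScheme f n) A = (∑ b : Bool, ∑ v : Bits 2,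
      uniformAvg (fun dk : Bits n × Bits n => uniformAvg fun x : Bits n =>
        gameProb A (keyPair f n dk) v b
          (Sum.elim x (keyPair f n dk (v (if b then 1 else 0)) x)))) / 2 := by
    have h1 : ∀ dk, ((bitScheme f n).gen dk).toReal = ((Fintype.card (Bits n × Bits n) : ℝ))⁻¹ := by
      intro dk
      change (PMF.uniformOfFintype (Bits n × Bits n) dk).toReal = _
      rw [PMF.uniformOfFintype_apply, ENNReal.toReal_inv, ENNReal.toReal_natCast]
    simp only [ccaWinProb, h1]
    rw [← Finset.mul_sum, ← div_eq_inv_mul]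
    simp only [ccaOutputProb_bitScheme]
    change uniformAvg (fun dk : Bits n × Bits n => _) = _
    rw [uniformAvg_comm, uniformAvg, Fintype.card_bool]
    simp only [uniformAvg_sum]
    norm_num
  rw [hwin]
  have hle : ∑ b : Bool, ∑ v : Bits 2, uniformAvg (fun dk : Bits n × Bits n =>
      uniformAvg fun x : Bits n => gameProb A (keyPair f n dk) v b
        (Sum.elim x (keyPair f n dk (v (if b then 1 else 0)) x))) ≤ 1 + 8 * δ := by
    -- Two bits times four message pairs give eight terms with error `δ`.
    refine (Finset.sum_le_sum fun b _ => Finset.sum_le_sum fun v _ => hkey b v).trans (le_of_eq ?_)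
    simp only [Finset.sum_add_distrib, hideal, Finset.sum_const, Finset.card_univ]
    simp
    ring
  linarith

end QuantumPKE

theorem mainTheorem6 (f : QuantumPKE.KeyedFun) (hf : QuantumPKE.IsQuantumSecurePRF f) :
    QuantumPKE.CCASecure (QuantumPKE.bitScheme f) := by
  intro A hA
  obtain ⟨μ, hμ, h⟩ := QuantumPKE.exists_advantage_bound hf A hA
  obtain ⟨p, hp⟩ := hA
  have h1 := QuantumPKE.superpolynomialDecay_stepError.polynomial_mul (p.map (Nat.castRingHom ℝ))
  -- The constants come from `4 * (2 * μ + 6 * size * stepError)`; the size is bounded by its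
  -- polynomial to keep the error negligible.
  refine ⟨_, (hμ.const_mul 8).add (h1.const_mul 24), fun n =>
    (QuantumPKE.ccaWinProb_le (A n) (h n)).trans ?_⟩
  have h2 : ((A n).size : ℝ) ≤ (p.map (Nat.castRingHom ℝ)).eval (n : ℝ) := by
    have h3 : (p.map (Nat.castRingHom ℝ)).eval (n : ℝ) = ((p.eval n : ℕ) : ℝ) :=
      Polynomial.eval_natCast_map (Nat.castRingHom ℝ) p n
    rw [h3]
    exact_mod_cast hp n
  have h4 := mul_le_mul_of_nonneg_right h2 (QuantumPKE.stepError_pos n).le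
  simp only [Pi.add_apply]
  linarith
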